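/- Work over $\mathbb C$. Take 18 variables, arranged as $\boldsymbol p={}^t(p_1,p_2,p_3)$, $p_4$, $\boldsymbol q={}^t(q_1,q_2,q_3)$, $r$, $u$, a symmetric matrix $S=(s_{ij})_{1\le i,j\le 3}$ and $\boldsymbol t={}^t(t_1,t_2,t_3)$. Let $S_\Sigma$ be the polynomial ring in these variables, let $$A=\begin{pmatrix}0&-q_3&q_2\\ q_3&0&-q_1\\ -q_2&q_1&0\end{pmatrix},$$ and let $S^\dagger$ be the adjugate of $S$. Let $\Sigma^{14}_{\mathbb A}\subset\mathbb A^{18}$ be the affine scheme defined by the nine equations $${}^t\boldsymbol p\boldsymbol q=0,\quad (rI+AS)\boldsymbol p=-p_4A\boldsymbol t,\quad {}^t\boldsymbol pS\boldsymbol p+p_4\,{}^t\boldsymbol p\boldsymbol t=0,\quad u\boldsymbol p=(rI-AS)A\boldsymbol t,\quad up_4=-(r^2+{}^t\boldsymbol qS^\dagger\boldsymbol q),$$ and let $R_\Sigma$ be the quotient of $S_\Sigma$ by the ideal generated by these equations. Let $\Sigma^{13}_{\mathbb A}\subset\mathbb A^{17}$ be obtained from $\Sigma^{14}_{\mathbb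 A}$ by setting $s_{33}=1$. A weight system $w$ assigns an integer to each variable so that all nine equations are homogeneous; we extend $w$ to monomials additively. Put $$d_0=w(p_1)+w(q_1),\quad d_i=w(r)+w(p_i)\ (i=1,2,3),\quad d_4=-d_0+w(p_1p_2p_3)+w(r),$$ $$d_{4+i}=w(u)+w(p_i)\ (i=1,2,3),\quad d_8=2w(r),\quad \delta=2w(r)+w(u)+w(p_1p_2p_3).$$ (1) $R_\Sigma$ has a free resolution over $S_\Sigma$ $$0\leftarrow R_\Sigma\leftarrow P_0\leftarrow P_1\leftarrow P_2\leftarrow P_3\leftarrow P_4\leftarrow 0$$ which, for every weight system $w$, is graded with respect to $w$, where $$P_0=S_\Sigma,\qquad P_1=\bigoplus_{i=0}^8S_\Sigma(-d_i),\qquad P_3=\bigoplus_{i=0}^8S_\Sigma(d_i-\delta),\qquad P_4=S_\Sigma(-\delta),$$ $$\begin{aligned}P_2={}&S_\Sigma(-(w(r)+d_0))\oplus S_\Sigma(-(w(u)+d_0))\oplus\bigoplus_{i=1}^3S_\Sigma(-w(rup_i))\oplus\bigoplus_{i=1}^3S_\Sigma(-w(r^2p_i))\\&\oplus\bigoplus_{i=1}^3S_\Sigma(-\delta+w(r^2p_i))\oplus\bigoplus_{i=1}^3S_\Sigma(-\delta+w(rup_i))\oplus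 S_\Sigma(-\delta+w(r)+d_0)\oplus S_\Sigma(-\delta+w(u)+d_0).\end{aligned}$$ Moreover, if all weights are positive and $\Sigma^{13}_{\mathbb P}=\operatorname{Proj}R_\Sigma$ is the resulting weighted projectivization (a normal projective variety of dimension 13), then its canonical divisor satisfies $$K_{\Sigma^{13}_{\mathbb P}}=\mathcal O(-k),\qquad k=3\delta-2w(r)-6d_0-w(u),$$ where $\mathcal O(m)$ is the sheaf associated with $R_\Sigma(m)$. (2) The same statements hold, with the same formulas, for the coordinate ring of $\Sigma^{13}_{\mathbb A}$ over the polynomial ring in the remaining 17 variables, for weight systems of these 17 variables (the constant $s_{33}=1$ has weight $0$), and, when these 17 weights are positive, for the weighted projectivization $\Sigma^{12}_{\mathbb P}$ of $\Sigma^{13}_{\mathbb A}$ (of dimension 12). -/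

import Mathlib

open MvPolynomial Matrix
open scoped nonZeroDivisors

noncomputable section

namespace KeyVariety

/-! ### The affine schemes `Σ¹⁴` and `Σ¹³` -/

/-- The 18 coordinates of the ambient affine space. -/
inductive Var
  | p1 | p2 | p3 | p4 | q1 | q2 | q3 | r | u
  | s11 | s12 | s13 | s22 | s23 | s33 | t1 | t2 | t3
  deriving DecidableEq

/-- The 17 coordinates that remain after `s33` is set to `1`. -/
abbrev Var13 : Type := {v : Var // v ≠ Var.s33}

section Equations

variable {A : Type} [CommRing A] (x : Var → A)

def pVec : Fin 3 → A := ![x .p1, x .p2, x .p3]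

def tVec : Fin 3 → A := ![x .t1, x .t2, x .t3]

def qVec : Fin 3 → A := ![x .q1, x .q2, x .q3]

/-- The symmetric matrix `S`. -/
def sMat : Matrix (Fin 3) (Fin 3) A :=
  !![x .s11, x .s12, x .s13;
     x .s12, x .s22, x .s23;
     x .s13, x .s23, x .s33]

/-- The skew-symmetric matrix `A` built from `q`. -/
def aMat : Matrix (Fin 3) (Fin 3) A :=
  !![0, -x .q3, x .q2;
     x .q3, 0, -x .q1;
     -x .q2, x .q1, 0]

/-- `(rI + AS) p + p₄ A t`. -/
def midVec : Fin 3 → A :=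
  (x .r • (1 : Matrix (Fin 3) (Fin 3) A) + aMat x * sMat x) *ᵥ pVec x +
    x .p4 • (aMat x *ᵥ tVec x)

/-- `u p - (rI - AS) A t`. -/
def lastVec : Fin 3 → A :=
  x .u • pVec x -
    (x .r • (1 : Matrix (Fin 3) (Fin 3) A) - aMat x * sMat x) *ᵥ (aMat x *ᵥ tVec x)

/-- The nine equations (each entry is "left-hand side minus right-hand side"), evaluated at the
coordinates `x`. -/
def equations : Fin 9 → A :=
  ![pVec x ⬝ᵥ qVec x,
    midVec x 0, midVec x 1, midVec x 2,
    pVec x ⬝ᵥ (sMat x *ᵥ pVec x) + x .p4 * (pVec x ⬝ᵥ tVec x),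
    lastVec x 0, lastVec x 1, lastVec x 2,
    x .u * x .p4 + (x .r ^ 2 + qVec x ⬝ᵥ ((sMat x).adjugate *ᵥ qVec x))]

end Equations

/-- The equations of `Σ¹⁴` in the polynomial ring in 18 variables. -/
def equations14 : Fin 9 → MvPolynomial Var ℂ := equations X

/-- The equations of `Σ¹³` in the polynomial ring in 17 variables: `s33` is set to `1`. -/
def equations13 : Fin 9 → MvPolynomial Var13 ℂ :=
  equations fun v => if h : v = Var.s33 then 1 else X ⟨v, h⟩

/-- The ideal of `Σ¹⁴`; the coordinate ring of `Σ¹⁴` is the quotient by it. -/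
def ideal14 : Ideal (MvPolynomial Var ℂ) := Ideal.span (Set.range equations14)

/-- The ideal of `Σ¹³`. -/
def ideal13 : Ideal (MvPolynomial Var13 ℂ) := Ideal.span (Set.range equations13)

/-! ### Weights -/

section Weights

/-- Integer weights of the variables for which every one of the given polynomials is
homogeneous. -/
def IsWeightSystem {σ : Type} (e : Fin 9 → MvPolynomial σ ℂ) (w : σ → ℤ) : Prop :=
  ∀ i, ∃ n : ℤ, IsWeightedHomogeneous w (e i) n

/-- Weights of the 17 variables, extended to all 18 coordinates: the constant `s33 = 1` has
weight `0`. -/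
def extendWeight (w : Var13 → ℤ) : Var → ℤ :=
  fun v => if h : v = Var.s33 then 0 else w ⟨v, h⟩

variable (w : Var → ℤ)

def d₀ : ℤ := w .p1 + w .q1

def δ : ℤ := 2 * w .r + w .u + (w .p1 + w .p2 + w .p3)

/-- The degrees `d₀, …, d₈` of the nine equations. -/
def degs : Fin 9 → ℤ :=
  ![d₀ w,
    w .r + w .p1, w .r + w .p2, w .r + w .p3,
    -d₀ w + (w .p1 + w .p2 + w .p3) + w .r,
    w .u + w .p1, w .u + w .p2, w .u + w .p3,
    2 * w .r]

/-- `P₀ = S`, with one generator in degree `0`. -/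
def twist0 : Fin 1 → ℤ := ![0]

/-- Degrees of the generators of `P₁ = ⊕ S(-dᵢ)`. -/
def twist1 : Fin 9 → ℤ := degs w

/-- Degrees of the sixteen generators of `P₂`. -/
def twist2 : Fin 16 → ℤ :=
  ![w .r + d₀ w, w .u + d₀ w,
    w .r + w .u + w .p1, w .r + w .u + w .p2, w .r + w .u + w .p3,
    2 * w .r + w .p1, 2 * w .r + w .p2, 2 * w .r + w .p3,
    δ w - (2 * w .r + w .p1), δ w - (2 * w .r + w .p2), δ w - (2 * w .r + w .p3),
    δ w - (w .r + w .u + w .p1), δ w - (w .r + w .u + w .p2), δ w - (w .r + w .u + w .p3),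
    δ w - (w .r + d₀ w), δ w - (w .u + d₀ w)]

/-- Degrees of the generators of `P₃ = ⊕ S(dᵢ - δ)`. -/
def twist3 : Fin 9 → ℤ := fun i => δ w - degs w i

/-- `P₄ = S(-δ)`. -/
def twist4 : Fin 1 → ℤ := ![δ w]

/-- The number `k` with `K = O(-k)`. -/
def canonicalIndex : ℤ := 3 * δ w - 2 * w .r - 6 * d₀ w - w .u

end Weights

/-! ### Graded free resolutions of format `1, 9, 16, 9, 1` -/

section Resolution

variable {σ : Type}

/-- The degree `m` part of the graded free module `⊕ᵢ S(-aᵢ)`, where `S` is graded by the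
weights `w`. -/
def freePiece (w : σ → ℤ) {ι : Type} (a : ι → ℤ) (m : ℤ) :
    Submodule ℂ (ι → MvPolynomial σ ℂ) where
  carrier := {f | ∀ i, IsWeightedHomogeneous w (f i) (m - a i)}
  zero_mem' := fun _ => isWeightedHomogeneous_zero ℂ w _
  add_mem' := fun hf hg i => (hf i).add (hg i)
  smul_mem' := fun c _ hf i =>
    (weightedHomogeneousSubmodule ℂ w (m - a i)).smul_mem c (hf i)

/-- An `S`-linear map `⊕ᵢ S(-aᵢ) → ⊕ⱼ S(-bⱼ)` that preserves degrees. -/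
def IsGradedMap (w : σ → ℤ) {ι κ : Type} (a : ι → ℤ) (b : κ → ℤ)
    (φ : (ι → MvPolynomial σ ℂ) →ₗ[MvPolynomial σ ℂ] (κ → MvPolynomial σ ℂ)) : Prop :=
  ∀ m : ℤ, ∀ f ∈ freePiece w a m, φ f ∈ freePiece w b m

/-- A free resolution `0 ← S/I ← S ← S⁹ ← S¹⁶ ← S⁹ ← S ← 0` of `S/I`, whose augmentation is the
quotient map. -/
structure Resolution916 (I : Ideal (MvPolynomial σ ℂ)) where
  f₁ : (Fin 9 → MvPolynomial σ ℂ) →ₗ[MvPolynomial σ ℂ] (Fin 1 → MvPolynomial σ ℂ)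
  f₂ : (Fin 16 → MvPolynomial σ ℂ) →ₗ[MvPolynomial σ ℂ] (Fin 9 → MvPolynomial σ ℂ)
  f₃ : (Fin 9 → MvPolynomial σ ℂ) →ₗ[MvPolynomial σ ℂ] (Fin 16 → MvPolynomial σ ℂ)
  f₄ : (Fin 1 → MvPolynomial σ ℂ) →ₗ[MvPolynomial σ ℂ] (Fin 9 → MvPolynomial σ ℂ)
  exact₀ : Function.Exact f₁ (fun f : Fin 1 → MvPolynomial σ ℂ => Ideal.Quotient.mk I (f 0))
  exact₁ : Function.Exact f₂ f₁
  exact₂ : Function.Exact f₃ f₂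
  exact₃ : Function.Exact f₄ f₃
  injective₄ : Function.Injective f₄

/-- All maps of the resolution are graded of degree `0` for the weights `w` and the listed twists,
which are computed from the weights `W` of the 18 coordinates. -/
def Resolution916.IsGraded {I : Ideal (MvPolynomial σ ℂ)} (F : Resolution916 I)
    (w : σ → ℤ) (W : Var → ℤ) : Prop :=
  IsGradedMap w (twist1 W) twist0 F.f₁ ∧
  IsGradedMap w (twist2 W) (twist1 W) F.f₂ ∧
  IsGradedMap w (twist3 W) (twist2 W) F.f₃ ∧
  IsGradedMap w (twist4 W) (twist3 W) F.f₄

end Resolution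

/-! ### Differential forms of an algebra over `ℂ` -/

section Forms

variable {K : Type} [CommRing K] [Algebra ℂ K]

variable (K) in
/-- The module `Ωⁿ` of Kähler differential `n`-forms of `K` over `ℂ`. -/
abbrev DiffForms (n : ℕ) : Type := ⋀[K]^n (Ω[K⁄ℂ])

/-- The image of `Ωⁿ` of the subring `O` in `Ωⁿ` of `K`: the sums of forms `a₀ da₁ ∧ ⋯ ∧ daₙ` with
all `aᵢ` in `O`. -/
def regularForms (n : ℕ) (O : Set K) : AddSubgroup (DiffForms K n) :=
  AddSubgroup.closure
    {η | ∃ (a₀ : K) (a : Fin n → K), a₀ ∈ O ∧ (∀ i, a i ∈ O) ∧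
      η = a₀ • exteriorPower.ιMulti K n fun i => KaehlerDifferential.D ℂ K (a i)}

/-- The functions `h` for which `h η` is regular with respect to the subring `O`. -/
def formMultipliers {n : ℕ} (η : DiffForms K n) (O : Set K) : Set K :=
  {h | h • η ∈ regularForms n O}

end Forms

/-! ### The weighted projectivization `Proj (S/I)` and its canonical divisor

`R = S/I` is graded by the weights `w`. The definitions below are used for positive weights and for
`R` a normal domain, so that `Proj R` is a normal projective variety. -/

section Canonical

variable {σ : Type} (w : σ → ℤ) (I : Ideal (MvPolynomial σ ℂ))

/-- The degree `m` part of `R = S/I`. -/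
def piece (m : ℤ) : Submodule ℂ (MvPolynomial σ ℂ ⧸ I) :=
  (weightedHomogeneousSubmodule ℂ w m).map (Ideal.Quotient.mkₐ ℂ I).toLinearMap

lemma mul_mem_piece {m n : ℤ} {a b : MvPolynomial σ ℂ ⧸ I} (ha : a ∈ piece w I m)
    (hb : b ∈ piece w I n) : a * b ∈ piece w I (m + n) := by
  obtain ⟨f, hf, rfl⟩ := ha
  obtain ⟨g, hg, rfl⟩ := hb
  exact ⟨f * g, IsWeightedHomogeneous.mul hf hg, map_mul (Ideal.Quotient.mkₐ ℂ I) f g⟩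

lemma algebraMap_mem_piece (c : ℂ) : algebraMap ℂ (MvPolynomial σ ℂ ⧸ I) c ∈ piece w I 0 :=
  ⟨C c, isWeightedHomogeneous_C w c, rfl⟩

/-- Points of `Proj R`: homogeneous primes (generated by homogeneous elements) that do not contain
the irrelevant ideal. -/
def IsProjPoint (𝔭 : Ideal (MvPolynomial σ ℂ ⧸ I)) : Prop :=
  𝔭.IsPrime ∧
  (∃ s : Set (MvPolynomial σ ℂ ⧸ I), (∀ a ∈ s, ∃ m, a ∈ piece w I m) ∧ 𝔭 = Ideal.span s) ∧
  ∃ v : σ, Ideal.Quotient.mk I (X v) ∉ 𝔭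

/-- Points of codimension one of `Proj R`. -/
def IsCodimOnePoint (𝔭 : Ideal (MvPolynomial σ ℂ ⧸ I)) : Prop :=
  IsProjPoint w I 𝔭 ∧ 𝔭.height = 1

/-- Rational sections of `O(m)`: fractions `a / b` of homogeneous elements with
`deg a - deg b = m`. -/
def rationalSections (m : ℤ) : Set (FractionRing (MvPolynomial σ ℂ ⧸ I)) :=
  {f | ∃ n : ℤ, ∃ a ∈ piece w I (n + m), ∃ b ∈ piece w I n,
    b ∈ (MvPolynomial σ ℂ ⧸ I)⁰ ∧ f * algebraMap _ _ b = algebraMap _ _ a}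

/-- The stalk of `O(m)` at the point `𝔭`, inside the rational sections: fractions `a / b` of degree
`m` with `b ∉ 𝔭`. -/
def twistStalk (𝔭 : Ideal (MvPolynomial σ ℂ ⧸ I)) (m : ℤ) :
    Set (FractionRing (MvPolynomial σ ℂ ⧸ I)) :=
  {f | ∃ n : ℤ, ∃ a ∈ piece w I (n + m), ∃ b ∈ piece w I n,
    b ∈ (MvPolynomial σ ℂ ⧸ I)⁰ ∧ b ∉ 𝔭 ∧ f * algebraMap _ _ b = algebraMap _ _ a}

/-- The function field of `Proj R`: homogeneous fractions of degree `0`. -/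
def functionField : Subalgebra ℂ (FractionRing (MvPolynomial σ ℂ ⧸ I)) where
  carrier := rationalSections w I 0
  mul_mem' := by
    rintro f g ⟨m, a, ha, b, hb, hb0, h⟩ ⟨n, c, hc, d, hd, hd0, h'⟩
    rw [add_zero] at ha hc
    refine ⟨m + n, a * c, ?_, b * d, mul_mem_piece w I hb hd, mul_mem hb0 hd0, ?_⟩
    · rw [add_zero]; exact mul_mem_piece w I ha hc
    · rw [map_mul, map_mul, ← h, ← h']; ring
  add_mem' := by
    rintro f g ⟨m, a, ha, b, hb, hb0, h⟩ ⟨n, c, hc, d, hd, hd0, h'⟩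
    rw [add_zero] at ha hc
    refine ⟨m + n, a * d + b * c, ?_, b * d, mul_mem_piece w I hb hd, mul_mem hb0 hd0, ?_⟩
    · rw [add_zero]; exact add_mem (mul_mem_piece w I ha hd) (mul_mem_piece w I hb hc)
    · rw [map_add, map_mul, map_mul, map_mul, ← h, ← h']; ring
  algebraMap_mem' := by
    intro c
    refine ⟨0, algebraMap _ _ c, ?_, 1, ?_, one_mem _, ?_⟩
    · rw [add_zero]; exact algebraMap_mem_piece w I c
    · simpa using algebraMap_mem_piece w I 1
    · rw [map_one, mul_one]
      exact IsScalarTower.algebraMap_apply ℂ (MvPolynomial σ ℂ ⧸ I)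
        (FractionRing (MvPolynomial σ ℂ ⧸ I)) c

/-- The local ring of `Proj R` at the point `𝔭`, inside the function field. -/
def localRing (𝔭 : Ideal (MvPolynomial σ ℂ ⧸ I)) : Set (functionField w I) :=
  {h | (h : FractionRing (MvPolynomial σ ℂ ⧸ I)) ∈ twistStalk w I 𝔭 0}

/-- The functions `h` for which the rational section `h g` of `O(m)` is regular at the point
`𝔭`. -/
def sectionMultipliers (𝔭 : Ideal (MvPolynomial σ ℂ ⧸ I)) (m : ℤ)
    (g : FractionRing (MvPolynomial σ ℂ ⧸ I)) : Set (functionField w I) :=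
  {h | (h : FractionRing (MvPolynomial σ ℂ ⧸ I)) * g ∈ twistStalk w I 𝔭 m}

/-- `K = O(m)` on the `n`-dimensional normal variety `Proj R`: the divisor of some nonzero rational
`n`-form `η` is the divisor of some nonzero rational section `g` of `O(m)`. Equality of the divisors
is equality, at every point of codimension one, of the fractional ideals of all `h` for which `h η`
is regular, respectively for which `h g` is regular. -/
def CanonicalDivisorEq (n : ℕ) (m : ℤ) : Prop :=
  ∃ η : DiffForms (functionField w I) n, η ≠ 0 ∧ ∃ g ∈ rationalSections w I m, g ≠ 0 ∧
    ∀ 𝔭 : Ideal (MvPolynomial σ ℂ ⧸ I), IsCodimOnePoint w I 𝔭 →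
      formMultipliers η (localRing w I 𝔭) = sectionMultipliers w I 𝔭 m g

end Canonical

end KeyVariety

end

/-!
The coordinate ring has an explicit self-dual complex `0 → S → S⁹ → S¹⁶ → S⁹ → S`, written with the
dot and cross products of the vectors `p`, `q`, `t`, `q × t`, `S p + p₄ t`, `S (q × t)` and `S† q`.
Multiplication by each of the four elements `p · q`, `t · (u p - r (q × t) + q × S (q × t))`,
`u p₄ + r² + q · S† q` and `p · (S p + p₄ t)` of the ideal is null-homotopic on it, by explicit
homotopies (`nullHomotopic_pairing`, `nullHomotopic_last`, `nullHomotopic_norm`,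
`nullHomotopic_quadric`). If `f` acts by zero up to homotopy and is regular modulo an ideal `J`, then
exactness modulo `J` at one place follows from exactness modulo `J + (f)` one place further to the
left (`ExactMod.of_homotopy`). Since the complex has length four, it is exact as soon as the four
elements form a regular sequence (`exactMod_of_regSeq`). Regularity of homogeneous elements may be
checked modulo variables; after nine variables are set to zero, three of the four elements become
monomials up to sign, and the claim is evident (`regSeq_special`). The same specialization shows
that the sequence stays regular modulo `u`, modulo `u` and `p₁`, and modulo `s₃₃ - 1`. It follows
that `u, p₁` is a regular sequence on the coordinate rings, and that everything descends to
`s₃₃ = 1` (`GoodBase`).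

For the grading, evaluating the scaling behaviour of the equations at well-chosen points shows that
a weight system satisfies the linear relations collected in `GradedCoords`. They say that `p` and
`q × t` on the one side, and `q`, `t`, `S p` on the other, have dual patterns of degrees, and that
`S` exchanges the two patterns; the degrees of all entries of the complex follow.

For the canonical divisor, the ring becomes a localized polynomial ring both where `u ≠ 0`, in the
coordinates `u, q₁, r, s₁₁` and the ten coordinates other than these and the `pᵢ`, and where `p₁ ≠ 0`,
in `p₁, p₂, p₃, p₄` and the same ten. This also shows that the ring is a domain
(`KeyCoords.isDomain`). Since `u, p₁` is a regular sequence, no prime of height one contains both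
(`notMem_of_height_one`), so every point of codimension one lies in one of the two charts.

In a chart with coordinates `x₀, x₁, …, xₙ` of degrees `w₀, …, wₙ`, the derivations
`(1/w₀) xᵢ ∂/∂xᵢ` of the function field are dual to the logarithmic differentials of the monomials
`xᵢ^{w₀} / x₀^{wᵢ}`, and the wedge product of the latter, a form `η`, has the property that `h η` is
regular at a point of codimension one with `x₀ ≠ 0` if and only if `h / (x₁ ⋯ xₙ)` is regular as a
section of `O(-(w₁ + ⋯ + wₙ))` (`Chart.mem_detSpan_iff`). So `η` for the chart `u ≠ 0` has the
divisor of the section `u / (x₁ ⋯ xₙ)` of `O(-k)` on that chart. On the other chart, `η` is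
multiplied by the determinant of a logarithmic Jacobian matrix (`Chart.exists_det_der_change`),
which is `q₁ r s₁₁ p₁² / (u p₂ p₃ p₄)` (`KeyCoords.det_logJacobian`). The factor `u` and the
coordinates combine to make the same section `u / (x₁ ⋯ xₙ)` work there, up to the unit `p₁²`.
-/

noncomputable section

namespace KeyVariety

set_option linter.unusedSectionVars false
set_option linter.unusedSimpArgs false

/-! ### The self-dual complex -/

section Complex

variable {A : Type} [CommRing A] (x : Var → A)

/-- The vector with three given entries. -/
def vec3 (a b c : A) : Fin 3 → A := ![a, b, c]

/-- The inner product of two vectors. -/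
def dot (a b : Fin 3 → A) : A := a 0 * b 0 + a 1 * b 1 + a 2 * b 2

/-- The cross product of two vectors. -/
def crs (a b : Fin 3 → A) : Fin 3 → A :=
  vec3 (a 1 * b 2 - a 2 * b 1) (a 2 * b 0 - a 0 * b 2) (a 0 * b 1 - a 1 * b 0)

/-- The symmetric matrix `S` acting on vectors. -/
def sAct (a : Fin 3 → A) : Fin 3 → A :=
  vec3 (x .s11 * a 0 + x .s12 * a 1 + x .s13 * a 2)
    (x .s12 * a 0 + x .s22 * a 1 + x .s23 * a 2)
    (x .s13 * a 0 + x .s23 * a 1 + x .s33 * a 2)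

/-- The vector `S† q`. -/
def adjVec : Fin 3 → A :=
  vec3
    (x .q1 * (x .s22 * x .s33 - x .s23 * x .s23) + x .q2 * (x .s13 * x .s23 - x .s12 * x .s33) +
      x .q3 * (x .s12 * x .s23 - x .s13 * x .s22))
    (x .q1 * (x .s13 * x .s23 - x .s12 * x .s33) + x .q2 * (x .s11 * x .s33 - x .s13 * x .s13) +
      x .q3 * (x .s12 * x .s13 - x .s11 * x .s23))
    (x .q1 * (x .s12 * x .s23 - x .s13 * x .s22) + x .q2 * (x .s12 * x .s13 - x .s11 * x .s23) +
      x .q3 * (x .s11 * x .s22 - x .s12 * x .s12))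

/-- The vector `A t = q × t`. -/
def xVec : Fin 3 → A :=
  vec3 (x .q2 * x .t3 - x .q3 * x .t2) (x .q3 * x .t1 - x .q1 * x .t3)
    (x .q1 * x .t2 - x .q2 * x .t1)

/-- The vector `S p`. -/
def spVec : Fin 3 → A := sAct x (pVec x)

/-- The vector `v = S p + p₄ t`. -/
def vVec : Fin 3 → A := spVec x + x .p4 • tVec x

/-- The vector `S (q × t)`. -/
def sxVec : Fin 3 → A := sAct x (xVec x)

/-- An element of the free module of rank nine, as three scalars and two vectors. -/
def pack9 (a₀ : A) (μ : Fin 3 → A) (a₄ : A) (l : Fin 3 → A) (a₈ : A) : Fin 9 → A :=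
  ![a₀, μ 0, μ 1, μ 2, a₄, l 0, l 1, l 2, a₈]

/-- An element of the free module of rank sixteen, as four scalars and four vectors. -/
def pack16 (a b : A) (c g h k : Fin 3 → A) (m n : A) : Fin 16 → A :=
  ![a, b, c 0, c 1, c 2, g 0, g 1, g 2, h 0, h 1, h 2, k 0, k 1, k 2, m, n]

/-- The vector `r p + q × (S p + p₄ t)`, whose entries are the second to fourth equations. -/
def midEq : Fin 3 → A := x .r • pVec x + crs (qVec x) (vVec x)
/-- The vector `u p - r (q × t) + q × S (q × t)`, whose entries are the sixth to eighth equations. -/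
def lastEq : Fin 3 → A := x .u • pVec x - x .r • xVec x + crs (qVec x) (sxVec x)
/-- The last equation, `u p₄ + r² + q · S† q`. -/
def normEq : A := x .u * x .p4 + (x .r ^ 2 + dot (qVec x) (adjVec x))

/-- The formula for the first differential: the combination of the nine equations with given
coefficients. -/
def diff1Fun (y : Fin 9 → A) : Fin 1 → A :=
  ![y 0 * dot (pVec x) (qVec x) + dot (vec3 (y 1) (y 2) (y 3)) (midEq x) +
    y 4 * dot (pVec x) (vVec x) + dot (vec3 (y 5) (y 6) (y 7)) (lastEq x) + y 8 * normEq x]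

/-- The formula for the second differential, whose columns are the sixteen syzygies of the nine
equations. -/
def diff2Fun (z : Fin 16 → A) : Fin 9 → A :=
  let c := vec3 (z 2) (z 3) (z 4)
  let g := vec3 (z 5) (z 6) (z 7)
  let h := vec3 (z 8) (z 9) (z 10)
  let k := vec3 (z 11) (z 12) (z 13)
  pack9
    (-(x .r * z 0) - x .u * z 1 - dot g (adjVec x) + dot h (sxVec x) - dot k (vVec x))
    (z 0 • qVec x - x .u • c + sAct x (crs g (qVec x)) - x .r • g + crs (xVec x) h +
      crs (pVec x) k + z 14 • sxVec x - z 15 • vVec x)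
    (dot (qVec x) k - x .u * z 14 + x .r * z 15)
    (z 1 • qVec x + x .r • c + sAct x (crs c (qVec x)) - x .p4 • g + crs h (pVec x) +
      z 14 • vVec x)
    (dot (xVec x) c + dot (pVec x) g)

/-- The formula for the third differential. -/
def diff3Fun (y : Fin 9 → A) : Fin 16 → A :=
  let μ := vec3 (y 1) (y 2) (y 3)
  let l := vec3 (y 5) (y 6) (y 7)
  pack16
    (dot (sxVec x) μ - x .u * y 4 + dot (vVec x) l)
    (x .r * y 4 - dot (vVec x) μ)
    (y 0 • vVec x - crs μ (pVec x) - y 4 • qVec x)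
    (crs l (pVec x) - y 0 • sxVec x - crs μ (xVec x))
    (y 0 • adjVec x - crs (qVec x) (sAct x μ) + x .r • μ + x .p4 • l - y 8 • pVec x)
    (x .u • μ - x .r • l - crs (qVec x) (sAct x l) - y 8 • xVec x)
    (dot (qVec x) μ - x .r * y 0)
    (dot (qVec x) l - x .u * y 0)

/-- The formula for the fourth differential. -/
def diff4Fun (w : Fin 1 → A) : Fin 9 → A :=
  pack9 (w 0 * dot (pVec x) (qVec x)) (w 0 • midEq x) (w 0 * dot (pVec x) (vVec x))
    (w 0 • lastEq x) (w 0 * normEq x)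

/- The evaluation rules below hold by definition. They are rewriting rules for `dsimp`, which keep the
expansion into coordinates from unfolding vectors that are then discarded. -/
section Coordinates

variable (a b c : A) (v v' g h k : Fin 3 → A) (m n : A)

lemma pVec_0 : pVec x 0 = x .p1 := rfl
lemma pVec_1 : pVec x 1 = x .p2 := rfl
lemma pVec_2 : pVec x 2 = x .p3 := rfl
lemma qVec_0 : qVec x 0 = x .q1 := rfl
lemma qVec_1 : qVec x 1 = x .q2 := rfl
lemma qVec_2 : qVec x 2 = x .q3 := rfl
lemma tVec_0 : tVec x 0 = x .t1 := rfl
lemma tVec_1 : tVec x 1 = x .t2 := rfl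
lemma tVec_2 : tVec x 2 = x .t3 := rfl
lemma vec3_0 : vec3 a b c 0 = a := rfl
lemma vec3_1 : vec3 a b c 1 = b := rfl
lemma vec3_2 : vec3 a b c 2 = c := rfl
lemma crs_0 : crs v g 0 = v 1 * g 2 - v 2 * g 1 := rfl
lemma crs_1 : crs v g 1 = v 2 * g 0 - v 0 * g 2 := rfl
lemma crs_2 : crs v g 2 = v 0 * g 1 - v 1 * g 0 := rfl
lemma sAct_0 : sAct x v 0 = x .s11 * v 0 + x .s12 * v 1 + x .s13 * v 2 := rfl
lemma sAct_1 : sAct x v 1 = x .s12 * v 0 + x .s22 * v 1 + x .s23 * v 2 := rfl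
lemma sAct_2 : sAct x v 2 = x .s13 * v 0 + x .s23 * v 1 + x .s33 * v 2 := rfl
lemma vec_add (i : Fin 3) : (v + g) i = v i + g i := rfl
lemma vec_sub (i : Fin 3) : (v - g) i = v i - g i := rfl
lemma vec_smul (i : Fin 3) : (a • v) i = a * v i := rfl
lemma vec_zero (i : Fin 3) : (0 : Fin 3 → A) i = 0 := rfl

lemma pack9_apply :
    pack9 a v b g c 0 = a ∧ pack9 a v b g c 1 = v 0 ∧ pack9 a v b g c 2 = v 1 ∧
    pack9 a v b g c 3 = v 2 ∧ pack9 a v b g c 4 = b ∧ pack9 a v b g c 5 = g 0 ∧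
    pack9 a v b g c 6 = g 1 ∧ pack9 a v b g c 7 = g 2 ∧ pack9 a v b g c 8 = c :=
  ⟨rfl, rfl, rfl, rfl, rfl, rfl, rfl, rfl, rfl⟩

lemma pack16_apply :
    pack16 a b v g h k m n 0 = a ∧ pack16 a b v g h k m n 1 = b ∧
    pack16 a b v g h k m n 2 = v 0 ∧ pack16 a b v g h k m n 3 = v 1 ∧
    pack16 a b v g h k m n 4 = v 2 ∧ pack16 a b v g h k m n 5 = g 0 ∧
    pack16 a b v g h k m n 6 = g 1 ∧ pack16 a b v g h k m n 7 = g 2 ∧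
    pack16 a b v g h k m n 8 = h 0 ∧ pack16 a b v g h k m n 9 = h 1 ∧
    pack16 a b v g h k m n 10 = h 2 ∧ pack16 a b v g h k m n 11 = k 0 ∧
    pack16 a b v g h k m n 12 = k 1 ∧ pack16 a b v g h k m n 13 = k 2 ∧
    pack16 a b v g h k m n 14 = m ∧ pack16 a b v g h k m n 15 = n :=
  ⟨rfl, rfl, rfl, rfl, rfl, rfl, rfl, rfl, rfl, rfl, rfl, rfl, rfl, rfl, rfl, rfl⟩

end Coordinates

lemma ext_fin9 {f g : Fin 9 → A} (h0 : f 0 = g 0) (h1 : f 1 = g 1) (h2 : f 2 = g 2)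
    (h3 : f 3 = g 3) (h4 : f 4 = g 4) (h5 : f 5 = g 5) (h6 : f 6 = g 6) (h7 : f 7 = g 7)
    (h8 : f 8 = g 8) : f = g := by
  funext i
  fin_cases i <;> assumption

lemma ext_fin16 {f g : Fin 16 → A} (h0 : f 0 = g 0) (h1 : f 1 = g 1) (h2 : f 2 = g 2)
    (h3 : f 3 = g 3) (h4 : f 4 = g 4) (h5 : f 5 = g 5) (h6 : f 6 = g 6) (h7 : f 7 = g 7)
    (h8 : f 8 = g 8) (h9 : f 9 = g 9) (h10 : f 10 = g 10) (h11 : f 11 = g 11)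
    (h12 : f 12 = g 12) (h13 : f 13 = g 13) (h14 : f 14 = g 14) (h15 : f 15 = g 15) :
    f = g := by
  funext i
  fin_cases i <;> assumption

lemma ext_fin1 {f g : Fin 1 → A} (h : f 0 = g 0) : f = g := by
  funext i
  fin_cases i
  exact h

lemma sMat_mulVec (v : Fin 3 → A) : sMat x *ᵥ v = sAct x v := by
  funext i
  fin_cases i <;>
  simp [sMat, sAct, vec3, Matrix.mulVec, dotProduct, Fin.sum_univ_three]

lemma aMat_mulVec (v : Fin 3 → A) : aMat x *ᵥ v = crs (qVec x) v := by
  funext i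
  fin_cases i <;>
  simp [aMat, crs, qVec, vec3, Matrix.mulVec, dotProduct, Fin.sum_univ_three] <;> ring

lemma adjugate_mulVec : (sMat x).adjugate *ᵥ qVec x = adjVec x := by
  funext i
  fin_cases i <;>
  simp [sMat, adjVec, qVec, vec3, Matrix.adjugate_fin_three_of, Matrix.mulVec, dotProduct,
    Fin.sum_univ_three] <;> ring

lemma dotProduct_eq_dot (v w : Fin 3 → A) : v ⬝ᵥ w = dot v w := by
  simp [dot, dotProduct, Fin.sum_univ_three]

lemma crs_add (a v w : Fin 3 → A) : crs a (v + w) = crs a v + crs a w := by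
  funext i
  fin_cases i <;> simp [crs, vec3] <;> ring

lemma crs_smul (c : A) (a v : Fin 3 → A) : crs a (c • v) = c • crs a v := by
  funext i
  fin_cases i <;> simp [crs, vec3] <;> ring

lemma dot_add (a v w : Fin 3 → A) : dot a (v + w) = dot a v + dot a w := by
  simp only [dot, Pi.add_apply]; ring

lemma dot_smul (c : A) (a v : Fin 3 → A) : dot a (c • v) = c * dot a v := by
  simp only [dot, Pi.smul_apply, smul_eq_mul]; ring

theorem equations_eq_pack9 : equations x =
    pack9 (dot (pVec x) (qVec x)) (midEq x) (dot (pVec x) (vVec x)) (lastEq x) (normEq x) := by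
  have hx : aMat x *ᵥ tVec x = xVec x := aMat_mulVec x _
  have hm : midVec x = midEq x := by
    rw [midVec, hx, Matrix.add_mulVec, Matrix.smul_mulVec, Matrix.one_mulVec,
      ← Matrix.mulVec_mulVec, sMat_mulVec, aMat_mulVec, midEq, vVec, crs_add, crs_smul, add_assoc]
    rfl
  have hl : lastVec x = lastEq x := by
    rw [lastVec, hx, Matrix.sub_mulVec, Matrix.smul_mulVec, Matrix.one_mulVec,
      ← Matrix.mulVec_mulVec, sMat_mulVec, aMat_mulVec, lastEq, sub_sub_eq_add_sub, sub_add_eq_add_sub]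
    rfl
  rw [equations, hm, hl, adjugate_mulVec, sMat_mulVec]
  simp only [dotProduct_eq_dot, vVec, dot_add, dot_smul]
  rfl

theorem diff1_diff2 (z : Fin 16 → A) : diff1Fun x (diff2Fun x z) = 0 := by
  apply ext_fin1
  simp only [diff1Fun, diff2Fun, midEq, lastEq, normEq, ↓pack9_apply, ↓pack16_apply, Matrix.cons_val,
    Pi.add_apply, Pi.smul_apply, Pi.zero_apply, smul_eq_mul]
  dsimp only [dot, vVec, sxVec, spVec, xVec, adjVec, ↓crs_0, ↓crs_1, ↓crs_2, ↓sAct_0, ↓sAct_1, ↓sAct_2, ↓vec_add,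
    ↓vec_sub, ↓vec_smul, ↓vec_zero, ↓vec3_0, ↓vec3_1, ↓vec3_2,
    pVec_0, pVec_1, pVec_2, qVec_0, qVec_1, qVec_2, tVec_0, tVec_1, tVec_2]
  ring

theorem diff2_diff3 (z : Fin 9 → A) : diff2Fun x (diff3Fun x z) = 0 := by
  apply ext_fin9 <;>
  simp only [diff3Fun, diff2Fun, ↓pack9_apply, ↓pack16_apply, Matrix.cons_val,
    Pi.add_apply, Pi.smul_apply, Pi.zero_apply, smul_eq_mul] <;>
  dsimp only [dot, vVec, sxVec, spVec, xVec, adjVec, ↓crs_0, ↓crs_1, ↓crs_2, ↓sAct_0, ↓sAct_1, ↓sAct_2, ↓vec_add,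
    ↓vec_sub, ↓vec_smul, ↓vec_zero, ↓vec3_0, ↓vec3_1, ↓vec3_2,
    pVec_0, pVec_1, pVec_2, qVec_0, qVec_1, qVec_2, tVec_0, tVec_1, tVec_2] <;>
  ring

theorem diff3_diff4 (z : Fin 1 → A) : diff3Fun x (diff4Fun x z) = 0 := by
  apply ext_fin16 <;>
  simp only [diff3Fun, diff4Fun, midEq, lastEq, normEq, ↓pack9_apply, ↓pack16_apply, Matrix.cons_val,
    Pi.add_apply, Pi.smul_apply, Pi.zero_apply, smul_eq_mul] <;>
  dsimp only [dot, vVec, sxVec, spVec, xVec, adjVec, ↓crs_0, ↓crs_1, ↓crs_2, ↓sAct_0, ↓sAct_1, ↓sAct_2, ↓vec_add,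
    ↓vec_sub, ↓vec_smul, ↓vec_zero, ↓vec3_0, ↓vec3_1, ↓vec3_2,
    pVec_0, pVec_1, pVec_2, qVec_0, qVec_1, qVec_2, tVec_0, tVec_1, tVec_2] <;>
  ring

/-- A linear map between free modules, from a function that is compatible with linear
combinations. -/
def linearOf {m n : ℕ} (f : (Fin m → A) → Fin n → A)
    (h : ∀ (a : A) (y z : Fin m → A), f (a • y + z) = a • f y + f z) :
    (Fin m → A) →ₗ[A] (Fin n → A) where
  toFun := f
  map_add' y z := by simpa only [one_smul] using h 1 y z
  map_smul' a y := by
    have h0 : f 0 = 0 := by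
      simpa only [smul_zero, add_zero, one_smul, left_eq_add] using h 1 0 0
    simpa only [h0, add_zero, RingHom.id_apply] using h a y 0

/-- The first differential of the complex; its entries are the nine equations. -/
def diff1 : (Fin 9 → A) →ₗ[A] (Fin 1 → A) :=
  linearOf (diff1Fun x) fun a y z => by
    apply ext_fin1
    simp only [diff1Fun, ↓pack9_apply, ↓pack16_apply, Matrix.cons_val, Pi.add_apply,
      Pi.smul_apply, smul_eq_mul]
    dsimp only [dot, ↓crs_0, ↓crs_1, ↓crs_2, ↓sAct_0, ↓sAct_1, ↓sAct_2, ↓vec_add,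
      ↓vec_sub, ↓vec_smul, ↓vec_zero, ↓vec3_0, ↓vec3_1, ↓vec3_2]
    ring

lemma diff1_apply (y : Fin 9 → A) : diff1 x y = diff1Fun x y := rfl

/-- The second differential of the complex. -/
def diff2 : (Fin 16 → A) →ₗ[A] (Fin 9 → A) :=
  linearOf (diff2Fun x) fun a y z => by
    apply ext_fin9 <;>
    simp only [diff2Fun, ↓pack9_apply, ↓pack16_apply, Matrix.cons_val, Pi.add_apply,
      Pi.smul_apply, smul_eq_mul] <;>
    (try dsimp only [dot, ↓crs_0, ↓crs_1, ↓crs_2, ↓sAct_0, ↓sAct_1, ↓sAct_2, ↓vec_add,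
      ↓vec_sub, ↓vec_smul, ↓vec_zero, ↓vec3_0, ↓vec3_1, ↓vec3_2]) <;>
    (try ring)

lemma diff2_apply (y : Fin 16 → A) : diff2 x y = diff2Fun x y := rfl

/-- The third differential of the complex: the transpose of the second one, for the symmetric pairing
on the free module of rank sixteen that pairs the entries `(a, b, c, g)` of `pack16` with
`(m, n, -k, -h)`. -/
def diff3 : (Fin 9 → A) →ₗ[A] (Fin 16 → A) :=
  linearOf (diff3Fun x) fun a y z => by
    apply ext_fin16 <;>
    simp only [diff3Fun, ↓pack9_apply, ↓pack16_apply, Matrix.cons_val, Pi.add_apply,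
      Pi.smul_apply, smul_eq_mul] <;>
    (try dsimp only [dot, ↓crs_0, ↓crs_1, ↓crs_2, ↓sAct_0, ↓sAct_1, ↓sAct_2, ↓vec_add,
      ↓vec_sub, ↓vec_smul, ↓vec_zero, ↓vec3_0, ↓vec3_1, ↓vec3_2]) <;>
    (try ring)

lemma diff3_apply (y : Fin 9 → A) : diff3 x y = diff3Fun x y := rfl

/-- The fourth differential of the complex, the transpose of the first one. -/
def diff4 : (Fin 1 → A) →ₗ[A] (Fin 9 → A) :=
  linearOf (diff4Fun x) fun a y z => by
    apply ext_fin9 <;>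
    simp only [diff4Fun, ↓pack9_apply, ↓pack16_apply, Matrix.cons_val, Pi.add_apply,
      Pi.smul_apply, smul_eq_mul] <;>
    (try dsimp only [dot, ↓crs_0, ↓crs_1, ↓crs_2, ↓sAct_0, ↓sAct_1, ↓sAct_2, ↓vec_add,
      ↓vec_sub, ↓vec_smul, ↓vec_zero, ↓vec3_0, ↓vec3_1, ↓vec3_2]) <;>
    (try ring)

lemma diff4_apply (y : Fin 1 → A) : diff4 x y = diff4Fun x y := rfl

/-- Multiplication by `a` on the complex is null-homotopic in positive degrees. The homotopy starts
with the map `S → S⁹` that sends `1` to `e`. -/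
def NullHomotopic (a : A) : Prop :=
  ∃ (e : Fin 9 → A) (s₁ : (Fin 9 → A) →ₗ[A] (Fin 16 → A)) (s₂ : (Fin 16 → A) →ₗ[A] (Fin 9 → A))
    (s₃ : (Fin 9 → A) →ₗ[A] (Fin 1 → A)),
    (∀ y, diff2 x (s₁ y) + diff1 x y 0 • e = a • y) ∧
    (∀ z, diff3 x (s₂ z) + s₁ (diff2 x z) = a • z) ∧
    (∀ y, diff4 x (s₃ y) + s₂ (diff3 x y) = a • y) ∧
    ∀ w, s₃ (diff4 x w) = a • w

/-! ### Homotopy for `p · q` -/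

/-- The formula for the homotopy `S⁹ → S¹⁶`. -/
def pairingHom1Fun (y : Fin 9 → A) : Fin 16 → A :=
  let μ := vec3 (y 1) (y 2) (y 3)
  let l := vec3 (y 5) (y 6) (y 7)
  pack16 (dot (pVec x) μ - dot (xVec x) l + x .r * y 8) (dot (pVec x) l + x .p4 * y 8) 0
    (y 8 • qVec x) (crs (qVec x) l) (crs μ (qVec x) + y 4 • pVec x) 0 0

/-- The formula for the homotopy `S¹⁶ → S⁹`. -/
def pairingHom2Fun (z : Fin 16 → A) : Fin 9 → A :=
  let c := vec3 (z 2) (z 3) (z 4)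
  let g := vec3 (z 5) (z 6) (z 7)
  let h := vec3 (z 8) (z 9) (z 10)
  pack9 0 (z 14 • pVec x + crs c (qVec x)) (-dot (pVec x) c)
    (z 15 • pVec x - z 14 • xVec x + crs (qVec x) g)
    (x .r * z 14 + x .p4 * z 15 - dot (qVec x) h)

/-- The formula for the homotopy `S⁹ → S`. -/
def pairingHom3Fun (_x : Var → A) (y : Fin 9 → A) : Fin 1 → A := ![y 0]

def pairingHom1 : (Fin 9 → A) →ₗ[A] (Fin 16 → A) :=
  linearOf (pairingHom1Fun x) fun a y z => by
    apply ext_fin16 <;>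
    simp only [pairingHom1Fun, ↓pack9_apply, ↓pack16_apply, Matrix.cons_val, Pi.add_apply,
      Pi.smul_apply, smul_eq_mul] <;>
    (try dsimp only [dot, ↓crs_0, ↓crs_1, ↓crs_2, ↓sAct_0, ↓sAct_1, ↓sAct_2, ↓vec_add,
      ↓vec_sub, ↓vec_smul, ↓vec_zero, ↓vec3_0, ↓vec3_1, ↓vec3_2]) <;>
    (try ring)

lemma pairingHom1_apply (y : Fin 9 → A) : pairingHom1 x y = pairingHom1Fun x y := rfl

def pairingHom2 : (Fin 16 → A) →ₗ[A] (Fin 9 → A) :=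
  linearOf (pairingHom2Fun x) fun a y z => by
    apply ext_fin9 <;>
    simp only [pairingHom2Fun, ↓pack9_apply, ↓pack16_apply, Matrix.cons_val, Pi.add_apply,
      Pi.smul_apply, smul_eq_mul] <;>
    (try dsimp only [dot, ↓crs_0, ↓crs_1, ↓crs_2, ↓sAct_0, ↓sAct_1, ↓sAct_2, ↓vec_add,
      ↓vec_sub, ↓vec_smul, ↓vec_zero, ↓vec3_0, ↓vec3_1, ↓vec3_2]) <;>
    (try ring)

lemma pairingHom2_apply (y : Fin 16 → A) : pairingHom2 x y = pairingHom2Fun x y := rfl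

def pairingHom3 : (Fin 9 → A) →ₗ[A] (Fin 1 → A) :=
  linearOf (pairingHom3Fun x) fun a y z => by
    apply ext_fin1
    simp only [pairingHom3Fun, Matrix.cons_val, Pi.add_apply, Pi.smul_apply, smul_eq_mul]

lemma pairingHom3_apply (y : Fin 9 → A) : pairingHom3 x y = pairingHom3Fun x y := rfl

theorem pairingHom_one (y : Fin 9 → A) :
    diff2Fun x (pairingHom1Fun x y) + diff1Fun x y 0 • pack9 1 0 0 0 0 = (dot (pVec x) (qVec x)) • y := by
  apply ext_fin9 <;>
  simp only [diff1Fun, diff2Fun, pairingHom1Fun, midEq, lastEq, normEq, ↓pack9_apply, ↓pack16_apply, Matrix.cons_val,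
    Pi.add_apply, Pi.smul_apply, Pi.zero_apply, smul_eq_mul] <;>
  dsimp only [dot, vVec, sxVec, spVec, xVec, adjVec, ↓crs_0, ↓crs_1, ↓crs_2, ↓sAct_0, ↓sAct_1, ↓sAct_2, ↓vec_add,
    ↓vec_sub, ↓vec_smul, ↓vec_zero, ↓vec3_0, ↓vec3_1, ↓vec3_2,
    pVec_0, pVec_1, pVec_2, qVec_0, qVec_1, qVec_2, tVec_0, tVec_1, tVec_2] <;>
  ring

theorem pairingHom_two (z : Fin 16 → A) :
    diff3Fun x (pairingHom2Fun x z) + pairingHom1Fun x (diff2Fun x z) = (dot (pVec x) (qVec x)) • z := by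
  apply ext_fin16 <;>
  simp only [diff2Fun, diff3Fun, pairingHom1Fun, pairingHom2Fun, midEq, lastEq, normEq, ↓pack9_apply, ↓pack16_apply, Matrix.cons_val,
    Pi.add_apply, Pi.smul_apply, Pi.zero_apply, smul_eq_mul] <;>
  dsimp only [dot, vVec, sxVec, spVec, xVec, adjVec, ↓crs_0, ↓crs_1, ↓crs_2, ↓sAct_0, ↓sAct_1, ↓sAct_2, ↓vec_add,
    ↓vec_sub, ↓vec_smul, ↓vec_zero, ↓vec3_0, ↓vec3_1, ↓vec3_2,
    pVec_0, pVec_1, pVec_2, qVec_0, qVec_1, qVec_2, tVec_0, tVec_1, tVec_2] <;>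
  ring

theorem pairingHom_three (y : Fin 9 → A) :
    diff4Fun x (pairingHom3Fun x y) + pairingHom2Fun x (diff3Fun x y) = (dot (pVec x) (qVec x)) • y := by
  apply ext_fin9 <;>
  simp only [diff4Fun, diff3Fun, pairingHom2Fun, pairingHom3Fun, midEq, lastEq, normEq, ↓pack9_apply, ↓pack16_apply, Matrix.cons_val,
    Pi.add_apply, Pi.smul_apply, Pi.zero_apply, smul_eq_mul] <;>
  dsimp only [dot, vVec, sxVec, spVec, xVec, adjVec, ↓crs_0, ↓crs_1, ↓crs_2, ↓sAct_0, ↓sAct_1, ↓sAct_2, ↓vec_add,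
    ↓vec_sub, ↓vec_smul, ↓vec_zero, ↓vec3_0, ↓vec3_1, ↓vec3_2,
    pVec_0, pVec_1, pVec_2, qVec_0, qVec_1, qVec_2, tVec_0, tVec_1, tVec_2] <;>
  ring

theorem pairingHom_four (w : Fin 1 → A) : pairingHom3Fun x (diff4Fun x w) = (dot (pVec x) (qVec x)) • w := by
  apply ext_fin1
  simp only [diff4Fun, pairingHom3Fun, midEq, lastEq, normEq, ↓pack9_apply, ↓pack16_apply, Matrix.cons_val,
    Pi.add_apply, Pi.smul_apply, Pi.zero_apply, smul_eq_mul]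
  dsimp only [dot, vVec, sxVec, spVec, xVec, adjVec, ↓crs_0, ↓crs_1, ↓crs_2, ↓sAct_0, ↓sAct_1, ↓sAct_2, ↓vec_add,
    ↓vec_sub, ↓vec_smul, ↓vec_zero, ↓vec3_0, ↓vec3_1, ↓vec3_2,
    pVec_0, pVec_1, pVec_2, qVec_0, qVec_1, qVec_2, tVec_0, tVec_1, tVec_2]
  ring

theorem nullHomotopic_pairing : NullHomotopic x (dot (pVec x) (qVec x)) :=
  ⟨pack9 1 0 0 0 0, pairingHom1 x, pairingHom2 x, pairingHom3 x,
    fun y => by simpa only [pairingHom1_apply, diff2_apply, diff1_apply] using pairingHom_one x y,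
    fun z => by
      simpa only [pairingHom2_apply, pairingHom1_apply, diff3_apply, diff2_apply] using pairingHom_two x z,
    fun y => by
      simpa only [pairingHom3_apply, pairingHom2_apply, diff4_apply, diff3_apply] using pairingHom_three x y,
    fun w => by simpa only [pairingHom3_apply, diff4_apply] using pairingHom_four x w⟩

/-! ### Homotopy for `p · v` -/

/-- The formula for the homotopy `S⁹ → S¹⁶`. -/
def quadricHom1Fun (y : Fin 9 → A) : Fin 16 → A :=
  let μ := vec3 (y 1) (y 2) (y 3)
  let l := vec3 (y 5) (y 6) (y 7)
  pack16 (dot (crs (tVec x) (spVec x)) l) 0 0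
    (dot (pVec x) l • tVec x - dot (pVec x) (tVec x) • l + y 8 • vVec x)
    (crs (spVec x) l)
    (crs μ (vVec x) - y 0 • pVec x + x .r • crs (tVec x) l +
      crs (tVec x) (sAct x (crs (qVec x) l)) - y 8 • adjVec x)
    (dot (pVec x) l + x .p4 * y 8) (-dot (pVec x) μ - x .r * y 8)

/-- The formula for the homotopy `S¹⁶ → S⁹`. -/
def quadricHom2Fun (z : Fin 16 → A) : Fin 9 → A :=
  let c := vec3 (z 2) (z 3) (z 4)
  let g := vec3 (z 5) (z 6) (z 7)
  let h := vec3 (z 8) (z 9) (z 10)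
  pack9 (dot (pVec x) c) (crs c (vVec x) - z 1 • pVec x) 0
    (z 14 • crs (tVec x) (spVec x) - dot (tVec x) h • pVec x + dot (pVec x) (tVec x) • h +
      crs (spVec x) g + x .r • crs (tVec x) c + crs (qVec x) (sAct x (crs c (tVec x))) +
      z 0 • pVec x)
    (dot (adjVec x) c - dot (vVec x) h + x .p4 * z 0 - x .r * z 1)

/-- The formula for the homotopy `S⁹ → S`. -/
def quadricHom3Fun (_x : Var → A) (y : Fin 9 → A) : Fin 1 → A := ![y 4]

def quadricHom1 : (Fin 9 → A) →ₗ[A] (Fin 16 → A) :=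
  linearOf (quadricHom1Fun x) fun a y z => by
    apply ext_fin16 <;>
    simp only [quadricHom1Fun, ↓pack9_apply, ↓pack16_apply, Matrix.cons_val, Pi.add_apply,
      Pi.smul_apply, smul_eq_mul] <;>
    (try dsimp only [dot, ↓crs_0, ↓crs_1, ↓crs_2, ↓sAct_0, ↓sAct_1, ↓sAct_2, ↓vec_add,
      ↓vec_sub, ↓vec_smul, ↓vec_zero, ↓vec3_0, ↓vec3_1, ↓vec3_2]) <;>
    (try ring)

lemma quadricHom1_apply (y : Fin 9 → A) : quadricHom1 x y = quadricHom1Fun x y := rfl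

def quadricHom2 : (Fin 16 → A) →ₗ[A] (Fin 9 → A) :=
  linearOf (quadricHom2Fun x) fun a y z => by
    apply ext_fin9 <;>
    simp only [quadricHom2Fun, ↓pack9_apply, ↓pack16_apply, Matrix.cons_val, Pi.add_apply,
      Pi.smul_apply, smul_eq_mul] <;>
    (try dsimp only [dot, ↓crs_0, ↓crs_1, ↓crs_2, ↓sAct_0, ↓sAct_1, ↓sAct_2, ↓vec_add,
      ↓vec_sub, ↓vec_smul, ↓vec_zero, ↓vec3_0, ↓vec3_1, ↓vec3_2]) <;>
    (try ring)

lemma quadricHom2_apply (y : Fin 16 → A) : quadricHom2 x y = quadricHom2Fun x y := rfl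

def quadricHom3 : (Fin 9 → A) →ₗ[A] (Fin 1 → A) :=
  linearOf (quadricHom3Fun x) fun a y z => by
    apply ext_fin1
    simp only [quadricHom3Fun, Matrix.cons_val, Pi.add_apply, Pi.smul_apply, smul_eq_mul]

lemma quadricHom3_apply (y : Fin 9 → A) : quadricHom3 x y = quadricHom3Fun x y := rfl

theorem quadricHom_one (y : Fin 9 → A) :
    diff2Fun x (quadricHom1Fun x y) + diff1Fun x y 0 • pack9 0 0 1 0 0 = (dot (pVec x) (vVec x)) • y := by
  apply ext_fin9 <;>
  simp only [diff1Fun, diff2Fun, quadricHom1Fun, midEq, lastEq, normEq, ↓pack9_apply, ↓pack16_apply, Matrix.cons_val,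
    Pi.add_apply, Pi.smul_apply, Pi.zero_apply, smul_eq_mul] <;>
  dsimp only [dot, vVec, sxVec, spVec, xVec, adjVec, ↓crs_0, ↓crs_1, ↓crs_2, ↓sAct_0, ↓sAct_1, ↓sAct_2, ↓vec_add,
    ↓vec_sub, ↓vec_smul, ↓vec_zero, ↓vec3_0, ↓vec3_1, ↓vec3_2,
    pVec_0, pVec_1, pVec_2, qVec_0, qVec_1, qVec_2, tVec_0, tVec_1, tVec_2] <;>
  ring

theorem quadricHom_two (z : Fin 16 → A) :
    diff3Fun x (quadricHom2Fun x z) + quadricHom1Fun x (diff2Fun x z) = (dot (pVec x) (vVec x)) • z := by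
  apply ext_fin16 <;>
  simp only [diff2Fun, diff3Fun, quadricHom1Fun, quadricHom2Fun, midEq, lastEq, normEq, ↓pack9_apply, ↓pack16_apply, Matrix.cons_val,
    Pi.add_apply, Pi.smul_apply, Pi.zero_apply, smul_eq_mul] <;>
  dsimp only [dot, vVec, sxVec, spVec, xVec, adjVec, ↓crs_0, ↓crs_1, ↓crs_2, ↓sAct_0, ↓sAct_1, ↓sAct_2, ↓vec_add,
    ↓vec_sub, ↓vec_smul, ↓vec_zero, ↓vec3_0, ↓vec3_1, ↓vec3_2,
    pVec_0, pVec_1, pVec_2, qVec_0, qVec_1, qVec_2, tVec_0, tVec_1, tVec_2] <;>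
  ring

theorem quadricHom_three (y : Fin 9 → A) :
    diff4Fun x (quadricHom3Fun x y) + quadricHom2Fun x (diff3Fun x y) = (dot (pVec x) (vVec x)) • y := by
  apply ext_fin9 <;>
  simp only [diff4Fun, diff3Fun, quadricHom2Fun, quadricHom3Fun, midEq, lastEq, normEq, ↓pack9_apply, ↓pack16_apply, Matrix.cons_val,
    Pi.add_apply, Pi.smul_apply, Pi.zero_apply, smul_eq_mul] <;>
  dsimp only [dot, vVec, sxVec, spVec, xVec, adjVec, ↓crs_0, ↓crs_1, ↓crs_2, ↓sAct_0, ↓sAct_1, ↓sAct_2, ↓vec_add,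
    ↓vec_sub, ↓vec_smul, ↓vec_zero, ↓vec3_0, ↓vec3_1, ↓vec3_2,
    pVec_0, pVec_1, pVec_2, qVec_0, qVec_1, qVec_2, tVec_0, tVec_1, tVec_2] <;>
  ring

theorem quadricHom_four (w : Fin 1 → A) : quadricHom3Fun x (diff4Fun x w) = (dot (pVec x) (vVec x)) • w := by
  apply ext_fin1
  simp only [diff4Fun, quadricHom3Fun, midEq, lastEq, normEq, ↓pack9_apply, ↓pack16_apply, Matrix.cons_val,
    Pi.add_apply, Pi.smul_apply, Pi.zero_apply, smul_eq_mul]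
  dsimp only [dot, vVec, sxVec, spVec, xVec, adjVec, ↓crs_0, ↓crs_1, ↓crs_2, ↓sAct_0, ↓sAct_1, ↓sAct_2, ↓vec_add,
    ↓vec_sub, ↓vec_smul, ↓vec_zero, ↓vec3_0, ↓vec3_1, ↓vec3_2,
    pVec_0, pVec_1, pVec_2, qVec_0, qVec_1, qVec_2, tVec_0, tVec_1, tVec_2]
  ring

theorem nullHomotopic_quadric : NullHomotopic x (dot (pVec x) (vVec x)) :=
  ⟨pack9 0 0 1 0 0, quadricHom1 x, quadricHom2 x, quadricHom3 x,
    fun y => by simpa only [quadricHom1_apply, diff2_apply, diff1_apply] using quadricHom_one x y,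
    fun z => by
      simpa only [quadricHom2_apply, quadricHom1_apply, diff3_apply, diff2_apply] using quadricHom_two x z,
    fun y => by
      simpa only [quadricHom3_apply, quadricHom2_apply, diff4_apply, diff3_apply] using quadricHom_three x y,
    fun w => by simpa only [quadricHom3_apply, diff4_apply] using quadricHom_four x w⟩

/-! ### Homotopy for `u p₄ + r² + q · S† q` -/

/-- The formula for the homotopy `S⁹ → S¹⁶`. -/
def normHom1Fun (y : Fin 9 → A) : Fin 16 → A :=
  let μ := vec3 (y 1) (y 2) (y 3)
  let l := vec3 (y 5) (y 6) (y 7)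
  pack16 (dot (adjVec x) μ - x .r * y 0) (dot (adjVec x) l - x .p4 * y 0)
    (x .r • l - x .p4 • μ + sAct x (crs (qVec x) l))
    (sAct x (crs (qVec x) μ) - y 0 • qVec x - x .r • μ - y 4 • vVec x - x .u • l)
    0 (y 4 • adjVec x) (-(x .p4 * y 4)) (x .r * y 4)

/-- The formula for the homotopy `S¹⁶ → S⁹`. -/
def normHom2Fun (z : Fin 16 → A) : Fin 9 → A :=
  let c := vec3 (z 2) (z 3) (z 4)
  let h := vec3 (z 8) (z 9) (z 10)
  let k := vec3 (z 11) (z 12) (z 13)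
  pack9 (dot (qVec x) h - x .r * z 14 - x .p4 * z 15)
    (z 14 • adjVec x + x .p4 • k + x .r • h + crs (qVec x) (sAct x h))
    (dot (vVec x) h - dot (adjVec x) c - x .p4 * z 0 + x .r * z 1)
    (z 15 • adjVec x - x .r • k + crs (qVec x) (sAct x k) + x .u • h) 0

/-- The formula for the homotopy `S⁹ → S`. -/
def normHom3Fun (_x : Var → A) (y : Fin 9 → A) : Fin 1 → A := ![y 8]

def normHom1 : (Fin 9 → A) →ₗ[A] (Fin 16 → A) :=
  linearOf (normHom1Fun x) fun a y z => by
    apply ext_fin16 <;>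
    simp only [normHom1Fun, ↓pack9_apply, ↓pack16_apply, Matrix.cons_val, Pi.add_apply,
      Pi.smul_apply, smul_eq_mul] <;>
    (try dsimp only [dot, ↓crs_0, ↓crs_1, ↓crs_2, ↓sAct_0, ↓sAct_1, ↓sAct_2, ↓vec_add,
      ↓vec_sub, ↓vec_smul, ↓vec_zero, ↓vec3_0, ↓vec3_1, ↓vec3_2]) <;>
    (try ring)

lemma normHom1_apply (y : Fin 9 → A) : normHom1 x y = normHom1Fun x y := rfl

def normHom2 : (Fin 16 → A) →ₗ[A] (Fin 9 → A) :=
  linearOf (normHom2Fun x) fun a y z => by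
    apply ext_fin9 <;>
    simp only [normHom2Fun, ↓pack9_apply, ↓pack16_apply, Matrix.cons_val, Pi.add_apply,
      Pi.smul_apply, smul_eq_mul] <;>
    (try dsimp only [dot, ↓crs_0, ↓crs_1, ↓crs_2, ↓sAct_0, ↓sAct_1, ↓sAct_2, ↓vec_add,
      ↓vec_sub, ↓vec_smul, ↓vec_zero, ↓vec3_0, ↓vec3_1, ↓vec3_2]) <;>
    (try ring)

lemma normHom2_apply (y : Fin 16 → A) : normHom2 x y = normHom2Fun x y := rfl

def normHom3 : (Fin 9 → A) →ₗ[A] (Fin 1 → A) :=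
  linearOf (normHom3Fun x) fun a y z => by
    apply ext_fin1
    simp only [normHom3Fun, Matrix.cons_val, Pi.add_apply, Pi.smul_apply, smul_eq_mul]

lemma normHom3_apply (y : Fin 9 → A) : normHom3 x y = normHom3Fun x y := rfl

theorem normHom_one (y : Fin 9 → A) :
    diff2Fun x (normHom1Fun x y) + diff1Fun x y 0 • pack9 0 0 0 0 1 = (normEq x) • y := by
  apply ext_fin9 <;>
  simp only [diff1Fun, diff2Fun, normHom1Fun, midEq, lastEq, normEq, ↓pack9_apply, ↓pack16_apply, Matrix.cons_val,
    Pi.add_apply, Pi.smul_apply, Pi.zero_apply, smul_eq_mul] <;>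
  dsimp only [dot, vVec, sxVec, spVec, xVec, adjVec, ↓crs_0, ↓crs_1, ↓crs_2, ↓sAct_0, ↓sAct_1, ↓sAct_2, ↓vec_add,
    ↓vec_sub, ↓vec_smul, ↓vec_zero, ↓vec3_0, ↓vec3_1, ↓vec3_2,
    pVec_0, pVec_1, pVec_2, qVec_0, qVec_1, qVec_2, tVec_0, tVec_1, tVec_2] <;>
  ring

theorem normHom_two (z : Fin 16 → A) :
    diff3Fun x (normHom2Fun x z) + normHom1Fun x (diff2Fun x z) = (normEq x) • z := by
  apply ext_fin16 <;>
  simp only [diff2Fun, diff3Fun, normHom1Fun, normHom2Fun, midEq, lastEq, normEq, ↓pack9_apply, ↓pack16_apply, Matrix.cons_val,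
    Pi.add_apply, Pi.smul_apply, Pi.zero_apply, smul_eq_mul] <;>
  dsimp only [dot, vVec, sxVec, spVec, xVec, adjVec, ↓crs_0, ↓crs_1, ↓crs_2, ↓sAct_0, ↓sAct_1, ↓sAct_2, ↓vec_add,
    ↓vec_sub, ↓vec_smul, ↓vec_zero, ↓vec3_0, ↓vec3_1, ↓vec3_2,
    pVec_0, pVec_1, pVec_2, qVec_0, qVec_1, qVec_2, tVec_0, tVec_1, tVec_2] <;>
  ring

theorem normHom_three (y : Fin 9 → A) :
    diff4Fun x (normHom3Fun x y) + normHom2Fun x (diff3Fun x y) = (normEq x) • y := by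
  apply ext_fin9 <;>
  simp only [diff4Fun, diff3Fun, normHom2Fun, normHom3Fun, midEq, lastEq, normEq, ↓pack9_apply, ↓pack16_apply, Matrix.cons_val,
    Pi.add_apply, Pi.smul_apply, Pi.zero_apply, smul_eq_mul] <;>
  dsimp only [dot, vVec, sxVec, spVec, xVec, adjVec, ↓crs_0, ↓crs_1, ↓crs_2, ↓sAct_0, ↓sAct_1, ↓sAct_2, ↓vec_add,
    ↓vec_sub, ↓vec_smul, ↓vec_zero, ↓vec3_0, ↓vec3_1, ↓vec3_2,
    pVec_0, pVec_1, pVec_2, qVec_0, qVec_1, qVec_2, tVec_0, tVec_1, tVec_2] <;>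
  ring

theorem normHom_four (w : Fin 1 → A) : normHom3Fun x (diff4Fun x w) = (normEq x) • w := by
  apply ext_fin1
  simp only [diff4Fun, normHom3Fun, midEq, lastEq, normEq, ↓pack9_apply, ↓pack16_apply, Matrix.cons_val,
    Pi.add_apply, Pi.smul_apply, Pi.zero_apply, smul_eq_mul]
  dsimp only [dot, vVec, sxVec, spVec, xVec, adjVec, ↓crs_0, ↓crs_1, ↓crs_2, ↓sAct_0, ↓sAct_1, ↓sAct_2, ↓vec_add,
    ↓vec_sub, ↓vec_smul, ↓vec_zero, ↓vec3_0, ↓vec3_1, ↓vec3_2,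
    pVec_0, pVec_1, pVec_2, qVec_0, qVec_1, qVec_2, tVec_0, tVec_1, tVec_2]
  ring

theorem nullHomotopic_norm : NullHomotopic x (normEq x) :=
  ⟨pack9 0 0 0 0 1, normHom1 x, normHom2 x, normHom3 x,
    fun y => by simpa only [normHom1_apply, diff2_apply, diff1_apply] using normHom_one x y,
    fun z => by
      simpa only [normHom2_apply, normHom1_apply, diff3_apply, diff2_apply] using normHom_two x z,
    fun y => by
      simpa only [normHom3_apply, normHom2_apply, diff4_apply, diff3_apply] using normHom_three x y,
    fun w => by simpa only [normHom3_apply, diff4_apply] using normHom_four x w⟩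

/-! ### Homotopy for `t · (u p - r (q × t) + q × S (q × t))` -/

/-- The formula for the homotopy `S⁹ → S¹⁶`. -/
def lastHom1Fun (y : Fin 9 → A) : Fin 16 → A :=
  let μ := vec3 (y 1) (y 2) (y 3)
  let l := vec3 (y 5) (y 6) (y 7)
  pack16 (dot (crs μ (sxVec x)) (tVec x))
    (dot (crs l (sxVec x)) (tVec x) - dot (pVec x) (tVec x) * y 0 -
      dot (adjVec x) (tVec x) * y 8)
    (dot (xVec x) l • tVec x - dot (pVec x) (tVec x) • μ - (x .r * y 8) • tVec x -
      y 8 • sxVec x)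
    (dot (xVec x) μ • tVec x + (x .u * y 8) • tVec x)
    (crs (sAct x (crs (qVec x) μ)) (tVec x) - y 0 • xVec x + x .r • crs (tVec x) μ +
      y 4 • crs (tVec x) (spVec x) + x .u • crs (tVec x) l)
    (y 4 • crs (sxVec x) (tVec x)) (-(dot (pVec x) (tVec x) * y 4)) 0

/-- The formula for the homotopy `S¹⁶ → S⁹`. -/
def lastHom2Fun (z : Fin 16 → A) : Fin 9 → A :=
  let c := vec3 (z 2) (z 3) (z 4)
  let g := vec3 (z 5) (z 6) (z 7)
  let h := vec3 (z 8) (z 9) (z 10)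
  let k := vec3 (z 11) (z 12) (z 13)
  pack9 (dot (xVec x) g - dot (pVec x) (tVec x) * z 15)
    (z 14 • crs (sxVec x) (tVec x) + dot (pVec x) (tVec x) • k - dot (tVec x) h • xVec x +
      crs (qVec x) (sAct x (crs (tVec x) g)) + x .r • crs (tVec x) g)
    (dot (crs (spVec x) (tVec x)) g + dot (crs (tVec x) (sxVec x)) c -
      dot (pVec x) (tVec x) * z 0)
    (z 15 • crs (sxVec x) (tVec x) - dot (tVec x) k • xVec x + x .u • crs (tVec x) g)
    (x .r * dot (tVec x) k - dot (adjVec x) (tVec x) * z 15 + dot (sxVec x) k -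
      x .u * dot (tVec x) h)

/-- The formula for the homotopy `S⁹ → S`. -/
def lastHom3Fun (y : Fin 9 → A) : Fin 1 → A := ![dot (tVec x) (vec3 (y 5) (y 6) (y 7))]

def lastHom1 : (Fin 9 → A) →ₗ[A] (Fin 16 → A) :=
  linearOf (lastHom1Fun x) fun a y z => by
    apply ext_fin16 <;>
    simp only [lastHom1Fun, ↓pack9_apply, ↓pack16_apply, Matrix.cons_val, Pi.add_apply,
      Pi.smul_apply, smul_eq_mul] <;>
    (try dsimp only [dot, ↓crs_0, ↓crs_1, ↓crs_2, ↓sAct_0, ↓sAct_1, ↓sAct_2, ↓vec_add,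
      ↓vec_sub, ↓vec_smul, ↓vec_zero, ↓vec3_0, ↓vec3_1, ↓vec3_2]) <;>
    (try ring)

lemma lastHom1_apply (y : Fin 9 → A) : lastHom1 x y = lastHom1Fun x y := rfl

def lastHom2 : (Fin 16 → A) →ₗ[A] (Fin 9 → A) :=
  linearOf (lastHom2Fun x) fun a y z => by
    apply ext_fin9 <;>
    simp only [lastHom2Fun, ↓pack9_apply, ↓pack16_apply, Matrix.cons_val, Pi.add_apply,
      Pi.smul_apply, smul_eq_mul] <;>
    (try dsimp only [dot, ↓crs_0, ↓crs_1, ↓crs_2, ↓sAct_0, ↓sAct_1, ↓sAct_2, ↓vec_add,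
      ↓vec_sub, ↓vec_smul, ↓vec_zero, ↓vec3_0, ↓vec3_1, ↓vec3_2]) <;>
    (try ring)

lemma lastHom2_apply (y : Fin 16 → A) : lastHom2 x y = lastHom2Fun x y := rfl

def lastHom3 : (Fin 9 → A) →ₗ[A] (Fin 1 → A) :=
  linearOf (lastHom3Fun x) fun a y z => by
    apply ext_fin1
    simp only [lastHom3Fun, ↓pack9_apply, ↓pack16_apply, Matrix.cons_val, Pi.add_apply,
      Pi.smul_apply, smul_eq_mul]
    dsimp only [dot, ↓crs_0, ↓crs_1, ↓crs_2, ↓sAct_0, ↓sAct_1, ↓sAct_2, ↓vec_add,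
      ↓vec_sub, ↓vec_smul, ↓vec_zero, ↓vec3_0, ↓vec3_1, ↓vec3_2]
    ring

lemma lastHom3_apply (y : Fin 9 → A) : lastHom3 x y = lastHom3Fun x y := rfl

theorem lastHom_one (y : Fin 9 → A) :
    diff2Fun x (lastHom1Fun x y) + diff1Fun x y 0 • pack9 0 0 0 (tVec x) 0 = (dot (tVec x) (lastEq x)) • y := by
  apply ext_fin9 <;>
  simp only [diff1Fun, diff2Fun, lastHom1Fun, midEq, lastEq, normEq, ↓pack9_apply, ↓pack16_apply, Matrix.cons_val,
    Pi.add_apply, Pi.smul_apply, Pi.zero_apply, smul_eq_mul] <;>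
  dsimp only [dot, vVec, sxVec, spVec, xVec, adjVec, ↓crs_0, ↓crs_1, ↓crs_2, ↓sAct_0, ↓sAct_1, ↓sAct_2, ↓vec_add,
    ↓vec_sub, ↓vec_smul, ↓vec_zero, ↓vec3_0, ↓vec3_1, ↓vec3_2,
    pVec_0, pVec_1, pVec_2, qVec_0, qVec_1, qVec_2, tVec_0, tVec_1, tVec_2] <;>
  ring

theorem lastHom_two (z : Fin 16 → A) :
    diff3Fun x (lastHom2Fun x z) + lastHom1Fun x (diff2Fun x z) = (dot (tVec x) (lastEq x)) • z := by
  apply ext_fin16 <;>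
  simp only [diff2Fun, diff3Fun, lastHom1Fun, lastHom2Fun, midEq, lastEq, normEq, ↓pack9_apply, ↓pack16_apply, Matrix.cons_val,
    Pi.add_apply, Pi.smul_apply, Pi.zero_apply, smul_eq_mul] <;>
  dsimp only [dot, vVec, sxVec, spVec, xVec, adjVec, ↓crs_0, ↓crs_1, ↓crs_2, ↓sAct_0, ↓sAct_1, ↓sAct_2, ↓vec_add,
    ↓vec_sub, ↓vec_smul, ↓vec_zero, ↓vec3_0, ↓vec3_1, ↓vec3_2,
    pVec_0, pVec_1, pVec_2, qVec_0, qVec_1, qVec_2, tVec_0, tVec_1, tVec_2] <;>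
  ring

theorem lastHom_three (y : Fin 9 → A) :
    diff4Fun x (lastHom3Fun x y) + lastHom2Fun x (diff3Fun x y) = (dot (tVec x) (lastEq x)) • y := by
  apply ext_fin9 <;>
  simp only [diff4Fun, diff3Fun, lastHom2Fun, lastHom3Fun, midEq, lastEq, normEq, ↓pack9_apply, ↓pack16_apply, Matrix.cons_val,
    Pi.add_apply, Pi.smul_apply, Pi.zero_apply, smul_eq_mul] <;>
  dsimp only [dot, vVec, sxVec, spVec, xVec, adjVec, ↓crs_0, ↓crs_1, ↓crs_2, ↓sAct_0, ↓sAct_1, ↓sAct_2, ↓vec_add,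
    ↓vec_sub, ↓vec_smul, ↓vec_zero, ↓vec3_0, ↓vec3_1, ↓vec3_2,
    pVec_0, pVec_1, pVec_2, qVec_0, qVec_1, qVec_2, tVec_0, tVec_1, tVec_2] <;>
  ring

theorem lastHom_four (w : Fin 1 → A) : lastHom3Fun x (diff4Fun x w) = (dot (tVec x) (lastEq x)) • w := by
  apply ext_fin1
  simp only [diff4Fun, lastHom3Fun, midEq, lastEq, normEq, ↓pack9_apply, ↓pack16_apply, Matrix.cons_val,
    Pi.add_apply, Pi.smul_apply, Pi.zero_apply, smul_eq_mul]
  dsimp only [dot, vVec, sxVec, spVec, xVec, adjVec, ↓crs_0, ↓crs_1, ↓crs_2, ↓sAct_0, ↓sAct_1, ↓sAct_2, ↓vec_add,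
    ↓vec_sub, ↓vec_smul, ↓vec_zero, ↓vec3_0, ↓vec3_1, ↓vec3_2,
    pVec_0, pVec_1, pVec_2, qVec_0, qVec_1, qVec_2, tVec_0, tVec_1, tVec_2]
  ring

theorem nullHomotopic_last : NullHomotopic x (dot (tVec x) (lastEq x)) :=
  ⟨pack9 0 0 0 (tVec x) 0, lastHom1 x, lastHom2 x, lastHom3 x,
    fun y => by simpa only [lastHom1_apply, diff2_apply, diff1_apply] using lastHom_one x y,
    fun z => by
      simpa only [lastHom2_apply, lastHom1_apply, diff3_apply, diff2_apply] using lastHom_two x z,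
    fun y => by
      simpa only [lastHom3_apply, lastHom2_apply, diff4_apply, diff3_apply] using lastHom_three x y,
    fun w => by simpa only [lastHom3_apply, diff4_apply] using lastHom_four x w⟩

end Complex

/-! ### Regular sequences modulo an ideal -/

section Regular

variable {S : Type*} [CommRing S]

/-- Multiplication by `f` is injective modulo the ideal `J`. -/
def NZ (J : Ideal S) (f : S) : Prop := ∀ v, f * v ∈ J → v ∈ J

/-- The elements of the list form a (weakly) regular sequence modulo `J`. -/
def RegSeq : Ideal S → List S → Prop
  | _, [] => True
  | J, f :: l => NZ J f ∧ RegSeq (J ⊔ Ideal.span {f}) l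

lemma mem_sup_span {J : Ideal S} {f v : S} :
    v ∈ J ⊔ Ideal.span {f} ↔ ∃ w, v - f * w ∈ J := by
  rw [sup_comm, Ideal.mem_span_singleton_sup]
  constructor
  · rintro ⟨a, b, hb, rfl⟩
    exact ⟨a, by rwa [mul_comm, add_sub_cancel_left]⟩
  · rintro ⟨w, h⟩
    exact ⟨w, _, h, by ring⟩

/-- Two elements of a regular sequence can be exchanged, in one direction. -/
lemma NZ.exchange {J : Ideal S} {x f : S} (hx : NZ J x) (hf : NZ (J ⊔ Ideal.span {x}) f) :
    NZ (J ⊔ Ideal.span {f}) x := by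
  intro v hv
  obtain ⟨w, hw⟩ := mem_sup_span.1 hv
  have h1 : f * w ∈ J ⊔ Ideal.span {x} := by
    refine mem_sup_span.2 ⟨v, ?_⟩
    rw [← neg_sub]
    exact J.neg_mem hw
  obtain ⟨w', hw'⟩ := mem_sup_span.1 (hf w h1)
  refine mem_sup_span.2 ⟨w', hx _ ?_⟩
  have : x * (v - f * w') = (x * v - f * w) + f * (w - x * w') := by ring
  rw [this]
  exact J.add_mem hw (J.mul_mem_left _ hw')

lemma NZ.mul {J : Ideal S} {a b : S} (ha : NZ J a) (hb : NZ J b) : NZ J (a * b) :=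
  fun v hv => hb v (ha _ (by rwa [← mul_assoc]))

/-- Regularity modulo a product follows from regularity modulo the factors. -/
lemma NZ.sup_mul {J : Ideal S} {a b f : S} (ha : NZ J a) (hfa : NZ (J ⊔ Ideal.span {a}) f)
    (hfb : NZ (J ⊔ Ideal.span {b}) f) : NZ (J ⊔ Ideal.span {a * b}) f := by
  intro v hv
  obtain ⟨w, hw⟩ := mem_sup_span.1 hv
  obtain ⟨v₁, h₁⟩ := mem_sup_span.1
    (hfa v (mem_sup_span.2 ⟨b * w, by rwa [← mul_assoc]⟩))
  have h2 : f * v₁ ∈ J ⊔ Ideal.span {b} := by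
    refine mem_sup_span.2 ⟨w, ha _ ?_⟩
    have : a * (f * v₁ - b * w) = (f * v - a * b * w) - f * (v - a * v₁) := by ring
    rw [this]
    exact J.sub_mem hw (J.mul_mem_left _ h₁)
  obtain ⟨v₂, h₂⟩ := mem_sup_span.1 (hfb v₁ h2)
  refine mem_sup_span.2 ⟨v₂, ?_⟩
  have : v - a * b * v₂ = (v - a * v₁) + a * (v₁ - b * v₂) := by ring
  rw [this]
  exact J.add_mem h₁ (J.mul_mem_left _ h₂)

lemma RegSeq.sup_mul {a b : S} : ∀ {l : List S} {J : Ideal S}, NZ J a →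
    RegSeq (J ⊔ Ideal.span {a}) l → RegSeq (J ⊔ Ideal.span {b}) l →
    RegSeq (J ⊔ Ideal.span {a * b}) l
  | [], _, _, _, _ => trivial
  | f :: l, J, ha, hla, hlb => by
    refine ⟨ha.sup_mul hla.1 hlb.1, ?_⟩
    have h1 := hla.2
    have h2 := hlb.2
    rw [sup_right_comm] at h1 h2 ⊢
    exact RegSeq.sup_mul (ha.exchange hla.1) h1 h2

lemma RegSeq.cons_mul {a b : S} {l : List S} {J : Ideal S} (ha : RegSeq J (a :: l))
    (hb : RegSeq J (b :: l)) : RegSeq J (a * b :: l) :=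
  ⟨ha.1.mul hb.1, RegSeq.sup_mul ha.1 ha.2 hb.2⟩

lemma RegSeq.cons_sq {a : S} {l : List S} {J : Ideal S} (ha : RegSeq J (a :: l)) :
    RegSeq J (a ^ 2 :: l) := by
  rw [pow_two]; exact ha.cons_mul ha

lemma RegSeq.cons_neg {a : S} {l : List S} {J : Ideal S} (ha : RegSeq J (a :: l)) :
    RegSeq J (-a :: l) := by
  refine ⟨fun v hv => ha.1 v ?_, ?_⟩
  · rw [neg_mul] at hv; exact neg_mem_iff.1 hv
  · rw [Ideal.span_singleton_neg]; exact ha.2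

lemma NZ.congr {J : Ideal S} {f g : S} (h : f - g ∈ J) (hg : NZ J g) : NZ J f := by
  intro v hv
  refine hg v ?_
  have : g * v = f * v - v * (f - g) := by ring
  rw [this]
  exact J.sub_mem hv (J.mul_mem_left _ h)

lemma sup_span_congr {J : Ideal S} {f g : S} (h : f - g ∈ J) :
    J ⊔ Ideal.span {f} = J ⊔ Ideal.span {g} := by
  apply le_antisymm
  · refine sup_le le_sup_left ?_
    rw [Ideal.span_singleton_le_iff_mem, mem_sup_span]
    exact ⟨1, by simpa using h⟩
  · refine sup_le le_sup_left ?_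
    rw [Ideal.span_singleton_le_iff_mem, mem_sup_span]
    refine ⟨1, ?_⟩
    rw [mul_one, ← neg_sub]
    exact J.neg_mem h

/-- Regularity of a sequence depends only on its members modulo the ideal. -/
lemma RegSeq.congr {f : S → S} : ∀ {l : List S} {J : Ideal S}, (∀ a ∈ l, a - f a ∈ J) →
    RegSeq J (l.map f) → RegSeq J l
  | [], _, _, _ => trivial
  | a :: l, J, h, hl => by
    have ha := h a List.mem_cons_self
    refine ⟨NZ.congr ha hl.1, ?_⟩
    rw [sup_span_congr ha]
    exact RegSeq.congr (fun b hb => le_sup_left (a := J) (h b (List.mem_cons_of_mem _ hb))) hl.2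

/-- A sequence stays regular modulo one more element that is regular modulo all its initial
parts. -/
lemma RegSeq.sup {P : Ideal S → Prop} {x : S} (hx : ∀ J, P J → NZ J x) :
    ∀ {l : List S} {J : Ideal S}, P J → (∀ f ∈ l, ∀ J, P J → P (J ⊔ Ideal.span {f})) →
    RegSeq J l → RegSeq (J ⊔ Ideal.span {x}) l
  | [], _, _, _, _ => trivial
  | f :: l, J, hJ, hP, hl => by
    have h1 : P (J ⊔ Ideal.span {f}) := hP f List.mem_cons_self J hJ
    refine ⟨hl.1.exchange (hx _ h1), ?_⟩
    rw [sup_right_comm]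
    exact RegSeq.sup hx h1 (fun g hg => hP g (List.mem_cons_of_mem _ hg)) hl.2

end Regular

section Graded

variable {S : Type*} [CommRing S] [Algebra ℂ S] (𝒜 : ℕ → Submodule ℂ S) [GradedAlgebra 𝒜]

/-- In a graded ring, a homogeneous element that is regular modulo a homogeneous regular element
of positive degree is regular. -/
lemma NZ.of_sup {J : Ideal S} (hJ : J.IsHomogeneous 𝒜) {x f : S} {d e : ℕ} (hxd : x ∈ 𝒜 d)
    (hd : 0 < d) (hfe : f ∈ 𝒜 e) (hx : NZ J x) (hf : NZ (J ⊔ Ideal.span {x}) f) : NZ J f := by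
  -- Write `v = x y` modulo `J` with `y` of smaller degree; then `f y ∈ J` because `x` is regular.
  have key : ∀ n : ℕ, ∀ v ∈ 𝒜 n, f * v ∈ J → v ∈ J := by
    intro n
    induction n using Nat.strong_induction_on with
    | _ n ih =>
      intro v hv hfv
      obtain ⟨w, hw⟩ := mem_sup_span.1 (hf v (le_sup_left (a := J) hfv))
      have h1 := hJ n hw
      rw [DirectSum.decompose_sub, DirectSum.sub_apply, AddSubgroupClass.coe_sub,
        DirectSum.decompose_of_mem_same _ hv] at h1
      by_cases hdn : d ≤ n
      · rw [DirectSum.coe_decompose_mul_of_left_mem_of_le 𝒜 hxd hdn] at h1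
        set y : S := (DirectSum.decompose 𝒜 w (n - d) : S) with hy
        have hy' : y ∈ 𝒜 (n - d) := SetLike.coe_mem _
        have h2 : f * y ∈ J := by
          apply hx
          have : x * (f * y) = f * v - f * (v - x * y) := by ring
          rw [this]
          exact J.sub_mem hfv (J.mul_mem_left _ h1)
        have h3 := ih (n - d) (by omega) y hy' h2
        have : v = (v - x * y) + x * y := by ring
        rw [this]
        exact J.add_mem h1 (J.mul_mem_left _ h3)
      · rw [DirectSum.coe_decompose_mul_of_left_mem_of_not_le 𝒜 hxd hdn, sub_zero] at h1
        exact h1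
  intro v hv
  classical
  rw [← DirectSum.sum_support_decompose 𝒜 v]
  refine J.sum_mem fun n _ => key n _ (SetLike.coe_mem _) ?_
  have := hJ (e + n) hv
  rwa [DirectSum.coe_decompose_mul_add_of_left_mem 𝒜 hfe] at this

/-- A homogeneous sequence is regular if it is regular modulo a homogeneous regular element of
positive degree. -/
lemma RegSeq.of_sup {x : S} {d : ℕ} (hxd : x ∈ 𝒜 d) (hd : 0 < d) : ∀ {l : List S} {J : Ideal S},
    J.IsHomogeneous 𝒜 → (∀ f ∈ l, ∃ e, f ∈ 𝒜 e) → NZ J x →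
    RegSeq (J ⊔ Ideal.span {x}) l → RegSeq J l
  | [], _, _, _, _, _ => trivial
  | f :: l, J, hJ, hl, hx, h => by
    obtain ⟨e, he⟩ := hl f List.mem_cons_self
    refine ⟨hx.of_sup 𝒜 hJ hxd hd he h.1, ?_⟩
    refine RegSeq.of_sup hxd hd (hJ.sup (Ideal.homogeneous_span 𝒜 _ ?_))
      (fun g hg => hl g (List.mem_cons_of_mem _ hg)) (hx.exchange h.1) ?_
    · rintro _ rfl; exact ⟨e, he⟩
    · rw [sup_right_comm]; exact h.2

/-- Modulo a homogeneous ideal, `s - 1` is regular for every `s` of positive degree. -/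
lemma NZ.sub_one {J : Ideal S} (hJ : J.IsHomogeneous 𝒜) {s : S} {d : ℕ} (hs : s ∈ 𝒜 d)
    (hd : 0 < d) : NZ J (s - 1) := by
  intro v hv
  have key : ∀ n : ℕ, (DirectSum.decompose 𝒜 v n : S) ∈ J := by
    intro n
    induction n using Nat.strong_induction_on with
    | _ n ih =>
      have h1 := hJ n hv
      rw [sub_mul, one_mul, DirectSum.decompose_sub, DirectSum.sub_apply,
        AddSubgroupClass.coe_sub] at h1
      by_cases hdn : d ≤ n
      · rw [DirectSum.coe_decompose_mul_of_left_mem_of_le 𝒜 hs hdn] at h1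
        exact (J.sub_mem_iff_right (J.mul_mem_left _ (ih (n - d) (by omega)))).1 h1
      · rw [DirectSum.coe_decompose_mul_of_left_mem_of_not_le 𝒜 hs hdn, zero_sub] at h1
        exact neg_mem_iff.1 h1
  classical
  rw [← DirectSum.sum_support_decompose 𝒜 v]
  exact J.sum_mem fun n _ => key n

end Graded

/-! ### Exactness modulo an ideal -/

section ExactMod

variable {S : Type*} [CommRing S] {ι κ τ ρ : Type}

/-- Exactness of a composable pair of matrices modulo the ideal `J`. -/
def ExactMod (J : Ideal S) (d' : (κ → S) →ₗ[S] (ι → S)) (d : (ι → S) →ₗ[S] (τ → S)) : Prop :=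
  ∀ z, (∀ i, d z i ∈ J) → ∃ y, ∀ i, (z - d' y) i ∈ J

lemma mem_pi_sup_span {J : Ideal S} {f : S} {z : ι → S}
    (h : ∀ i, z i ∈ J ⊔ Ideal.span {f}) : ∃ w : ι → S, ∀ i, (z - f • w) i ∈ J := by
  choose w hw using fun i => mem_sup_span.1 (h i)
  exact ⟨w, hw⟩

/-- If multiplication by `f` is null-homotopic and `f` is regular modulo `J`, exactness modulo
`J` follows from exactness modulo `J + (f)` one step further to the left. -/
lemma ExactMod.of_homotopy [Finite κ] [Finite ι] [Finite τ] {J : Ideal S} {f : S} (hf : NZ J f)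
    {d : (ι → S) →ₗ[S] (τ → S)} {d' : (κ → S) →ₗ[S] (ι → S)} {d'' : (ρ → S) →ₗ[S] (κ → S)}
    (s : (ι → S) →ₗ[S] (κ → S)) (s' : (τ → S) →ₗ[S] (ι → S))
    (h : ∀ z, d' (s z) + s' (d z) = f • z) (hd : ∀ y, d' (d'' y) = 0)
    (hex : ExactMod (J ⊔ Ideal.span {f}) d'' d') : ExactMod J d' d := by
  intro z hz
  have hs' : ∀ i, s' (d z) i ∈ J := Ideal.map_pi J _ hz s'
  obtain ⟨y, hy⟩ := hex (s z) fun i => by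
    refine mem_sup_span.2 ⟨z i, ?_⟩
    have h1 := congrFun (h z) i
    simp only [Pi.add_apply, Pi.smul_apply, smul_eq_mul] at h1
    rw [← h1, sub_add_cancel_left]
    exact J.neg_mem (hs' i)
  obtain ⟨w, hw⟩ := mem_pi_sup_span hy
  have hdw := Ideal.map_pi J _ hw d'
  refine ⟨w, fun i => hf _ ?_⟩
  have h1 := congrFun (h z) i
  have h2 := hdw i
  simp only [map_sub, map_smul, hd, sub_zero, Pi.sub_apply, Pi.smul_apply, smul_eq_mul,
    Pi.add_apply] at h1 h2
  rw [Pi.sub_apply, mul_sub, ← h1]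
  have : d' (s z) i + s' (d z) i - f * d' w i = (d' (s z) i - f * d' w i) + s' (d z) i := by ring
  rw [this]
  exact J.add_mem h2 (hs' i)

/-- If the relations among the generators of the ideal `I` modulo `K + (f)` are exhausted by those
that hold on the nose, then `f` is regular modulo `K + I` as soon as it is regular modulo `K`. -/
lemma NZ.sup_of_exactMod [Finite ι] {K : Ideal S} {f : S} (hf : NZ K f) {d : (ι → S) →ₗ[S] (Fin 1 → S)}
    {d' : (κ → S) →ₗ[S] (ι → S)} (hd : ∀ y, d (d' y) = 0)
    (hex : ExactMod (K ⊔ Ideal.span {f}) d' d) {I : Ideal S}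
    (hI : ∀ a, a ∈ I ↔ ∃ y, a = d y 0) : NZ (K ⊔ I) f := by
  intro v hv
  obtain ⟨k, hk, a, ha, hka⟩ := Submodule.mem_sup.1 hv
  obtain ⟨y, rfl⟩ := (hI a).1 ha
  obtain ⟨z, hz⟩ := hex y fun i => by
    obtain rfl : i = 0 := Subsingleton.elim _ _
    refine mem_sup_span.2 ⟨v, ?_⟩
    rw [← hka, sub_add_cancel_right]
    exact K.neg_mem hk
  obtain ⟨w, hw⟩ := mem_pi_sup_span hz
  have hdw := Ideal.map_pi K _ hw d 0
  simp only [map_sub, map_smul, hd, sub_zero, Pi.sub_apply, Pi.smul_apply, smul_eq_mul] at hdw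
  have h1 : v - d w 0 ∈ K := by
    apply hf
    have : f * (v - d w 0) = k + (d y 0 - f * d w 0) := by
      rw [mul_sub, ← hka]; ring
    rw [this]
    exact K.add_mem hk hdw
  have : v = (v - d w 0) + d w 0 := by ring
  rw [this]
  exact Submodule.add_mem_sup h1 ((hI _).2 ⟨w, rfl⟩)

end ExactMod

/-! ### Exactness of the complex -/

section Exactness

variable {A : Type} [CommRing A] (x : Var → A)

/-- Four members of the ideal of the nine equations, multiplication by which is
null-homotopic. -/
def regList : List A :=
  [dot (pVec x) (qVec x), dot (tVec x) (lastEq x), normEq x, dot (pVec x) (vVec x)]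

variable {x} in
lemma exactMod_four {J : Ideal A} {f : A} (hf : NZ J f) (h : NullHomotopic x f) :
    ExactMod J (0 : (Fin 0 → A) →ₗ[A] (Fin 1 → A)) (diff4 x) := by
  obtain ⟨e, s₁, s₂, s₃, h1, h2, h3, h4⟩ := h
  refine ExactMod.of_homotopy (ρ := Fin 0) (d'' := 0) hf 0 s₃ (fun z => ?_) (fun _ => rfl) ?_
  · rw [h4]; simp
  · exact fun z _ => ⟨0, fun i => i.elim0⟩

variable {x} in
lemma exactMod_three {J : Ideal A} {f : A} (hf : NZ J f) (h : NullHomotopic x f)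
    (hex : ExactMod (J ⊔ Ideal.span {f}) (0 : (Fin 0 → A) →ₗ[A] (Fin 1 → A)) (diff4 x)) :
    ExactMod J (diff4 x) (diff3 x) := by
  obtain ⟨e, s₁, s₂, s₃, h1, h2, h3, h4⟩ := h
  exact ExactMod.of_homotopy hf s₃ s₂ h3 (by simp) hex

variable {x} in
lemma exactMod_two {J : Ideal A} {f : A} (hf : NZ J f) (h : NullHomotopic x f)
    (hex : ExactMod (J ⊔ Ideal.span {f}) (diff4 x) (diff3 x)) :
    ExactMod J (diff3 x) (diff2 x) := by
  obtain ⟨e, s₁, s₂, s₃, h1, h2, h3, h4⟩ := h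
  refine ExactMod.of_homotopy hf s₂ s₁ h2 (fun y => ?_) hex
  rw [diff3_apply, diff4_apply, diff3_diff4]

variable {x} in
lemma exactMod_one {J : Ideal A} {f : A} (hf : NZ J f) (h : NullHomotopic x f)
    (hex : ExactMod (J ⊔ Ideal.span {f}) (diff3 x) (diff2 x)) :
    ExactMod J (diff2 x) (diff1 x) := by
  obtain ⟨e, s₁, s₂, s₃, h1, h2, h3, h4⟩ := h
  refine ExactMod.of_homotopy hf s₁ ((LinearMap.proj (R := A) (φ := fun _ : Fin 1 => A) 0).smulRight e)
    (fun z => h1 z) (fun y => ?_) hex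
  rw [diff2_apply, diff3_apply, diff2_diff3]

/-- The complex is exact modulo every ideal modulo which the four elements are regular. -/
lemma exactMod_of_regSeq {J : Ideal A} (h : RegSeq J (regList x)) :
    ExactMod J (diff2 x) (diff1 x) ∧ ExactMod J (diff3 x) (diff2 x) ∧
      ExactMod J (diff4 x) (diff3 x) ∧
      ExactMod J (0 : (Fin 0 → A) →ₗ[A] (Fin 1 → A)) (diff4 x) := by
  obtain ⟨r1, r2, r3, r4, -⟩ := h
  have e1 := nullHomotopic_pairing x
  have e2 := nullHomotopic_last x
  have e3 := nullHomotopic_norm x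
  have e4 := nullHomotopic_quadric x
  exact ⟨exactMod_one r1 e1 (exactMod_two r2 e2 (exactMod_three r3 e3 (exactMod_four r4 e4))),
    exactMod_two r1 e1 (exactMod_three r2 e2 (exactMod_four r3 e3)),
    exactMod_three r1 e1 (exactMod_four r2 e2), exactMod_four r1 e1⟩

/-- The image of the first differential is the ideal generated by the equations. -/
lemma mem_span_equations (a : A) :
    a ∈ Ideal.span (Set.range (equations x)) ↔ ∃ y, a = diff1 x y 0 := by
  rw [Ideal.mem_span_range_iff_exists_fun]
  refine exists_congr fun y => ?_
  rw [equations_eq_pack9, diff1_apply, eq_comm]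
  have : ∑ i, y i * pack9 (dot (pVec x) (qVec x)) (midEq x) (dot (pVec x) (vVec x)) (lastEq x)
      (normEq x) i = diff1Fun x y 0 := by
    simp only [Fin.sum_univ_succ, Fin.sum_univ_zero, diff1Fun, dot, vec3, pack9, Matrix.cons_val]
    simp [Fin.succ]
    ring
  rw [this]

end Exactness

/-! ### Reduction to a monomial situation -/

section Specialization

local notation "𝕏" => (X : Var → MvPolynomial Var ℂ)

/-- The monomial prime generated by a set of variables. -/
def varIdeal (s : Set Var) : Ideal (MvPolynomial Var ℂ) := Ideal.span (X '' s)

lemma eval_eq_zero_of_mem_varIdeal {s : Set Var} {c : Var → ℂ} (hc : ∀ v ∈ s, c v = 0)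
    {f : MvPolynomial Var ℂ} (hf : f ∈ varIdeal s) : eval c f = 0 := by
  have : varIdeal s ≤ RingHom.ker (eval c) := by
    refine Ideal.span_le.2 ?_
    rintro _ ⟨v, hv, rfl⟩
    simp [hc v hv]
  exact this hf

open Classical in
/-- The substitution of zero for the variables in a set. -/
def killVars (s : Set Var) : MvPolynomial Var ℂ →ₐ[ℂ] MvPolynomial Var ℂ :=
  aeval fun v => if v ∈ s then 0 else X v

lemma killVars_of_mem {s : Set Var} {v : Var} (h : v ∈ s) : killVars s (X v) = 0 := by
  simp [killVars, h]

lemma killVars_of_notMem {s : Set Var} {v : Var} (h : v ∉ s) : killVars s (X v) = X v := by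
  simp [killVars, h]

lemma sub_killVars_mem (s : Set Var) (f : MvPolynomial Var ℂ) :
    f - killVars s f ∈ varIdeal s := by
  rw [← Ideal.Quotient.eq]
  have : Ideal.Quotient.mkₐ ℂ (varIdeal s) =
      (Ideal.Quotient.mkₐ ℂ (varIdeal s)).comp (killVars s) := by
    apply MvPolynomial.algHom_ext
    intro v
    by_cases h : v ∈ s
    · rw [AlgHom.comp_apply, killVars_of_mem h, map_zero]
      exact Ideal.Quotient.eq_zero_iff_mem.2 (Ideal.subset_span ⟨v, h, rfl⟩)
    · rw [AlgHom.comp_apply, killVars_of_notMem h]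
  exact DFunLike.congr_fun this f

lemma varIdeal_isPrime (s : Set Var) : (varIdeal s).IsPrime := by
  have : varIdeal s = RingHom.ker (killVars s) := by
    apply le_antisymm
    · refine Ideal.span_le.2 ?_
      rintro _ ⟨v, hv, rfl⟩
      exact killVars_of_mem hv
    · intro f hf
      have h1 := sub_killVars_mem s f
      rwa [(hf : killVars s f = 0), sub_zero] at h1
  rw [this]
  exact RingHom.ker_isPrime _

lemma nz_varIdeal {s : Set Var} {f : MvPolynomial Var ℂ} (c : Var → ℂ) (hc : ∀ v ∈ s, c v = 0)
    (hf : eval c f ≠ 0) : NZ (varIdeal s) f := fun _ hv =>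
  ((varIdeal_isPrime s).mem_or_mem hv).resolve_left
    fun h => hf (eval_eq_zero_of_mem_varIdeal hc h)

lemma varIdeal_sup (s : Set Var) (v : Var) :
    varIdeal s ⊔ Ideal.span {X v} = varIdeal (insert v s) := by
  rw [varIdeal, varIdeal, Set.image_insert_eq, Ideal.span_insert, sup_comm]

lemma regSeq_singleton {J : Ideal (MvPolynomial Var ℂ)} {f : MvPolynomial Var ℂ} (h : NZ J f) :
    RegSeq J [f] := ⟨h, trivial⟩

lemma nz_varIdeal_X {s : Set Var} {v : Var} (hv : v ∉ s) :
    NZ (varIdeal s) (X v : MvPolynomial Var ℂ) :=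
  nz_varIdeal (fun v' => if v' = v then 1 else 0)
    (fun v' h => if_neg (fun h' : v' = v => hv (h' ▸ h))) (by simp)

lemma regSeq_X {s : Set Var} {v : Var} (hv : v ∉ s) {l : List (MvPolynomial Var ℂ)}
    (h : RegSeq (varIdeal (insert v s)) l) : RegSeq (varIdeal s) (X v :: l) :=
  ⟨nz_varIdeal_X hv, by rwa [varIdeal_sup]⟩

lemma regSeq_of_killVars {s : Set Var} {l : List (MvPolynomial Var ℂ)}
    (h : RegSeq (varIdeal s) (l.map (killVars s))) : RegSeq (varIdeal s) l :=
  RegSeq.congr (f := killVars s) (fun a _ => sub_killVars_mem s a) h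

/-- Weights for which the nine equations are homogeneous. -/
def stdWeight : Var → ℕ
  | .r => 2
  | .u => 3
  | _ => 1

local instance : GradedAlgebra (weightedHomogeneousSubmodule ℂ stdWeight) :=
  weightedGradedAlgebra ℂ stdWeight

lemma varIdeal_isHomogeneous (s : Set Var) :
    (varIdeal s).IsHomogeneous (weightedHomogeneousSubmodule ℂ stdWeight) := by
  apply Ideal.homogeneous_span
  rintro _ ⟨v, -, rfl⟩
  exact ⟨stdWeight v, isWeightedHomogeneous_X ℂ stdWeight v⟩

/-- It suffices to check regularity of a homogeneous sequence after setting one more variable to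
zero. -/
lemma regSeq_of_insert {s : Set Var} {v : Var} (hv : v ∉ s) {l : List (MvPolynomial Var ℂ)}
    (hl : ∀ f ∈ l, ∃ e, f ∈ weightedHomogeneousSubmodule ℂ stdWeight e)
    (h : RegSeq (varIdeal (insert v s)) l) : RegSeq (varIdeal s) l := by
  refine RegSeq.of_sup (weightedHomogeneousSubmodule ℂ stdWeight) (x := X v) (d := stdWeight v)
    (isWeightedHomogeneous_X ℂ stdWeight v) ?_ (varIdeal_isHomogeneous s) hl (nz_varIdeal_X hv) ?_
  · cases v <;> simp [stdWeight]
  · rwa [varIdeal_sup]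

lemma regList_homogeneous : ∀ f ∈ regList 𝕏,
    ∃ e, f ∈ weightedHomogeneousSubmodule ℂ stdWeight e := by
  have hX : ∀ v, (X v : MvPolynomial Var ℂ) ∈ weightedHomogeneousSubmodule ℂ stdWeight
    (stdWeight v) := fun v => isWeightedHomogeneous_X ℂ stdWeight v
  have hmul : ∀ {m n k : ℕ} {f g : MvPolynomial Var ℂ},
      f ∈ weightedHomogeneousSubmodule ℂ stdWeight m →
      g ∈ weightedHomogeneousSubmodule ℂ stdWeight n → k = m + n →
      f * g ∈ weightedHomogeneousSubmodule ℂ stdWeight k := by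
    rintro m n _ f g hf hg rfl
    exact IsWeightedHomogeneous.mul hf hg
  have hv : ∀ {i : Fin 3}, vVec 𝕏 i ∈
      weightedHomogeneousSubmodule ℂ stdWeight 2 := by
    intro i
    fin_cases i <;>
    · dsimp [vVec, spVec, sAct, vec3, tVec, pVec]
      refine add_mem (add_mem (add_mem ?_ ?_) ?_) ?_ <;>
      exact hmul (hX _) (hX _) rfl
  have hx : ∀ {i : Fin 3}, xVec 𝕏 i ∈
      weightedHomogeneousSubmodule ℂ stdWeight 2 := by
    intro i
    fin_cases i <;>
    · dsimp [xVec, vec3]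
      refine sub_mem ?_ ?_ <;>
      exact hmul (hX _) (hX _) rfl
  have hsx : ∀ {i : Fin 3}, sxVec 𝕏 i ∈
      weightedHomogeneousSubmodule ℂ stdWeight 3 := by
    intro i
    fin_cases i <;>
    · dsimp [sxVec, sAct, vec3]
      refine add_mem (add_mem ?_ ?_) ?_ <;>
      exact hmul (hX _) hx rfl
  have ha : ∀ {i : Fin 3}, adjVec 𝕏 i ∈
      weightedHomogeneousSubmodule ℂ stdWeight 3 := by
    intro i
    fin_cases i <;>
    · dsimp [adjVec, vec3]
      refine add_mem (add_mem ?_ ?_) ?_ <;>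
      refine hmul (n := 2) (hX _) (sub_mem ?_ ?_) rfl <;>
      exact hmul (hX _) (hX _) rfl
  have hl : ∀ {i : Fin 3}, lastEq 𝕏 i ∈
      weightedHomogeneousSubmodule ℂ stdWeight 4 := by
    intro i
    fin_cases i <;>
    · dsimp [lastEq, vec3, pVec, crs, qVec]
      refine add_mem (sub_mem (hmul (hX _) (hX _) rfl) (hmul (hX _) hx rfl))
        (sub_mem (hmul (hX _) hsx rfl) (hmul (hX _) hsx rfl))
  intro f hf
  simp only [regList, List.mem_cons, List.not_mem_nil, or_false] at hf
  rcases hf with rfl | rfl | rfl | rfl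
  · refine ⟨2, ?_⟩
    dsimp only [dot, pVec_0, pVec_1, pVec_2, qVec_0, qVec_1, qVec_2]
    refine add_mem (add_mem ?_ ?_) ?_ <;> exact hmul (hX _) (hX _) rfl
  · refine ⟨5, ?_⟩
    dsimp only [dot, tVec_0, tVec_1, tVec_2]
    refine add_mem (add_mem ?_ ?_) ?_ <;> exact hmul (hX _) hl rfl
  · refine ⟨4, ?_⟩
    dsimp only [normEq, dot, qVec_0, qVec_1, qVec_2]
    rw [pow_two]
    refine add_mem (hmul (hX _) (hX _) rfl)
      (add_mem (hmul (hX _) (hX _) rfl) (add_mem (add_mem ?_ ?_) ?_)) <;>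
    exact hmul (hX _) ha rfl
  · refine ⟨3, ?_⟩
    dsimp only [dot, pVec_0, pVec_1, pVec_2]
    refine add_mem (add_mem ?_ ?_) ?_ <;> exact hmul (hX _) hv rfl

lemma map_killVars_regList : (regList 𝕏).map
    (killVars {.s33, .s23, .s13, .s12, .s11, .t1, .q2, .p1, .u}) =
    [𝕏 .p3 * 𝕏 .q3, -(𝕏 .s22 * (𝕏 .q1 ^ 2 * 𝕏 .t3 ^ 2)), 𝕏 .r ^ 2,
      𝕏 .p2 ^ 2 * 𝕏 .s22 + 𝕏 .p4 * 𝕏 .p2 * 𝕏 .t2 + 𝕏 .p4 * 𝕏 .p3 * 𝕏 .t3] := by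
  simp only [regList, List.map_cons, List.map_nil]
  congr 1
  · simp [killVars, dot, pVec, qVec]
  congr 1
  · simp [killVars, dot, tVec, lastEq, xVec, sxVec, vec3, crs, sAct, pVec, qVec]
    ring
  congr 1
  · simp [killVars, normEq, adjVec, dot, vec3, qVec]
  congr 1
  simp [killVars, dot, pVec, vVec, spVec, sAct, vec3, tVec]
  ring

lemma regSeq_last (s : Set Var) (h2 : Var.p2 ∉ s) (h4 : Var.p4 ∉ s) (ht : Var.t2 ∉ s) : RegSeq (varIdeal s)
    [𝕏 .p2 ^ 2 * 𝕏 .s22 + 𝕏 .p4 * 𝕏 .p2 * 𝕏 .t2 + 𝕏 .p4 * 𝕏 .p3 * 𝕏 .t3] := by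
  refine regSeq_singleton
    (nz_varIdeal (fun v => if v = .p2 ∨ v = .p4 ∨ v = .t2 then 1 else 0) ?_ ?_)
  · intro v hv
    refine if_neg ?_
    rintro (rfl | rfl | rfl) <;> contradiction
  · simp

/-- Modulo a suitable set of variables, the four elements are products of variables, except for
the last one. -/
lemma regSeq_special : RegSeq (varIdeal {.s33, .s23, .s13, .s12, .s11, .t1, .q2, .p1, .u})
    (regList 𝕏) := by
  apply regSeq_of_killVars
  rw [map_killVars_regList]
  -- Splitting the monomials into their factors leaves sequences of variables, followed by the last
  -- element, which does not vanish for `p₂ = p₄ = t₂ = 1` and all other variables zero.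
  apply RegSeq.cons_mul <;> refine regSeq_X (by simp) ?_ <;>
  apply RegSeq.cons_neg <;> apply RegSeq.cons_mul <;>
  [skip; (apply RegSeq.cons_mul <;> apply RegSeq.cons_sq);
    skip; (apply RegSeq.cons_mul <;> apply RegSeq.cons_sq)] <;>
  refine regSeq_X (by simp) ?_ <;>
  exact RegSeq.cons_sq (regSeq_X (by simp) (regSeq_last _ (by simp) (by simp) (by simp)))

lemma regSeq_of_subset_u_p1 :
    RegSeq (varIdeal ∅) (regList 𝕏) ∧
    RegSeq (varIdeal {.u}) (regList 𝕏) ∧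
    RegSeq (varIdeal {.p1, .u}) (regList 𝕏) := by
  have h2 : RegSeq (varIdeal {.p1, .u}) (regList 𝕏) := by
    have := regSeq_special
    iterate 7 replace this := regSeq_of_insert (by simp) regList_homogeneous this
    exact this
  have h1 := regSeq_of_insert (by simp) regList_homogeneous h2
  exact ⟨regSeq_of_insert (s := ∅) (v := .u) (by simp) regList_homogeneous (by simpa using h1),
    h1, h2⟩

lemma nz_s33_sub_one {J : Ideal (MvPolynomial Var ℂ)}
    (hJ : J.IsHomogeneous (weightedHomogeneousSubmodule ℂ stdWeight)) :
    NZ J (𝕏 .s33 - 1) :=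
  NZ.sub_one (weightedHomogeneousSubmodule ℂ stdWeight) hJ (d := 1)
    (isWeightedHomogeneous_X ℂ stdWeight .s33) one_pos

/-- The four elements stay regular after setting `s33 = 1`. -/
lemma RegSeq.sup_s33 {s : Set Var} (h : RegSeq (varIdeal s)
    (regList 𝕏)) :
    RegSeq (varIdeal s ⊔ Ideal.span {𝕏 .s33 - 1}) (regList 𝕏) := by
  refine RegSeq.sup (P := fun J => J.IsHomogeneous (weightedHomogeneousSubmodule ℂ stdWeight))
    (fun J hJ => nz_s33_sub_one hJ) (varIdeal_isHomogeneous s) (fun f hf J hJ => hJ.sup ?_) h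
  obtain ⟨e, he⟩ := regList_homogeneous f hf
  apply Ideal.homogeneous_span
  rintro _ rfl
  exact ⟨e, he⟩

end Specialization

/-! ### Regularity of `u, p₁` and the substitution `s₃₃ = 1` -/

section Consequences

local notation "𝕏" => (X : Var → MvPolynomial Var ℂ)

/-- An ideal modulo which the complex is exact, and remains so modulo `u` and `p₁`. -/
structure GoodBase (K : Ideal (MvPolynomial Var ℂ)) : Prop where
  reg : RegSeq K (regList X)
  reg_u : RegSeq (K ⊔ Ideal.span {X .u}) (regList X)
  reg_p1 : RegSeq (K ⊔ Ideal.span {X .u} ⊔ Ideal.span {X .p1}) (regList X)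
  nz_u : NZ K (X .u)
  nz_p1 : NZ (K ⊔ Ideal.span {X .u}) (X .p1)

lemma varIdeal_empty : varIdeal ∅ = ⊥ := by simp [varIdeal]

lemma goodBase_bot : GoodBase ⊥ := by
  obtain ⟨h0, h1, h2⟩ := regSeq_of_subset_u_p1
  have e1 : (⊥ : Ideal (MvPolynomial Var ℂ)) ⊔ Ideal.span {X .u} = varIdeal {.u} := by
    rw [← varIdeal_empty, varIdeal_sup]; simp
  have e2 : varIdeal {.u} ⊔ Ideal.span {X .p1} = varIdeal {.p1, .u} := varIdeal_sup _ _
  refine ⟨varIdeal_empty ▸ h0, e1 ▸ h1, e1 ▸ e2 ▸ h2, ?_, ?_⟩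
  · rw [← varIdeal_empty]; exact nz_varIdeal_X (by simp)
  · rw [e1]; exact nz_varIdeal_X (by simp)

lemma goodBase_s33 : GoodBase (Ideal.span {𝕏 .s33 - 1}) := by
  obtain ⟨h0, h1, h2⟩ := regSeq_of_subset_u_p1
  have e0 : Ideal.span {𝕏 .s33 - 1} = varIdeal ∅ ⊔ Ideal.span {𝕏 .s33 - 1} := by
    rw [varIdeal_empty, bot_sup_eq]
  have e1 : Ideal.span {𝕏 .s33 - 1} ⊔ Ideal.span {X .u} =
      varIdeal {.u} ⊔ Ideal.span {𝕏 .s33 - 1} := by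
    rw [e0, sup_right_comm, varIdeal_sup]; simp [varIdeal_empty]
  have e2 : varIdeal {.u} ⊔ Ideal.span {𝕏 .s33 - 1} ⊔ Ideal.span {X .p1} =
      varIdeal {.p1, .u} ⊔ Ideal.span {𝕏 .s33 - 1} := by
    rw [sup_right_comm, varIdeal_sup]
  refine ⟨e0 ▸ h0.sup_s33, ?_, ?_, ?_, ?_⟩
  · rw [e1]; exact h1.sup_s33
  · rw [e1, e2]; exact h2.sup_s33
  · rw [e0]
    refine (nz_varIdeal_X (by simp)).exchange ?_
    rw [varIdeal_sup]
    exact nz_s33_sub_one (varIdeal_isHomogeneous _)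
  · rw [e1]
    refine (nz_varIdeal_X (by simp)).exchange ?_
    rw [varIdeal_sup]
    exact nz_s33_sub_one (varIdeal_isHomogeneous _)

variable {K : Ideal (MvPolynomial Var ℂ)}

lemma GoodBase.nz_sup_ideal14_u (h : GoodBase K) : NZ (K ⊔ ideal14) (X .u) :=
  h.nz_u.sup_of_exactMod (d := diff1 X) (d' := diff2 X) (fun y => diff1_diff2 X y)
    (exactMod_of_regSeq X h.reg_u).1 (mem_span_equations X)

lemma GoodBase.nz_sup_ideal14_p1 (h : GoodBase K) :
    NZ (K ⊔ Ideal.span {X .u} ⊔ ideal14) (X .p1) :=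
  h.nz_p1.sup_of_exactMod (d := diff1 X) (d' := diff2 X) (fun y => diff1_diff2 X y)
    (exactMod_of_regSeq X h.reg_p1).1 (mem_span_equations X)

end Consequences

/-! ### Degrees of the vectors in the complex -/

section Grading

variable {σ : Type} {w : σ → ℤ}

lemma wh_mul {f g : MvPolynomial σ ℂ} {a b k : ℤ} (hf : IsWeightedHomogeneous w f a)
    (hg : IsWeightedHomogeneous w g b) (h : k = a + b) : IsWeightedHomogeneous w (f * g) k :=
  h ▸ hf.mul hg

lemma wh_neg {f : MvPolynomial σ ℂ} {a : ℤ} (hf : IsWeightedHomogeneous w f a) :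
    IsWeightedHomogeneous w (-f) a :=
  (weightedHomogeneousSubmodule ℂ w a).neg_mem hf

lemma wh_sub {f g : MvPolynomial σ ℂ} {a : ℤ} (hf : IsWeightedHomogeneous w f a)
    (hg : IsWeightedHomogeneous w g a) : IsWeightedHomogeneous w (f - g) a :=
  (weightedHomogeneousSubmodule ℂ w a).sub_mem hf hg

lemma wh_congr {f : MvPolynomial σ ℂ} {a k : ℤ} (hf : IsWeightedHomogeneous w f a)
    (h : k = a) : IsWeightedHomogeneous w f k := h ▸ hf

variable (w) in
/-- Vectors whose entries have the degrees of the `pᵢ`, shifted by `a`. -/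
def PType (pw : Fin 3 → ℤ) (a : ℤ) (v : Fin 3 → MvPolynomial σ ℂ) : Prop :=
  ∀ i, IsWeightedHomogeneous w (v i) (a + pw i)

variable (w) in
/-- Vectors whose entries have degrees dual to those of the `pᵢ`, shifted by `a`. -/
def QType (pw : Fin 3 → ℤ) (a : ℤ) (v : Fin 3 → MvPolynomial σ ℂ) : Prop :=
  ∀ i, IsWeightedHomogeneous w (v i) (a - pw i)

variable {pw : Fin 3 → ℤ} {a b k : ℤ} {v v' : Fin 3 → MvPolynomial σ ℂ}

lemma PType.add (h : PType w pw a v) (h' : PType w pw a v') : PType w pw a (v + v') :=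
  fun i => (h i).add (h' i)
lemma PType.sub (h : PType w pw a v) (h' : PType w pw a v') : PType w pw a (v - v') :=
  fun i => wh_sub (h i) (h' i)
lemma QType.add (h : QType w pw a v) (h' : QType w pw a v') : QType w pw a (v + v') :=
  fun i => (h i).add (h' i)
lemma QType.sub (h : QType w pw a v) (h' : QType w pw a v') : QType w pw a (v - v') :=
  fun i => wh_sub (h i) (h' i)
lemma PType.smul {f : MvPolynomial σ ℂ} (hf : IsWeightedHomogeneous w f b)
    (h : PType w pw a v) (hk : k = a + b) : PType w pw k (f • v) :=
  fun i => wh_mul hf (h i) (by omega)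
lemma QType.smul {f : MvPolynomial σ ℂ} (hf : IsWeightedHomogeneous w f b)
    (h : QType w pw a v) (hk : k = a + b) : QType w pw k (f • v) :=
  fun i => wh_mul hf (h i) (by omega)

/- The dot product pairs the two patterns of degrees, and the cross product exchanges them. -/
lemma PType.dot (h : PType w pw a v) (h' : QType w pw b v') (hk : k = a + b) :
    IsWeightedHomogeneous w (dot v v') k :=
  ((wh_mul (h 0) (h' 0) (by omega)).add (wh_mul (h 1) (h' 1) (by omega))).add
    (wh_mul (h 2) (h' 2) (by omega))

lemma QType.dot (h : QType w pw a v) (h' : PType w pw b v') (hk : k = a + b) :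
    IsWeightedHomogeneous w (KeyVariety.dot v v') k :=
  ((wh_mul (h 0) (h' 0) (by omega)).add (wh_mul (h 1) (h' 1) (by omega))).add
    (wh_mul (h 2) (h' 2) (by omega))

lemma PType.crs (h : PType w pw a v) (h' : PType w pw b v')
    (hk : k = a + b + (pw 0 + pw 1 + pw 2)) : QType w pw k (crs v v') := by
  intro i
  fin_cases i <;>
  exact wh_sub (wh_mul (h _) (h' _) (by dsimp; omega)) (wh_mul (h _) (h' _) (by dsimp; omega))

lemma QType.crs (h : QType w pw a v) (h' : QType w pw b v')
    (hk : k = a + b - (pw 0 + pw 1 + pw 2)) : PType w pw k (crs v v') := by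
  intro i
  fin_cases i <;>
  exact wh_sub (wh_mul (h _) (h' _) (by dsimp; omega)) (wh_mul (h _) (h' _) (by dsimp; omega))

/-- Polynomials `x`, in place of the 18 variables, whose degrees `W` make the nine equations
homogeneous. -/
structure GradedCoords (w : σ → ℤ) (x : Var → MvPolynomial σ ℂ) (W : Var → ℤ) : Prop where
  hom : ∀ v, IsWeightedHomogeneous w (x v) (W v)
  q2 : W .q2 = d₀ W - W .p2
  q3 : W .q3 = d₀ W - W .p3
  s11 : W .s11 = degs W 4 - W .p1 - W .p1
  s12 : W .s12 = degs W 4 - W .p1 - W .p2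
  s13 : W .s13 = degs W 4 - W .p1 - W .p3
  s22 : W .s22 = degs W 4 - W .p2 - W .p2
  s23 : W .s23 = degs W 4 - W .p2 - W .p3
  s33 : W .s33 = degs W 4 - W .p3 - W .p3
  p4 : W .p4 = 2 * W .r - W .u
  t1 : W .t1 = degs W 4 - W .p4 - W .p1
  t2 : W .t2 = degs W 4 - W .p4 - W .p2
  t3 : W .t3 = degs W 4 - W .p4 - W .p3

/-- The weights of the `pᵢ`. -/
def pWeights (W : Var → ℤ) : Fin 3 → ℤ := ![W .p1, W .p2, W .p3]

variable {x : Var → MvPolynomial σ ℂ} {W : Var → ℤ}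

lemma xVec_eq {A : Type} [CommRing A] (x : Var → A) : crs (qVec x) (tVec x) = xVec x := rfl

namespace GradedCoords

lemma sAct (H : GradedCoords w x W) (h : PType w (pWeights W) a v)
    (hk : k = a + degs W 4) : QType w (pWeights W) k (sAct x v) := by
  have h0 : IsWeightedHomogeneous w (v 0) (a + W .p1) := h 0
  have h1 : IsWeightedHomogeneous w (v 1) (a + W .p2) := h 1
  have h2 : IsWeightedHomogeneous w (v 2) (a + W .p3) := h 2
  intro i
  match i with
  | 0 =>
    show IsWeightedHomogeneous w (KeyVariety.sAct x v 0) (k - W .p1)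
    exact ((wh_mul (H.hom _) h0 (by rw [H.s11]; omega)).add
      (wh_mul (H.hom _) h1 (by rw [H.s12]; omega))).add (wh_mul (H.hom _) h2 (by rw [H.s13]; omega))
  | 1 =>
    show IsWeightedHomogeneous w (KeyVariety.sAct x v 1) (k - W .p2)
    exact ((wh_mul (H.hom _) h0 (by rw [H.s12]; omega)).add
      (wh_mul (H.hom _) h1 (by rw [H.s22]; omega))).add (wh_mul (H.hom _) h2 (by rw [H.s23]; omega))
  | 2 =>
    show IsWeightedHomogeneous w (KeyVariety.sAct x v 2) (k - W .p3)
    exact ((wh_mul (H.hom _) h0 (by rw [H.s13]; omega)).add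
      (wh_mul (H.hom _) h1 (by rw [H.s23]; omega))).add (wh_mul (H.hom _) h2 (by rw [H.s33]; omega))

lemma c_eq (W : Var → ℤ) : degs W 4 = -d₀ W + (W .p1 + W .p2 + W .p3) + W .r := rfl

lemma pWeights_sum (W : Var → ℤ) : pWeights W 0 + pWeights W 1 + pWeights W 2 =
    W .p1 + W .p2 + W .p3 := rfl

lemma pVec (H : GradedCoords w x W) : PType w (pWeights W) 0 (pVec x) := by
  intro i
  match i with
  | 0 => exact wh_congr (H.hom .p1) (zero_add _)
  | 1 => exact wh_congr (H.hom .p2) (zero_add _)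
  | 2 => exact wh_congr (H.hom .p3) (zero_add _)

lemma qVec (H : GradedCoords w x W) : QType w (pWeights W) (d₀ W) (qVec x) := by
  intro i
  match i with
  | 0 => exact wh_congr (H.hom .q1) (by simp [pWeights, d₀])
  | 1 => exact wh_congr (H.hom .q2) H.q2.symm
  | 2 => exact wh_congr (H.hom .q3) H.q3.symm

lemma tVec (H : GradedCoords w x W) :
    QType w (pWeights W) (degs W 4 - W .p4) (tVec x) := by
  intro i
  match i with
  | 0 => exact wh_congr (H.hom .t1) H.t1.symm
  | 1 => exact wh_congr (H.hom .t2) H.t2.symm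
  | 2 => exact wh_congr (H.hom .t3) H.t3.symm

lemma xVec (H : GradedCoords w x W) : PType w (pWeights W)
    (d₀ W + degs W 4 - W .p4 - (W .p1 + W .p2 + W .p3)) (xVec x) :=
  xVec_eq x ▸ H.qVec.crs H.tVec (by rw [pWeights_sum]; omega)

lemma spVec (H : GradedCoords w x W) : QType w (pWeights W) (degs W 4) (spVec x) :=
  H.sAct H.pVec (by omega)

lemma vVec (H : GradedCoords w x W) : QType w (pWeights W) (degs W 4) (vVec x) :=
  H.spVec.add (H.tVec.smul (H.hom .p4) (by omega))

lemma sxVec (H : GradedCoords w x W) : QType w (pWeights W)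
    (d₀ W + degs W 4 + degs W 4 - W .p4 - (W .p1 + W .p2 + W .p3)) (sxVec x) :=
  H.sAct H.xVec (by omega)

lemma adjVec (H : GradedCoords w x W) : PType w (pWeights W)
    (d₀ W + 2 * degs W 4 - 2 * (W .p1 + W .p2 + W .p3)) (adjVec x) := by
  have hs := H.s11
  have hs2 := H.s12
  have hs3 := H.s13
  have hs4 := H.s22
  have hs5 := H.s23
  have hs6 := H.s33
  have hq := H.q2
  have hq' := H.q3
  have hd : d₀ W = W .p1 + W .q1 := rfl
  intro i
  match i with
  | 0 =>
    show IsWeightedHomogeneous w (KeyVariety.adjVec x 0) (_ + W .p1)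
    refine ((wh_mul (H.hom _) (b := W .s22 + W .s33) (wh_sub ?_ ?_) ?_).add
      (wh_mul (H.hom _) (b := W .s13 + W .s23) (wh_sub ?_ ?_) ?_)).add
      (wh_mul (H.hom _) (b := W .s12 + W .s23) (wh_sub ?_ ?_) ?_) <;>
    first
      | exact wh_mul (H.hom _) (H.hom _) (by omega)
      | omega
  | 1 =>
    show IsWeightedHomogeneous w (KeyVariety.adjVec x 1) (_ + W .p2)
    refine ((wh_mul (H.hom _) (b := W .s13 + W .s23) (wh_sub ?_ ?_) ?_).add
      (wh_mul (H.hom _) (b := W .s11 + W .s33) (wh_sub ?_ ?_) ?_)).add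
      (wh_mul (H.hom _) (b := W .s12 + W .s13) (wh_sub ?_ ?_) ?_) <;>
    first
      | exact wh_mul (H.hom _) (H.hom _) (by omega)
      | omega
  | 2 =>
    show IsWeightedHomogeneous w (KeyVariety.adjVec x 2) (_ + W .p3)
    refine ((wh_mul (H.hom _) (b := W .s12 + W .s23) (wh_sub ?_ ?_) ?_).add
      (wh_mul (H.hom _) (b := W .s12 + W .s13) (wh_sub ?_ ?_) ?_)).add
      (wh_mul (H.hom _) (b := W .s11 + W .s22) (wh_sub ?_ ?_) ?_) <;>
    first
      | exact wh_mul (H.hom _) (H.hom _) (by omega)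
      | omega

lemma midEq (H : GradedCoords w x W) : PType w (pWeights W) (W .r) (midEq x) :=
  (H.pVec.smul (H.hom .r) (by omega)).add
    (H.qVec.crs H.vVec (by rw [pWeights_sum, c_eq]; omega))

lemma lastEq (H : GradedCoords w x W) : PType w (pWeights W) (W .u) (lastEq x) := by
  have := H.p4
  have := c_eq W
  exact ((H.pVec.smul (H.hom .u) (by omega)).sub (H.xVec.smul (H.hom .r) (by omega))).add
    (H.qVec.crs H.sxVec (by rw [pWeights_sum]; omega))

lemma normEq (H : GradedCoords w x W) : IsWeightedHomogeneous w (normEq x) (2 * W .r) := by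
  have := H.p4
  have := c_eq W
  refine (wh_mul (H.hom _) (H.hom _) (by omega)).add (IsWeightedHomogeneous.add ?_
    (H.qVec.dot H.adjVec (by omega)))
  rw [pow_two]
  exact wh_mul (H.hom _) (H.hom _) (by omega)

end GradedCoords

end Grading

/-! ### The degrees of the differentials -/

section GradedMaps

variable {σ : Type} {w : σ → ℤ} {x : Var → MvPolynomial σ ℂ} {W : Var → ℤ} {m : ℤ}

lemma pack9_graded {a₀ a₄ a₈ : MvPolynomial σ ℂ} {μ l : Fin 3 → MvPolynomial σ ℂ}
    (h0 : IsWeightedHomogeneous w a₀ (m - d₀ W)) (hμ : QType w (pWeights W) (m - W .r) μ)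
    (h4 : IsWeightedHomogeneous w a₄ (m - degs W 4)) (hl : QType w (pWeights W) (m - W .u) l)
    (h8 : IsWeightedHomogeneous w a₈ (m - 2 * W .r)) :
    pack9 a₀ μ a₄ l a₈ ∈ freePiece w (twist1 W) m := by
  have e : ∀ a b : ℤ, m - (a + b) = m - a - b := fun a b => by omega
  intro i
  match i with
  | 0 => exact h0
  | 1 => exact wh_congr (hμ 0) (e _ _)
  | 2 => exact wh_congr (hμ 1) (e _ _)
  | 3 => exact wh_congr (hμ 2) (e _ _)
  | 4 => exact h4
  | 5 => exact wh_congr (hl 0) (e _ _)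
  | 6 => exact wh_congr (hl 1) (e _ _)
  | 7 => exact wh_congr (hl 2) (e _ _)
  | 8 => exact h8

lemma pack9_dual_graded {a₀ a₄ a₈ : MvPolynomial σ ℂ} {μ l : Fin 3 → MvPolynomial σ ℂ}
    (h0 : IsWeightedHomogeneous w a₀ (m - δ W + d₀ W))
    (hμ : PType w (pWeights W) (m - δ W + W .r) μ)
    (h4 : IsWeightedHomogeneous w a₄ (m - δ W + degs W 4))
    (hl : PType w (pWeights W) (m - δ W + W .u) l)
    (h8 : IsWeightedHomogeneous w a₈ (m - δ W + 2 * W .r)) :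
    pack9 a₀ μ a₄ l a₈ ∈ freePiece w (twist3 W) m := by
  have e : ∀ a b : ℤ, m - (δ W - (a + b)) = m - δ W + a + b := fun a b => by omega
  have e' : ∀ a : ℤ, m - (δ W - a) = m - δ W + a := fun a => by omega
  intro i
  match i with
  | 0 => exact wh_congr h0 (e' _)
  | 1 => exact wh_congr (hμ 0) (e _ _)
  | 2 => exact wh_congr (hμ 1) (e _ _)
  | 3 => exact wh_congr (hμ 2) (e _ _)
  | 4 => exact wh_congr h4 (e' _)
  | 5 => exact wh_congr (hl 0) (e _ _)
  | 6 => exact wh_congr (hl 1) (e _ _)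
  | 7 => exact wh_congr (hl 2) (e _ _)
  | 8 => exact wh_congr h8 (e' _)

lemma pack16_graded {a b mm n : MvPolynomial σ ℂ} {c g h k : Fin 3 → MvPolynomial σ ℂ}
    (ha : IsWeightedHomogeneous w a (m - (W .r + d₀ W)))
    (hb : IsWeightedHomogeneous w b (m - (W .u + d₀ W)))
    (hc : QType w (pWeights W) (m - (W .r + W .u)) c)
    (hg : QType w (pWeights W) (m - 2 * W .r) g)
    (hh : PType w (pWeights W) (m - δ W + 2 * W .r) h)
    (hk : PType w (pWeights W) (m - δ W + (W .r + W .u)) k)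
    (hm : IsWeightedHomogeneous w mm (m - (δ W - (W .r + d₀ W))))
    (hn : IsWeightedHomogeneous w n (m - (δ W - (W .u + d₀ W)))) :
    pack16 a b c g h k mm n ∈ freePiece w (twist2 W) m := by
  have e : ∀ a b : ℤ, m - (δ W - (a + b)) = m - δ W + a + b := fun a b => by omega
  have e' : ∀ a b : ℤ, m - (a + b) = m - a - b := fun a b => by omega
  intro i
  fin_cases i
  exacts [ha, hb, wh_congr (hc 0) (e' _ _), wh_congr (hc 1) (e' _ _), wh_congr (hc 2) (e' _ _),
    wh_congr (hg 0) (e' _ _), wh_congr (hg 1) (e' _ _), wh_congr (hg 2) (e' _ _), wh_congr (hh 0) (e _ _),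
    wh_congr (hh 1) (e _ _), wh_congr (hh 2) (e _ _), wh_congr (hk 0) (e _ _), wh_congr (hk 1) (e _ _), wh_congr (hk 2) (e _ _), hm, hn]

lemma twist1_parts {y : Fin 9 → MvPolynomial σ ℂ} (hy : y ∈ freePiece w (twist1 W) m) :
    IsWeightedHomogeneous w (y 0) (m - d₀ W) ∧
    QType w (pWeights W) (m - W .r) (vec3 (y 1) (y 2) (y 3)) ∧
    IsWeightedHomogeneous w (y 4) (m - degs W 4) ∧
    QType w (pWeights W) (m - W .u) (vec3 (y 5) (y 6) (y 7)) ∧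
    IsWeightedHomogeneous w (y 8) (m - 2 * W .r) := by
  have e : ∀ a b : ℤ, m - a - b = m - (a + b) := fun a b => by omega
  refine ⟨hy 0, fun i => ?_, hy 4, fun i => ?_, hy 8⟩
  · match i with
    | 0 => exact wh_congr (hy 1) (e _ _)
    | 1 => exact wh_congr (hy 2) (e _ _)
    | 2 => exact wh_congr (hy 3) (e _ _)
  · match i with
    | 0 => exact wh_congr (hy 5) (e _ _)
    | 1 => exact wh_congr (hy 6) (e _ _)
    | 2 => exact wh_congr (hy 7) (e _ _)

lemma twist3_parts {y : Fin 9 → MvPolynomial σ ℂ} (hy : y ∈ freePiece w (twist3 W) m) :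
    IsWeightedHomogeneous w (y 0) (m - δ W + d₀ W) ∧
    PType w (pWeights W) (m - δ W + W .r) (vec3 (y 1) (y 2) (y 3)) ∧
    IsWeightedHomogeneous w (y 4) (m - δ W + degs W 4) ∧
    PType w (pWeights W) (m - δ W + W .u) (vec3 (y 5) (y 6) (y 7)) ∧
    IsWeightedHomogeneous w (y 8) (m - δ W + 2 * W .r) := by
  have e : ∀ a b : ℤ, m - δ W + a + b = m - (δ W - (a + b)) := fun a b => by omega
  have e' : ∀ a : ℤ, m - δ W + a = m - (δ W - a) := fun a => by omega
  refine ⟨wh_congr (hy 0) (e' _), fun i => ?_, wh_congr (hy 4) (e' _), fun i => ?_,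
    wh_congr (hy 8) (e' _)⟩
  · match i with
    | 0 => exact wh_congr (hy 1) (e _ _)
    | 1 => exact wh_congr (hy 2) (e _ _)
    | 2 => exact wh_congr (hy 3) (e _ _)
  · match i with
    | 0 => exact wh_congr (hy 5) (e _ _)
    | 1 => exact wh_congr (hy 6) (e _ _)
    | 2 => exact wh_congr (hy 7) (e _ _)

lemma twist2_parts {z : Fin 16 → MvPolynomial σ ℂ} (hz : z ∈ freePiece w (twist2 W) m) :
    IsWeightedHomogeneous w (z 0) (m - (W .r + d₀ W)) ∧
    IsWeightedHomogeneous w (z 1) (m - (W .u + d₀ W)) ∧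
    QType w (pWeights W) (m - (W .r + W .u)) (vec3 (z 2) (z 3) (z 4)) ∧
    QType w (pWeights W) (m - 2 * W .r) (vec3 (z 5) (z 6) (z 7)) ∧
    PType w (pWeights W) (m - δ W + 2 * W .r) (vec3 (z 8) (z 9) (z 10)) ∧
    PType w (pWeights W) (m - δ W + (W .r + W .u)) (vec3 (z 11) (z 12) (z 13)) ∧
    IsWeightedHomogeneous w (z 14) (m - (δ W - (W .r + d₀ W))) ∧
    IsWeightedHomogeneous w (z 15) (m - (δ W - (W .u + d₀ W))) := by
  have e : ∀ a b : ℤ, m - δ W + a + b = m - (δ W - (a + b)) := fun a b => by omega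
  have e' : ∀ a b : ℤ, m - a - b = m - (a + b) := fun a b => by omega
  refine ⟨hz 0, hz 1, fun i => ?_, fun i => ?_, fun i => ?_, fun i => ?_, hz 14, hz 15⟩
  · match i with
    | 0 => exact wh_congr (hz 2) (e' _ _)
    | 1 => exact wh_congr (hz 3) (e' _ _)
    | 2 => exact wh_congr (hz 4) (e' _ _)
  · match i with
    | 0 => exact wh_congr (hz 5) (e' _ _)
    | 1 => exact wh_congr (hz 6) (e' _ _)
    | 2 => exact wh_congr (hz 7) (e' _ _)
  · match i with
    | 0 => exact wh_congr (hz 8) (e _ _)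
    | 1 => exact wh_congr (hz 9) (e _ _)
    | 2 => exact wh_congr (hz 10) (e _ _)
  · match i with
    | 0 => exact wh_congr (hz 11) (e _ _)
    | 1 => exact wh_congr (hz 12) (e _ _)
    | 2 => exact wh_congr (hz 13) (e _ _)

lemma delta_eq (W : Var → ℤ) : δ W = 2 * W .r + W .u + (W .p1 + W .p2 + W .p3) := rfl

theorem GradedCoords.diff1 (H : GradedCoords w x W) :
    IsGradedMap w (twist1 W) twist0 (diff1 x) := by
  intro m y hy i
  obtain rfl : i = 0 := Subsingleton.elim _ _
  obtain ⟨h0, h1, h4, h5, h8⟩ := twist1_parts hy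
  have e : m - twist0 0 = m := sub_zero m
  rw [e, diff1_apply]
  exact ((((wh_mul h0 (H.pVec.dot H.qVec rfl) (by omega)).add (h1.dot H.midEq (by omega))).add
    (wh_mul h4 (H.pVec.dot H.vVec rfl) (by omega))).add (h5.dot H.lastEq (by omega))).add
    (wh_mul h8 H.normEq (by omega))

theorem GradedCoords.diff2 (H : GradedCoords w x W) :
    IsGradedMap w (twist2 W) (twist1 W) (diff2 x) := by
  intro m z hz
  obtain ⟨ha, hb, hc, hg, hh, hk, hm, hn⟩ := twist2_parts hz
  have hP := GradedCoords.pWeights_sum W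
  have hcc := GradedCoords.c_eq W
  have hδ := delta_eq W
  have hp4 := H.p4
  rw [diff2_apply]
  refine pack9_graded ?_ ?_ ?_ ?_ ?_
  · refine wh_sub (IsWeightedHomogeneous.add (wh_sub (wh_sub (wh_neg ?_) ?_) ?_) ?_) ?_
    · exact wh_mul (H.hom _) ha (by omega)
    · exact wh_mul (H.hom _) hb (by omega)
    · exact hg.dot H.adjVec (by omega)
    · exact hh.dot H.sxVec (by omega)
    · exact hk.dot H.vVec (by omega)
  · refine QType.sub (QType.add (QType.add (QType.add (QType.sub (QType.add (QType.sub
      ?_ ?_) ?_) ?_) ?_) ?_) ?_) ?_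
    · exact H.qVec.smul ha (by omega)
    · exact hc.smul (H.hom _) (by omega)
    · exact H.sAct (hg.crs H.qVec rfl) (by omega)
    · exact hg.smul (H.hom _) (by omega)
    · exact H.xVec.crs hh (by omega)
    · exact H.pVec.crs hk (by omega)
    · exact H.sxVec.smul hm (by omega)
    · exact H.vVec.smul hn (by omega)
  · refine IsWeightedHomogeneous.add (wh_sub ?_ ?_) ?_
    · exact H.qVec.dot hk (by omega)
    · exact wh_mul (H.hom _) hm (by omega)
    · exact wh_mul (H.hom _) hn (by omega)
  · refine QType.add (QType.add (QType.sub (QType.add (QType.add ?_ ?_) ?_) ?_) ?_) ?_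
    · exact H.qVec.smul hb (by omega)
    · exact hc.smul (H.hom _) (by omega)
    · exact H.sAct (hc.crs H.qVec rfl) (by omega)
    · exact hg.smul (H.hom _) (by omega)
    · exact hh.crs H.pVec (by omega)
    · exact H.vVec.smul hm (by omega)
  · exact IsWeightedHomogeneous.add (H.xVec.dot hc (by omega)) (H.pVec.dot hg (by omega))

theorem GradedCoords.diff3 (H : GradedCoords w x W) :
    IsGradedMap w (twist3 W) (twist2 W) (diff3 x) := by
  intro m y hy
  obtain ⟨h0, hμ, h4, hl, h8⟩ := twist3_parts hy
  have hP := GradedCoords.pWeights_sum W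
  have hcc := GradedCoords.c_eq W
  have hδ := delta_eq W
  have hp4 := H.p4
  rw [diff3_apply]
  refine pack16_graded ?_ ?_ ?_ ?_ ?_ ?_ ?_ ?_
  · refine IsWeightedHomogeneous.add (wh_sub ?_ ?_) ?_
    · exact H.sxVec.dot hμ (by omega)
    · exact wh_mul (H.hom _) h4 (by omega)
    · exact H.vVec.dot hl (by omega)
  · exact wh_sub (wh_mul (H.hom _) h4 (by omega)) (H.vVec.dot hμ (by omega))
  · refine QType.sub (QType.sub ?_ ?_) ?_
    · exact H.vVec.smul h0 (by omega)
    · exact hμ.crs H.pVec (by omega)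
    · exact H.qVec.smul h4 (by omega)
  · refine QType.sub (QType.sub ?_ ?_) ?_
    · exact hl.crs H.pVec (by omega)
    · exact H.sxVec.smul h0 (by omega)
    · exact hμ.crs H.xVec (by omega)
  · refine PType.sub (PType.add (PType.add (PType.sub ?_ ?_) ?_) ?_) ?_
    · exact H.adjVec.smul h0 (by omega)
    · exact H.qVec.crs (H.sAct hμ rfl) (by omega)
    · exact hμ.smul (H.hom _) (by omega)
    · exact hl.smul (H.hom _) (by omega)
    · exact H.pVec.smul h8 (by omega)
  · refine PType.sub (PType.sub (PType.sub ?_ ?_) ?_) ?_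
    · exact hμ.smul (H.hom _) (by omega)
    · exact hl.smul (H.hom _) (by omega)
    · exact H.qVec.crs (H.sAct hl rfl) (by omega)
    · exact H.xVec.smul h8 (by omega)
  · exact wh_sub (H.qVec.dot hμ (by omega)) (wh_mul (H.hom _) h0 (by omega))
  · exact wh_sub (H.qVec.dot hl (by omega)) (wh_mul (H.hom _) h0 (by omega))

theorem GradedCoords.diff4 (H : GradedCoords w x W) :
    IsGradedMap w (twist4 W) (twist3 W) (diff4 x) := by
  intro m y hy
  have h0 : IsWeightedHomogeneous w (y 0) (m - δ W) := hy 0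
  rw [diff4_apply]
  exact pack9_dual_graded (wh_mul h0 (H.pVec.dot H.qVec rfl) (by omega))
    (H.midEq.smul h0 (by omega)) (wh_mul h0 (H.pVec.dot H.vVec rfl) (by omega))
    (H.lastEq.smul h0 (by omega)) (wh_mul h0 H.normEq (by omega))

end GradedMaps

/-! ### Weight systems -/

section WeightRelations

lemma map_equations {A B : Type} [CommRing A] [CommRing B] (φ : A →+* B) (x : Var → A) (i : Fin 9) :
    φ (equations x i) = equations (fun v => φ (x v)) i := by
  rw [equations_eq_pack9, equations_eq_pack9]
  fin_cases i <;>
  simp [pack9, dot, midEq, lastEq, normEq, adjVec, xVec, sxVec, spVec, vVec, sAct, crs, vec3, pVec,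
    qVec, tVec]

lemma eval_weightedHomogeneous {σ : Type} {w : σ → ℤ} {f : MvPolynomial σ ℂ} {n : ℤ}
    (hf : IsWeightedHomogeneous w f n) {s : ℂ} (hs : s ≠ 0) (c : σ → ℂ) :
    eval (fun v => s ^ w v * c v) f = s ^ n * eval c f := by
  rw [eval_eq, eval_eq, Finset.mul_sum]
  refine Finset.sum_congr rfl fun d hd => ?_
  have hn : Finsupp.weight w d = n := hf (mem_support_iff.1 hd)
  have : s ^ n = ∏ i ∈ d.support, (s ^ w i) ^ d i := by
    rw [← hn, Finsupp.weight_apply, Finsupp.sum]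
    have key : ∀ t : Finset σ, s ^ (∑ i ∈ t, d i • w i) = ∏ i ∈ t, (s ^ w i) ^ d i := by
      intro t
      classical
      induction t using Finset.induction_on with
      | empty => simp
      | insert a t ha ih =>
        rw [Finset.sum_insert ha, Finset.prod_insert ha, zpow_add₀ hs, ih, nsmul_eq_mul,
          mul_comm (d a : ℤ), _root_.zpow_mul, zpow_natCast]
    exact key _
  simp_rw [mul_pow]
  rw [Finset.prod_mul_distrib, this]
  ring

lemma two_zpow_inj {a b : ℤ} (h : (2 : ℂ) ^ a = 2 ^ b) : a = b := by
  have h1 : (2 : ℝ) ^ a = 2 ^ b := by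
    have := congrArg (fun z : ℂ => ‖z‖) h
    simpa using this
  exact (zpow_right_inj₀ (by norm_num) (by norm_num)).1 h1

set_option maxHeartbeats 1000000 in
/-- The scaling behaviour of the nine equations determines the weights. Homogeneity is used only in
the form that the substitution `xᵥ ↦ 2 ^ W(v) xᵥ` multiplies each equation by a power of `2`. -/
lemma gradedCoords_of_scaling {σ : Type} {w : σ → ℤ} {x : Var → MvPolynomial σ ℂ} {W : Var → ℤ}
    (hom : ∀ v, IsWeightedHomogeneous w (x v) (W v))
    (h : ∀ i, ∃ n : ℤ, ∀ c : Var → ℂ, c .s33 = 1 →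
      equations (fun v => 2 ^ W v * c v) i = 2 ^ n * equations c i) : GradedCoords w x W := by
  have h2 : (2 : ℂ) ≠ 0 := two_ne_zero
  simp only [equations_eq_pack9] at h
  obtain ⟨n0, h0⟩ := h 0
  obtain ⟨n1, h1⟩ := h 1
  obtain ⟨n4, h4⟩ := h 4
  obtain ⟨n8, h8⟩ := h 8
  simp only [pack9_apply] at h0 h1 h4 h8
  -- Each point below isolates one monomial of an equation, or that monomial and another whose
  -- contribution is already known.
  have a1 := h0 (fun | .p1 => 1 | .q1 => 1 | .s33 => 1 | _ => 0) rfl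
  have a2 := h0 (fun | .p2 => 1 | .q2 => 1 | .s33 => 1 | _ => 0) rfl
  have a3 := h0 (fun | .p3 => 1 | .q3 => 1 | .s33 => 1 | _ => 0) rfl
  have b1 := h4 (fun | .p1 => 1 | .s11 => 1 | .s33 => 1 | _ => 0) rfl
  have b2 := h4 (fun | .p2 => 1 | .s22 => 1 | .s33 => 1 | _ => 0) rfl
  have b3 := h4 (fun | .p3 => 1 | .s33 => 1 | _ => 0) rfl
  have b12 := h4 (fun | .p1 => 1 | .p2 => 1 | .s12 => 1 | .s33 => 1 | _ => 0) rfl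
  have b13 := h4 (fun | .p1 => 1 | .p3 => 1 | .s13 => 1 | .s33 => 1 | _ => 0) rfl
  have b23 := h4 (fun | .p2 => 1 | .p3 => 1 | .s23 => 1 | .s33 => 1 | _ => 0) rfl
  have c1 := h4 (fun | .p1 => 1 | .p4 => 1 | .t1 => 1 | .s33 => 1 | _ => 0) rfl
  have c2 := h4 (fun | .p2 => 1 | .p4 => 1 | .t2 => 1 | .s33 => 1 | _ => 0) rfl
  have c3 := h4 (fun | .p3 => 1 | .p4 => 1 | .t3 => 1 | .s33 => 1 | _ => 0) rfl
  have e1 := h1 (fun | .p1 => 1 | .r => 1 | .s33 => 1 | _ => 0) rfl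
  have e2 := h1 (fun | .p1 => 1 | .q2 => 1 | .s13 => 1 | .s33 => 1 | _ => 0) rfl
  have f1 := h8 (fun | .u => 1 | .p4 => 1 | .s33 => 1 | _ => 0) rfl
  have f2 := h8 (fun | .r => 1 | .s33 => 1 | _ => 0) rfl
  simp [dot, pVec, qVec, tVec, vVec, spVec, sAct, vec3, midEq, crs, normEq, adjVec]
    at a1 a2 a3 b1 b2 b3 b12 b13 b23 c1 c2 c3 e1 e2 f1 f2
  have m2 : ∀ {a b n : ℤ}, (2 : ℂ) ^ a * 2 ^ b = 2 ^ n → a + b = n := fun h =>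
    two_zpow_inj (by rw [zpow_add₀ h2, h])
  have m3 : ∀ {a b c n : ℤ}, (2 : ℂ) ^ a * (2 ^ b * 2 ^ c) = 2 ^ n → a + b + c = n := fun h =>
    two_zpow_inj (by rw [zpow_add₀ h2, zpow_add₀ h2, mul_assoc, h])
  have g1 := m2 a1
  have g2 := m2 a2
  have g3 := m2 a3
  have g4 := m3 b1
  have g5 := m3 b2
  have g6 := m3 b3
  have g7 : W .p1 + W .s12 + W .p2 = n4 := m3 (by linear_combination b12 / 2)
  have g8 : W .p1 + W .s13 + W .p3 = n4 := m3 (by linear_combination (b13 - b3) / 2)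
  have g9 : W .p2 + W .s23 + W .p3 = n4 := m3 (by linear_combination (b23 - b3) / 2)
  have g10 := m3 c1
  have g11 := m3 c2
  have g12 : W .p3 + W .p4 + W .t3 = n4 := m3 (by linear_combination c3 - b3)
  have g13 := m2 e1
  have g14 := m3 e2
  have g15 := m2 f1
  have g16 := m2 (by rw [← pow_two]; exact f2)
  have hd : d₀ W = W .p1 + W .q1 := rfl
  have hc := GradedCoords.c_eq W
  refine ⟨hom, ?_, ?_, ?_, ?_, ?_, ?_, ?_, ?_, ?_, ?_, ?_, ?_⟩ <;>
  linarith

lemma gradedCoords14 {w : Var → ℤ} (hw : IsWeightSystem equations14 w) :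
    GradedCoords w X w := by
  refine gradedCoords_of_scaling (fun v => isWeightedHomogeneous_X ℂ w v) fun i => ?_
  obtain ⟨n, hn⟩ := hw i
  refine ⟨n, fun c _ => ?_⟩
  have h1 := eval_weightedHomogeneous hn two_ne_zero c
  rw [equations14, map_equations, map_equations] at h1
  simpa using h1

/-- The coordinates of `Σ¹³`, among them the constant `s₃₃ = 1`. -/
def coord13 : Var → MvPolynomial Var13 ℂ :=
  fun v => if h : v = Var.s33 then 1 else X ⟨v, h⟩

lemma coord13_s33 : coord13 .s33 = 1 := by simp [coord13]

lemma coord13_of_ne {v : Var} (h : v ≠ .s33) : coord13 v = X ⟨v, h⟩ := by simp [coord13, h]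

lemma gradedCoords13 {w : Var13 → ℤ} (hw : IsWeightSystem equations13 w) :
    GradedCoords w coord13 (extendWeight w) := by
  refine gradedCoords_of_scaling (fun v => ?_) fun i => ?_
  · by_cases h : v = .s33
    · subst h
      rw [coord13_s33]
      simpa [extendWeight] using isWeightedHomogeneous_one ℂ w
    · rw [coord13_of_ne h]
      simpa [extendWeight, h] using isWeightedHomogeneous_X ℂ w ⟨v, h⟩
  · obtain ⟨n, hn⟩ := hw i
    refine ⟨n, fun c hc => ?_⟩
    have h1 := eval_weightedHomogeneous hn two_ne_zero (fun v => c v.1)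
    change eval _ (equations coord13 i) = _ * eval _ (equations coord13 i) at h1
    rw [map_equations, map_equations] at h1
    convert h1 using 3
    · rename_i v
      by_cases h : v = .s33
      · subst h; simp [coord13_s33, extendWeight, hc]
      · simp [coord13_of_ne h, extendWeight, h]
    · funext v
      by_cases h : v = .s33
      · subst h; simp [coord13_s33, hc]
      · simp [coord13_of_ne h]

end WeightRelations

/-! ### The resolutions -/

section Resolutions

local notation "𝕏" => (X : Var → MvPolynomial Var ℂ)

/-- Regularity of the image of a sequence under a surjection. -/
lemma RegSeq.map {A B : Type} [CommRing A] [CommRing B] {φ : A →+* B}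
    (hφ : Function.Surjective φ) : ∀ {l : List A} {J : Ideal B}, RegSeq (J.comap φ) l →
    RegSeq J (l.map φ)
  | [], _, _ => trivial
  | f :: l, J, h => by
    refine ⟨fun v hv => ?_, RegSeq.map hφ ?_⟩
    · obtain ⟨v, rfl⟩ := hφ v
      rw [← map_mul] at hv
      exact h.1 v hv
    · have : (J ⊔ Ideal.span {φ f}).comap φ = J.comap φ ⊔ Ideal.span {f} := by
        ext a
        rw [Ideal.mem_comap, mem_sup_span, mem_sup_span, hφ.exists]
        simp only [Ideal.mem_comap, map_sub, map_mul]
      rw [this]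
      exact h.2

/-- The substitution `s₃₃ = 1`. -/
def setS33 : MvPolynomial Var ℂ →ₐ[ℂ] MvPolynomial Var13 ℂ := aeval coord13

lemma setS33_X (v : Var) : setS33 (X v) = coord13 v := by simp [setS33]

lemma setS33_rename (f : MvPolynomial Var13 ℂ) : setS33 (rename Subtype.val f) = f := by
  have : setS33.comp (rename Subtype.val) = AlgHom.id ℂ _ := by
    apply MvPolynomial.algHom_ext
    intro v
    simp [setS33_X, coord13_of_ne v.2]
  exact DFunLike.congr_fun this f

lemma setS33_surjective : Function.Surjective setS33 := fun f => ⟨_, setS33_rename f⟩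

lemma ker_setS33 : (⊥ : Ideal (MvPolynomial Var13 ℂ)).comap setS33.toRingHom =
    Ideal.span {𝕏 .s33 - 1} := by
  apply le_antisymm
  · intro f hf
    have hf' : setS33 f = 0 := hf
    have : (Ideal.Quotient.mkₐ ℂ (Ideal.span {𝕏 .s33 - 1})) =
        (Ideal.Quotient.mkₐ ℂ _).comp ((rename Subtype.val).comp setS33) := by
      apply MvPolynomial.algHom_ext
      intro v
      by_cases h : v = .s33
      · subst h
        rw [AlgHom.comp_apply, AlgHom.comp_apply, setS33_X, coord13_s33, map_one]
        exact Ideal.Quotient.eq.2 (Ideal.mem_span_singleton_self _)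
      · rw [AlgHom.comp_apply, AlgHom.comp_apply, setS33_X, coord13_of_ne h, rename_X]
    have h2 := DFunLike.congr_fun this f
    rw [AlgHom.comp_apply, AlgHom.comp_apply, hf', map_zero, map_zero] at h2
    exact Ideal.Quotient.eq_zero_iff_mem.1 h2
  · rw [Ideal.span_singleton_le_iff_mem]
    show setS33 _ = 0
    simp [setS33_X, coord13_s33]

lemma map_regList {A B : Type} [CommRing A] [CommRing B] (φ : A →+* B) (x : Var → A) :
    (regList x).map φ = regList (fun v => φ (x v)) := by
  simp [regList, dot, lastEq, normEq, adjVec, xVec, sxVec, spVec, vVec, sAct, crs, vec3, pVec,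
    qVec, tVec]

lemma regSeq13 : RegSeq ⊥ (regList coord13) := by
  have h := goodBase_s33.reg
  rw [← ker_setS33] at h
  have := h.map (φ := setS33.toRingHom) setS33_surjective
  rw [map_regList] at this
  convert this using 2
  funext v
  exact (setS33_X v).symm

variable {σ : Type} {x : Var → MvPolynomial σ ℂ}

/-- The resolution of the quotient by the nine equations, evaluated at coordinates for which the
four elements form a regular sequence. -/
def resolution (h : RegSeq ⊥ (regList x)) :
    Resolution916 (Ideal.span (Set.range (equations x))) where
  f₁ := diff1 x
  f₂ := diff2 x
  f₃ := diff3 x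
  f₄ := diff4 x
  exact₀ := by
    intro y
    rw [Ideal.Quotient.eq_zero_iff_mem, mem_span_equations]
    constructor
    · rintro ⟨z, hz⟩
      refine ⟨z, funext fun i => ?_⟩
      obtain rfl : i = 0 := Subsingleton.elim _ _
      exact hz.symm
    · rintro ⟨z, rfl⟩
      exact ⟨z, rfl⟩
  exact₁ := by
    intro y
    constructor
    · intro hy
      obtain ⟨z, hz⟩ := (exactMod_of_regSeq x h).1 y fun i => by rw [hy]; exact zero_mem _
      exact ⟨z, funext fun i => (sub_eq_zero.1 (Ideal.mem_bot.1 (hz i))).symm⟩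
    · rintro ⟨z, rfl⟩
      rw [diff1_apply, diff2_apply, diff1_diff2]
  exact₂ := by
    intro y
    constructor
    · intro hy
      obtain ⟨z, hz⟩ := (exactMod_of_regSeq x h).2.1 y fun i => by rw [hy]; exact zero_mem _
      exact ⟨z, funext fun i => (sub_eq_zero.1 (Ideal.mem_bot.1 (hz i))).symm⟩
    · rintro ⟨z, rfl⟩
      rw [diff2_apply, diff3_apply, diff2_diff3]
  exact₃ := by
    intro y
    constructor
    · intro hy
      obtain ⟨z, hz⟩ := (exactMod_of_regSeq x h).2.2.1 y fun i => by rw [hy]; exact zero_mem _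
      exact ⟨z, funext fun i => (sub_eq_zero.1 (Ideal.mem_bot.1 (hz i))).symm⟩
    · rintro ⟨z, rfl⟩
      rw [diff3_apply, diff4_apply, diff3_diff4]
  injective₄ := by
    rw [injective_iff_map_eq_zero]
    intro y hy
    obtain ⟨z, hz⟩ := (exactMod_of_regSeq x h).2.2.2 y fun i => by rw [hy]; exact zero_mem _
    funext i
    simpa using hz i

lemma resolution_isGraded (h : RegSeq ⊥ (regList x)) {w : σ → ℤ} {W : Var → ℤ}
    (H : GradedCoords w x W) : (resolution h).IsGraded w W :=
  ⟨H.diff1, H.diff2, H.diff3, H.diff4⟩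

theorem exists_resolution14 : ∃ F : Resolution916 ideal14,
    ∀ w : Var → ℤ, IsWeightSystem equations14 w → F.IsGraded w w :=
  ⟨resolution goodBase_bot.reg, fun _ hw => resolution_isGraded _ (gradedCoords14 hw)⟩

theorem exists_resolution13 : ∃ F : Resolution916 ideal13,
    ∀ w : Var13 → ℤ, IsWeightSystem equations13 w → F.IsGraded w (extendWeight w) :=
  ⟨resolution regSeq13, fun _ hw => resolution_isGraded _ (gradedCoords13 hw)⟩

end Resolutions

/-! ### The nonzerodivisors `u` and `p₁` -/

section NonZeroDivisors

local notation "𝕏" => (X : Var → MvPolynomial Var ℂ)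

lemma NZ.map {A B : Type} [CommRing A] [CommRing B] {φ : A →+* B}
    (hφ : Function.Surjective φ) {f : A} {J : Ideal B} (h : NZ (J.comap φ) f) : NZ J (φ f) := by
  intro v hv
  obtain ⟨v, rfl⟩ := hφ v
  rw [← map_mul] at hv
  exact h v hv

lemma comap_ideal13 : ideal13.comap setS33.toRingHom = Ideal.span {𝕏 .s33 - 1} ⊔ ideal14 := by
  have : ideal13 = ideal14.map setS33.toRingHom := by
    rw [ideal13, ideal14, Ideal.map_span, ← Set.range_comp]
    congr 2
    funext i
    show equations coord13 i = setS33.toRingHom (equations X i)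
    rw [map_equations]
    congr 1
    funext v
    exact (setS33_X v).symm
  rw [this, Ideal.comap_map_of_surjective setS33.toRingHom setS33_surjective, ker_setS33, sup_comm]

lemma nz14_u : NZ ideal14 (X .u) := by
  have h := goodBase_bot.nz_sup_ideal14_u
  rwa [bot_sup_eq] at h

lemma nz14_p1 : NZ (ideal14 ⊔ Ideal.span {X .u}) (X .p1) := by
  have h := goodBase_bot.nz_sup_ideal14_p1
  rwa [bot_sup_eq, sup_comm] at h

lemma nz13_u : NZ ideal13 (coord13 .u) := by
  have h := goodBase_s33.nz_sup_ideal14_u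
  rw [← comap_ideal13] at h
  have := h.map (φ := setS33.toRingHom) setS33_surjective
  rwa [show setS33.toRingHom (X .u) = _ from setS33_X _] at this

lemma nz13_p1 : NZ (ideal13 ⊔ Ideal.span {coord13 .u}) (coord13 .p1) := by
  have h := goodBase_s33.nz_sup_ideal14_p1
  rw [sup_right_comm, ← comap_ideal13] at h
  have e : (ideal13 ⊔ Ideal.span {setS33.toRingHom (X .u)}).comap setS33.toRingHom =
      ideal13.comap setS33.toRingHom ⊔ Ideal.span {X .u} := by
    ext a
    rw [Ideal.mem_comap, mem_sup_span, mem_sup_span,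
      (show Function.Surjective setS33.toRingHom from setS33_surjective).exists]
    simp only [Ideal.mem_comap, map_sub, map_mul]
  rw [← e] at h
  have := h.map (φ := setS33.toRingHom) setS33_surjective
  rwa [show setS33.toRingHom (X .u) = _ from setS33_X _,
    show setS33.toRingHom (X .p1) = _ from setS33_X _] at this

end NonZeroDivisors

/-! ### Derivations of fraction fields -/

section Derivations

/-- A derivation extends to the fraction field: it is the second component of a ring homomorphism
into the dual numbers, and nonzero elements of `A` become invertible there. -/
lemma exists_derivation_fractionField {A K : Type} [CommRing A] [IsDomain A] [Algebra ℂ A] [Field K]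
    [Algebra ℂ K] [Algebra A K] [IsScalarTower ℂ A K] [IsFractionRing A K]
    (d : Derivation ℂ A A) :
    ∃ D : Derivation ℂ K K, ∀ a, D (algebraMap A K a) = algebraMap A K (d a) := by
  let φ : A →ₐ[ℂ] TrivSqZeroExt K K :=
    { toFun := fun a => TrivSqZeroExt.inl (algebraMap A K a) +
        TrivSqZeroExt.inr (algebraMap A K (d a))
      map_one' := by ext <;> simp
      map_mul' := fun a b => by ext <;> simp [Algebra.smul_def, TrivSqZeroExt.algebraMap_eq_inl, mul_comm]
      map_zero' := by ext <;> simp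
      map_add' := fun a b => by ext <;> simp [Algebra.smul_def]
      commutes' := fun c => by
        ext
        · simp [TrivSqZeroExt.algebraMap_eq_inl', ← IsScalarTower.algebraMap_apply]
        · simp [TrivSqZeroExt.algebraMap_eq_inl'] }
  have hφ : ∀ a : A⁰, IsUnit (φ a) := by
    intro a
    rw [TrivSqZeroExt.isUnit_iff_isUnit_fst]
    simp [φ]
  let ψ : K →ₐ[ℂ] TrivSqZeroExt K K := IsLocalization.liftAlgHom (M := A⁰) (f := φ) hφ
  have hψ : ∀ a, ψ (algebraMap A K a) = φ a := fun a => IsLocalization.lift_eq hφ a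
  have hfst : ∀ z, (ψ z).fst = z := by
    have : (TrivSqZeroExt.fstHom K K K).toRingHom.comp ψ.toRingHom = RingHom.id K := by
      apply IsLocalization.ringHom_ext A⁰
      ext a
      have := hψ a
      simp only [RingHom.comp_apply]
      show (ψ (algebraMap A K a)).fst = algebraMap A K a
      rw [this]
      simp [φ]
    exact fun z => DFunLike.congr_fun this z
  refine ⟨Derivation.mk' ((TrivSqZeroExt.sndHom K K).restrictScalars ℂ ∘ₗ ψ.toLinearMap) ?_, ?_⟩
  · intro a b
    simp [TrivSqZeroExt.snd_mul, hfst, mul_comm]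
  · intro a
    show (ψ (algebraMap A K a)).snd = _
    rw [hψ]
    simp [φ, Algebra.smul_def, TrivSqZeroExt.algebraMap_eq_inl]

/-- A derivation of a polynomial ring extends to every field that is generated as a field of
fractions by algebraically independent elements. -/
lemma exists_derivation_of_rational {ι K : Type} [Field K] [Algebra ℂ K] {x : ι → K}
    (hinj : Function.Injective (aeval x : MvPolynomial ι ℂ →ₐ[ℂ] K))
    (hsurj : ∀ z : K, ∃ F G : MvPolynomial ι ℂ, G ≠ 0 ∧ z * aeval x G = aeval x F)
    (d : Derivation ℂ (MvPolynomial ι ℂ) (MvPolynomial ι ℂ)) :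
    ∃ D : Derivation ℂ K K, ∀ F, D (aeval x F) = aeval x (d F) := by
  let _ : Algebra (MvPolynomial ι ℂ) K := (aeval x : MvPolynomial ι ℂ →ₐ[ℂ] K).toRingHom.toAlgebra
  have : IsScalarTower ℂ (MvPolynomial ι ℂ) K := by
    refine IsScalarTower.of_algebraMap_eq fun c => ?_
    show _ = aeval x (algebraMap ℂ (MvPolynomial ι ℂ) c)
    rw [AlgHom.commutes]
  have : IsFractionRing (MvPolynomial ι ℂ) K := by
    have : FaithfulSMul (MvPolynomial ι ℂ) K := (faithfulSMul_iff_algebraMap_injective _ _).2 hinj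
    refine IsFractionRing.of_field _ _ fun z => ?_
    obtain ⟨F, G, hG, h⟩ := hsurj z
    refine ⟨F, G, ?_⟩
    have hG' : aeval x G ≠ 0 := fun h0 => hG (hinj (by rw [h0, map_zero]))
    exact (div_eq_iff hG').2 h.symm |>.symm
  exact exists_derivation_fractionField d

end Derivations

/-! ### Top forms in terms of dual derivations -/

section TopForms

variable {K : Type} [CommRing K] [Algebra ℂ K] {n : ℕ}

/-- The additive group generated by the determinants `a₀ det (Dᵢ aⱼ)` with all `aⱼ ∈ O`. -/
def detSpan {τ : Type} [Fintype τ] [DecidableEq τ] (D : τ → Derivation ℂ K K) (O : Set K) :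
    AddSubgroup K :=
  AddSubgroup.closure {h | ∃ (a₀ : K) (a : τ → K), a₀ ∈ O ∧ (∀ i, a i ∈ O) ∧
    h = a₀ * (Matrix.of fun i j => D i (a j)).det}

/-- If the `Dᵢ` are dual to a basis of the differentials, there is a top form `η` for which
regularity of `h η` can be read off from determinants of the `Dᵢ`. -/
lemma exists_form [Nontrivial K] (D : Fin n → Derivation ℂ K K) (β : Fin n → Ω[K⁄ℂ])
    (hdual : ∀ i j, (D i).liftKaehlerDifferential (β j) = if i = j then 1 else 0)
    (hspan : ∀ a, KaehlerDifferential.D ℂ K a = ∑ i, D i a • β i) :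
    ∃ η : DiffForms K n, η ≠ 0 ∧ ∀ O : Set K, formMultipliers η O = detSpan D O := by
  -- The derivations are the coordinates with respect to the basis `β` of the differentials.
  let e : Ω[K⁄ℂ] ≃ₗ[K] (Fin n → K) :=
    { LinearMap.pi fun i => (D i).liftKaehlerDifferential with
      invFun := fun c => ∑ i, c i • β i
      left_inv := by
        intro ω
        have : (∑ i, ((D i).liftKaehlerDifferential).smulRight (β i)) =
            (LinearMap.id : Ω[K⁄ℂ] →ₗ[K] Ω[K⁄ℂ]) := by
          apply Derivation.liftKaehlerDifferential_unique
          ext a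
          simp [hspan a, hdual]
        have h := DFunLike.congr_fun this ω
        simpa [LinearMap.sum_apply] using h
      right_inv := by
        intro c
        funext i
        simp [hdual] }
  let B : Module.Basis (Fin n) K (Ω[K⁄ℂ]) := Module.Basis.ofEquivFun e
  have hB : ∀ i, B i = β i := by
    intro i
    simp only [B, Module.Basis.coe_ofEquivFun]
    show ∑ j, (Pi.single i (1 : K) : Fin n → K) j • β j = β i
    simp [Pi.single_apply]
  let Δ : DiffForms K n →ₗ[K] K := exteriorPower.alternatingMapLinearEquiv B.det
  set η : DiffForms K n := exteriorPower.ιMulti K n B with hη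
  have hΔη : Δ η = 1 := by
    simp only [Δ, hη, exteriorPower.alternatingMapLinearEquiv_apply_ιMulti]
    exact B.det_self
  have hΔ : ∀ ω, Δ ω • η = ω := by
    have : Δ.smulRight η = LinearMap.id := by
      apply exteriorPower.linearMap_ext
      apply Module.Basis.ext_alternating B
      intro v hv
      obtain ⟨σ, hσ⟩ : ∃ σ : Equiv.Perm (Fin n), ∀ i, σ i = v i :=
        ⟨Equiv.ofBijective v (Finite.injective_iff_bijective.1 hv), fun i => rfl⟩
      have hv' : (fun i => B (v i)) = (fun i => B i) ∘ σ := by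
        funext i; simp [hσ]
      rw [hv', AlternatingMap.map_perm, AlternatingMap.map_perm]
      congr 1
      show Δ η • η = η
      rw [hΔη, one_smul]
    exact fun ω => DFunLike.congr_fun this ω
  refine ⟨η, fun h0 => one_ne_zero (by rw [← hΔη, h0, map_zero]), fun O => ?_⟩
  have hdet : ∀ a : Fin n → K, Δ (exteriorPower.ιMulti K n fun i => KaehlerDifferential.D ℂ K (a i))
      = (Matrix.of fun i j => D i (a j)).det := by
    intro a
    simp only [Δ, exteriorPower.alternatingMapLinearEquiv_apply_ιMulti]
    rw [Module.Basis.det_apply]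
    congr 1
    ext i j
    simp only [Module.Basis.toMatrix_apply, Matrix.of_apply]
    show e (KaehlerDifferential.D ℂ K (a j)) i = _
    simp [e]
  have himage : (regularForms n O).map Δ.toAddMonoidHom = detSpan D O := by
    rw [regularForms, AddMonoidHom.map_closure, detSpan]
    congr 1
    ext h
    constructor
    · rintro ⟨_, ⟨a₀, a, h0, h1, rfl⟩, rfl⟩
      refine ⟨a₀, a, h0, h1, ?_⟩
      show Δ _ = _
      rw [map_smul, hdet, smul_eq_mul]
    · rintro ⟨a₀, a, h0, h1, rfl⟩
      refine ⟨_, ⟨a₀, a, h0, h1, rfl⟩, ?_⟩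
      show Δ _ = _
      rw [map_smul, hdet, smul_eq_mul]
  ext h
  show h • η ∈ regularForms n O ↔ h ∈ detSpan D O
  rw [← himage]
  constructor
  · intro hh
    refine ⟨_, hh, ?_⟩
    show Δ _ = _
    rw [map_smul, hΔη, smul_eq_mul, mul_one]
  · rintro ⟨ω, hω, rfl⟩
    show Δ ω • η ∈ _
    rwa [hΔ]

end TopForms

/-! ### Stalks of the sheaves `O(m)` -/

/-- The quotient ring `R = S/I`. -/
abbrev CoordRing {σ : Type} (I : Ideal (MvPolynomial σ ℂ)) : Type := MvPolynomial σ ℂ ⧸ I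

/-- The fraction field of `R = S/I`. -/
abbrev FracField {σ : Type} (I : Ideal (MvPolynomial σ ℂ)) : Type := FractionRing (CoordRing I)

/- The instances below shorten the search for the algebraic structures on the fraction field. -/
section Instances

variable {σ : Type} (I : Ideal (MvPolynomial σ ℂ))

instance : DistribMulAction (CoordRing I) (CoordRing I) := inferInstance
instance : CommRing (FracField I) := inferInstance
instance : AddCommGroup (FracField I) := inferInstance
instance : AddCommMonoid (FracField I) := inferInstance
instance : AddGroup (FracField I) := inferInstance
instance : Algebra ℂ (FracField I) := inferInstance
instance : Module ℂ (FracField I) := inferInstance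
instance : Module (FracField I) (FracField I) := inferInstance
instance : Sub (FracField I) := inferInstance
instance : Neg (FracField I) := inferInstance
instance : Mul (FracField I) := inferInstance
instance : Add (FracField I) := inferInstance
instance [IsDomain (CoordRing I)] : Field (FracField I) := inferInstance
instance [IsDomain (CoordRing I)] : Div (FracField I) := inferInstance
instance [IsDomain (CoordRing I)] : CommGroupWithZero (FracField I) := inferInstance
instance [IsDomain (CoordRing I)] : CharZero (FracField I) :=
  charZero_of_injective_algebraMap (algebraMap ℂ (FracField I)).injective

end Instances

section Stalks

variable {σ : Type} {w : σ → ℤ} {I : Ideal (MvPolynomial σ ℂ)} [IsDomain (CoordRing I)]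
  {𝔭 : Ideal (CoordRing I)}

lemma one_mem_piece : (1 : CoordRing I) ∈ piece w I 0 := by
  simpa using algebraMap_mem_piece w I 1

lemma toK_ne_zero {a : CoordRing I} (ha : a ≠ 0) : algebraMap (CoordRing I) (FracField I) a ≠ 0 :=
  (map_ne_zero_iff _ (IsFractionRing.injective _ _)).2 ha

lemma ne_zero_of_notMem {a : CoordRing I} (ha : a ∉ 𝔭) : a ≠ 0 := fun h => ha (h ▸ 𝔭.zero_mem)

lemma mem_twistStalk {m : ℤ} {f : FracField I} : f ∈ twistStalk w I 𝔭 m ↔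
    ∃ n : ℤ, ∃ a ∈ piece w I (n + m), ∃ b ∈ piece w I n, b ∉ 𝔭 ∧
      f * algebraMap _ _ b = algebraMap _ _ a := by
  constructor
  · rintro ⟨n, a, ha, b, hb, -, hb', h⟩
    exact ⟨n, a, ha, b, hb, hb', h⟩
  · rintro ⟨n, a, ha, b, hb, hb', h⟩
    exact ⟨n, a, ha, b, hb, mem_nonZeroDivisors_of_ne_zero (ne_zero_of_notMem hb'), hb', h⟩

/-- Rational sections are the sections at the generic point. -/
lemma rationalSections_eq (m : ℤ) : rationalSections w I m = twistStalk w I ⊥ m := by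
  ext f
  rw [mem_twistStalk]
  constructor
  · rintro ⟨n, a, ha, b, hb, hb', h⟩
    exact ⟨n, a, ha, b, hb, nonZeroDivisors.ne_zero hb', h⟩
  · rintro ⟨n, a, ha, b, hb, hb', h⟩
    exact ⟨n, a, ha, b, hb, mem_nonZeroDivisors_of_ne_zero hb', h⟩

lemma twistStalk_subset {m : ℤ} : twistStalk w I 𝔭 m ⊆ twistStalk w I ⊥ m := by
  intro f hf
  rw [mem_twistStalk] at hf ⊢
  obtain ⟨n, a, ha, b, hb, hb', h⟩ := hf
  exact ⟨n, a, ha, b, hb, ne_zero_of_notMem hb', h⟩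

lemma twistStalk_of_piece [𝔭.IsPrime] {m : ℤ} {a : CoordRing I} (ha : a ∈ piece w I m) :
    algebraMap _ _ a ∈ twistStalk w I 𝔭 m :=
  mem_twistStalk.2 ⟨0, a, by rwa [zero_add], 1, one_mem_piece,
    (Ideal.ne_top_iff_one 𝔭).1 (Ideal.IsPrime.ne_top inferInstance), by rw [map_one, mul_one]⟩

lemma twistStalk_inv [𝔭.IsPrime] {m : ℤ} {a : CoordRing I} (ha : a ∈ piece w I m) (ha' : a ∉ 𝔭) :
    (algebraMap _ (FracField I) a)⁻¹ ∈ twistStalk w I 𝔭 (-m) :=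
  mem_twistStalk.2 ⟨m, 1, by rw [add_neg_cancel]; exact one_mem_piece, a, ha, ha', by
    rw [map_one, inv_mul_cancel₀ (toK_ne_zero (ne_zero_of_notMem ha'))]⟩

lemma twistStalk_mul [h𝔭 : 𝔭.IsPrime] {m n : ℤ} {f g : FracField I} (hf : f ∈ twistStalk w I 𝔭 m)
    (hg : g ∈ twistStalk w I 𝔭 n) : f * g ∈ twistStalk w I 𝔭 (m + n) := by
  rw [mem_twistStalk] at hf hg ⊢
  obtain ⟨k, a, ha, b, hb, hb', h⟩ := hf
  obtain ⟨l, c, hc, d, hd, hd', h'⟩ := hg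
  refine ⟨k + l, a * c, ?_, b * d, mul_mem_piece w I hb hd,
    fun hm => (h𝔭.mem_or_mem hm).elim hb' hd', ?_⟩
  · rw [add_add_add_comm]; exact mul_mem_piece w I ha hc
  · rw [map_mul, map_mul, ← h, ← h']; ring

lemma twistStalk_add [h𝔭 : 𝔭.IsPrime] {m : ℤ} {f g : FracField I} (hf : f ∈ twistStalk w I 𝔭 m)
    (hg : g ∈ twistStalk w I 𝔭 m) : f + g ∈ twistStalk w I 𝔭 m := by
  rw [mem_twistStalk] at hf hg ⊢
  obtain ⟨k, a, ha, b, hb, hb', h⟩ := hf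
  obtain ⟨l, c, hc, d, hd, hd', h'⟩ := hg
  refine ⟨k + l, a * d + b * c, add_mem ?_ ?_, b * d, mul_mem_piece w I hb hd,
    fun hm => (h𝔭.mem_or_mem hm).elim hb' hd', ?_⟩
  · rw [add_right_comm]; exact mul_mem_piece w I ha hd
  · rw [add_assoc]; exact mul_mem_piece w I hb hc
  · rw [map_add, map_mul, map_mul, map_mul, ← h, ← h']; ring

lemma twistStalk_algebraMap [𝔭.IsPrime] (c : ℂ) :
    algebraMap ℂ (FracField I) c ∈ twistStalk w I 𝔭 0 := by
  rw [IsScalarTower.algebraMap_apply ℂ (CoordRing I) (FracField I)]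
  exact twistStalk_of_piece (algebraMap_mem_piece w I c)

lemma twistStalk_one [𝔭.IsPrime] : (1 : FracField I) ∈ twistStalk w I 𝔭 0 := by
  simpa using twistStalk_algebraMap (w := w) (𝔭 := 𝔭) 1

lemma twistStalk_zero [𝔭.IsPrime] (m : ℤ) : (0 : FracField I) ∈ twistStalk w I 𝔭 m := by
  rw [← map_zero (algebraMap (CoordRing I) (FracField I))]
  exact twistStalk_of_piece (zero_mem _)

lemma twistStalk_smul [𝔭.IsPrime] {m : ℤ} (c : ℂ) {f : FracField I}
    (hf : f ∈ twistStalk w I 𝔭 m) : c • f ∈ twistStalk w I 𝔭 m := by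
  rw [Algebra.smul_def, ← zero_add m]
  exact twistStalk_mul (twistStalk_algebraMap c) hf

lemma twistStalk_neg [𝔭.IsPrime] {m : ℤ} {f : FracField I}
    (hf : f ∈ twistStalk w I 𝔭 m) : -f ∈ twistStalk w I 𝔭 m := by
  simpa using twistStalk_smul (-1) hf

lemma twistStalk_sum [𝔭.IsPrime] {m : ℤ} {ι : Type} (s : Finset ι) {f : ι → FracField I}
    (hf : ∀ i ∈ s, f i ∈ twistStalk w I 𝔭 m) : ∑ i ∈ s, f i ∈ twistStalk w I 𝔭 m := by
  classical
  induction s using Finset.induction_on with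
  | empty => simpa using twistStalk_zero m
  | insert a s ha ih =>
    rw [Finset.sum_insert ha]
    exact twistStalk_add (hf a (Finset.mem_insert_self _ _))
      (ih fun i hi => hf i (Finset.mem_insert_of_mem hi))

lemma twistStalk_prod [𝔭.IsPrime] {ι : Type} (s : Finset ι) {m : ι → ℤ} {f : ι → FracField I}
    (hf : ∀ i ∈ s, f i ∈ twistStalk w I 𝔭 (m i)) :
    ∏ i ∈ s, f i ∈ twistStalk w I 𝔭 (∑ i ∈ s, m i) := by
  classical
  induction s using Finset.induction_on with
  | empty => simpa using twistStalk_one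
  | insert a s ha ih =>
    rw [Finset.prod_insert ha, Finset.sum_insert ha]
    exact twistStalk_mul (hf a (Finset.mem_insert_self _ _))
      (ih fun i hi => hf i (Finset.mem_insert_of_mem hi))

lemma twistStalk_pow [𝔭.IsPrime] {m : ℤ} {f : FracField I} (hf : f ∈ twistStalk w I 𝔭 m) (n : ℕ) :
    f ^ n ∈ twistStalk w I 𝔭 (n * m) := by
  have := twistStalk_prod (w := w) (𝔭 := 𝔭) (Finset.range n) (m := fun _ => m) (f := fun _ => f)
    fun _ _ => hf
  simpa using this

lemma functionField_mem (h : functionField w I) :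
    (h : FracField I) ∈ twistStalk w I ⊥ 0 := by
  rw [← rationalSections_eq]; exact h.2

lemma mem_functionField {f : FracField I} (hf : f ∈ twistStalk w I ⊥ 0) :
    f ∈ functionField w I := by
  rw [← rationalSections_eq] at hf; exact hf

lemma exists_inverse_functionField (h : functionField w I) (h0 : h ≠ 0) :
    ∃ h' : functionField w I, h * h' = 1 := by
  have h0' : (h : FracField I) ≠ 0 := fun h1 => h0 (Subtype.ext h1)
  obtain ⟨n, a, ha, b, hb, hb', e⟩ := mem_twistStalk.1 (functionField_mem h)
  have ha0 : a ≠ 0 := by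
    rintro rfl
    rw [map_zero] at e
    exact (mul_ne_zero h0' (toK_ne_zero hb')) e
  refine ⟨⟨(h : FracField I)⁻¹, mem_functionField (mem_twistStalk.2 ⟨n, b, by rwa [add_zero], a,
    by rwa [add_zero] at ha, ha0, ?_⟩)⟩, Subtype.ext (mul_inv_cancel₀ h0')⟩
  rw [← e, inv_mul_cancel_left₀ h0']

end Stalks

/-! ### Charts -/

/-- A system of homogeneous elements of positive degree that are algebraically independent and
generate the graded ring `R = S/I` after inverting the first of them. The degrees are natural
numbers, and the remaining elements are indexed by `τ`. -/
structure Chart {σ : Type} (w : σ → ℤ) (I : Ideal (MvPolynomial σ ℂ)) (τ : Type) where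
  x : Option τ → CoordRing I
  wt : Option τ → ℕ
  wt_pos : ∀ i, 0 < wt i
  mem : ∀ i, x i ∈ piece w I (wt i)
  inj : Function.Injective (aeval x : MvPolynomial (Option τ) ℂ →ₐ[ℂ] CoordRing I)
  surj : ∀ a, ∃ (N : ℕ) (F : MvPolynomial (Option τ) ℂ), x none ^ N * a = aeval x F
  surj_hom : ∀ (d : ℤ), ∀ a ∈ piece w I d, ∃ (N : ℕ) (F : MvPolynomial (Option τ) ℂ),
    IsWeightedHomogeneous (fun i => (wt i : ℤ)) F (N * wt none + d) ∧ x none ^ N * a = aeval x F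

lemma aeval_mem_piece {σ : Type} {w : σ → ℤ} {I : Ideal (MvPolynomial σ ℂ)} {ι : Type}
    {x : ι → CoordRing I} {wt : ι → ℤ} (hx : ∀ i, x i ∈ piece w I (wt i))
    {F : MvPolynomial ι ℂ} {d : ℤ} (hF : IsWeightedHomogeneous wt F d) :
    aeval x F ∈ piece w I d := by
  rw [F.as_sum, map_sum]
  refine sum_mem fun e he => ?_
  have hd : Finsupp.weight wt e = d := hF (mem_support_iff.1 he)
  rw [aeval_monomial, ← Algebra.smul_def, ← hd]
  refine Submodule.smul_mem _ _ ?_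
  rw [Finsupp.weight_apply, Finsupp.prod, Finsupp.sum]
  have hpow : ∀ i (k : ℕ), x i ^ k ∈ piece w I (k • wt i) := by
    intro i k
    induction k with
    | zero => simpa using algebraMap_mem_piece w I 1
    | succ k ih => rw [pow_succ, succ_nsmul]; exact mul_mem_piece w I ih (hx i)
  classical
  induction e.support using Finset.induction_on with
  | empty => simpa using algebraMap_mem_piece w I 1
  | insert a s ha ih =>
    rw [Finset.prod_insert ha, Finset.sum_insert ha]
    exact mul_mem_piece w I (hpow _ _) ih

namespace Chart

variable {σ : Type} {w : σ → ℤ} {I : Ideal (MvPolynomial σ ℂ)} [IsDomain (CoordRing I)]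
  {τ : Type} (Φ : Chart w I τ) {𝔭 : Ideal (CoordRing I)}

/-- The degrees of the chart as integers. -/
def deg (i : Option τ) : ℤ := Φ.wt i

/-- The chart coordinates in the fraction field. -/
def xK (i : Option τ) : FracField I := algebraMap _ _ (Φ.x i)

lemma x_ne_zero (i : Option τ) : Φ.x i ≠ 0 := by
  intro h
  have : (X i : MvPolynomial (Option τ) ℂ) = 0 := Φ.inj (by rw [aeval_X, h, map_zero])
  exact X_ne_zero i this

lemma xK_ne_zero (i : Option τ) : Φ.xK i ≠ 0 := toK_ne_zero (Φ.x_ne_zero i)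

lemma aeval_xK (F : MvPolynomial (Option τ) ℂ) :
    aeval Φ.xK F = algebraMap _ (FracField I) (aeval Φ.x F) :=
  (aeval_algebraMap_apply (FracField I) Φ.x F)

lemma inj_xK : Function.Injective (aeval Φ.xK : MvPolynomial (Option τ) ℂ →ₐ[ℂ] FracField I) := by
  intro F G h
  rw [aeval_xK, aeval_xK] at h
  exact Φ.inj (IsFractionRing.injective _ _ h)

lemma surj_xK (z : FracField I) : ∃ F G : MvPolynomial (Option τ) ℂ, G ≠ 0 ∧
    z * aeval Φ.xK G = aeval Φ.xK F := by
  obtain ⟨a, b, hb, rfl⟩ := IsFractionRing.div_surjective (A := CoordRing I) z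
  obtain ⟨N, F, hF⟩ := Φ.surj a
  obtain ⟨M, G, hG⟩ := Φ.surj b
  have hb0 : b ≠ 0 := nonZeroDivisors.ne_zero hb
  refine ⟨X none ^ M * F, X none ^ N * G, ?_, ?_⟩
  · refine mul_ne_zero (pow_ne_zero _ (X_ne_zero _)) ?_
    rintro rfl
    rw [map_zero] at hG
    exact mul_ne_zero (pow_ne_zero _ (Φ.x_ne_zero none)) hb0 hG
  · rw [aeval_xK, aeval_xK]
    simp only [map_mul, ← hF, ← hG, map_pow, aeval_X]
    have := toK_ne_zero hb0
    field_simp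

/-- The derivation `xᵢ ∂/∂xᵢ` of the fraction field. -/
def theta (i : Option τ) : Derivation ℂ (FracField I) (FracField I) :=
  (exists_derivation_of_rational Φ.inj_xK Φ.surj_xK
    ((X i : MvPolynomial (Option τ) ℂ) • pderiv i)).choose

lemma theta_aeval (i : Option τ) (F : MvPolynomial (Option τ) ℂ) :
    Φ.theta i (aeval Φ.xK F) = Φ.xK i * aeval Φ.xK (pderiv i F) := by
  rw [theta, (exists_derivation_of_rational Φ.inj_xK Φ.surj_xK
    ((X i : MvPolynomial (Option τ) ℂ) • pderiv i)).choose_spec]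
  simp

lemma theta_xK [DecidableEq τ] (i j : Option τ) :
    Φ.theta i (Φ.xK j) = if i = j then Φ.xK j else 0 := by
  have := Φ.theta_aeval i (X j)
  rw [aeval_X] at this
  rw [this, pderiv_X]
  by_cases h : i = j
  · subst h; simp
  · simp [h]

/-- Fractions of degree `m` in terms of the chart. -/
lemma mem_twistStalk_iff [h𝔭 : 𝔭.IsPrime] (h0 : Φ.x none ∉ 𝔭) {m : ℤ} {f : FracField I} :
    f ∈ twistStalk w I 𝔭 m ↔ ∃ (n : ℤ) (F G : MvPolynomial (Option τ) ℂ),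
      IsWeightedHomogeneous Φ.deg F (n + m) ∧ IsWeightedHomogeneous Φ.deg G n ∧
      aeval Φ.x G ∉ 𝔭 ∧ f * aeval Φ.xK G = aeval Φ.xK F := by
  rw [mem_twistStalk]
  constructor
  · rintro ⟨n, a, ha, b, hb, hb', h⟩
    obtain ⟨N, F, hF, eF⟩ := Φ.surj_hom _ a ha
    obtain ⟨M, G, hG, eG⟩ := Φ.surj_hom _ b hb
    have hX : ∀ k : ℕ, IsWeightedHomogeneous Φ.deg ((X none : MvPolynomial (Option τ) ℂ) ^ k)
        (k * Φ.wt none) := by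
      intro k
      have := (isWeightedHomogeneous_X ℂ Φ.deg none).pow k
      rwa [nsmul_eq_mul] at this
    refine ⟨(N + M) * Φ.wt none + n, X none ^ M * F, X none ^ N * G, ?_, ?_, ?_, ?_⟩
    · have e := (hX M).mul hF
      rwa [show (M * Φ.wt none + (N * Φ.wt none + (n + m)) : ℤ) =
        (N + M) * Φ.wt none + n + m by ring] at e
    · have e := (hX N).mul hG
      rwa [show (N * Φ.wt none + (M * Φ.wt none + n) : ℤ) =
        (N + M) * Φ.wt none + n by ring] at e
    · rw [map_mul, ← eG, map_pow, aeval_X]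
      intro hm
      rcases h𝔭.mem_or_mem hm with h1 | h1
      · exact h0 (h𝔭.mem_of_pow_mem _ h1)
      · exact (h𝔭.mem_or_mem h1).elim (fun h2 => h0 (h𝔭.mem_of_pow_mem _ h2)) hb'
    · rw [aeval_xK, aeval_xK]
      simp only [map_mul, ← eF, ← eG, map_pow, aeval_X]
      rw [← h]
      ring
  · rintro ⟨n, F, G, hF, hG, hG', h⟩
    exact ⟨n, _, aeval_mem_piece Φ.mem hF, _, aeval_mem_piece Φ.mem hG, hG', by
      rw [← aeval_xK, ← aeval_xK, h]⟩

/-- The derivative `∂f/∂xᵢ` of a section of `O(m)` is a section of `O(m - wᵢ)`. -/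
lemma theta_mem [𝔭.IsPrime] (h0 : Φ.x none ∉ 𝔭) {m : ℤ} {f : FracField I}
    (hf : f ∈ twistStalk w I 𝔭 m) (i : Option τ) :
    ∃ g ∈ twistStalk w I 𝔭 (m - Φ.deg i), Φ.theta i f = Φ.xK i * g := by
  obtain ⟨n, F, G, hF, hG, hG', h⟩ := (Φ.mem_twistStalk_iff h0).1 hf
  have hG0 : aeval Φ.xK G ≠ 0 := by
    rw [aeval_xK]; exact toK_ne_zero (ne_zero_of_notMem hG')
  have h1 := congrArg (Φ.theta i) h
  rw [Derivation.leibniz, theta_aeval, theta_aeval, smul_eq_mul, smul_eq_mul] at h1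
  refine ⟨aeval Φ.xK (pderiv i F * G - F * pderiv i G) / aeval Φ.xK (G ^ 2), ?_, ?_⟩
  · refine (Φ.mem_twistStalk_iff h0).2 ⟨n + n, pderiv i F * G - F * pderiv i G, G ^ 2, ?_, ?_, ?_, ?_⟩
    · have e1 := (hF.pderiv (n' := n + m - Φ.deg i) (i := i) (by ring)).mul hG
      have e2 := hF.mul (hG.pderiv (n' := n - Φ.deg i) (i := i) (by ring))
      rw [show n + m - Φ.deg i + n = n + n + (m - Φ.deg i) by ring] at e1
      rw [show n + m + (n - Φ.deg i) = n + n + (m - Φ.deg i) by ring] at e2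
      exact e1.sub e2
    · rw [pow_two]; exact hG.mul hG
    · rw [map_pow]
      exact fun h2 => hG' (Ideal.IsPrime.mem_of_pow_mem inferInstance _ h2)
    · rw [map_pow]
      exact div_mul_cancel₀ _ (pow_ne_zero _ hG0)
  · rw [map_pow, map_sub, map_mul, map_mul, ← h]
    field_simp
    linear_combination h1

lemma theta_monomial (i : Option τ) (e : Option τ →₀ ℕ) (c : ℂ) :
    Φ.theta i (aeval Φ.xK (monomial e c)) = (e i : FracField I) * aeval Φ.xK (monomial e c) := by
  rw [theta_aeval, ← aeval_X (R := ℂ) Φ.xK i, ← map_mul,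
    X_mul_pderiv_monomial, map_nsmul, nsmul_eq_mul]

lemma euler_aeval [Fintype τ] {d : ℤ} {F : MvPolynomial (Option τ) ℂ}
    (hF : IsWeightedHomogeneous Φ.deg F d) :
    ∑ i, (Φ.wt i : FracField I) * Φ.theta i (aeval Φ.xK F) = d * aeval Φ.xK F := by
  have key : ∀ e ∈ F.support, ∑ i, (Φ.wt i : FracField I) *
      Φ.theta i (aeval Φ.xK (monomial e (coeff e F))) =
      d * aeval Φ.xK (monomial e (coeff e F)) := by
    intro e he
    have hd : Finsupp.weight Φ.deg e = d := hF (mem_support_iff.1 he)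
    rw [Finsupp.weight_apply, Finsupp.sum_fintype _ _ (by simp)] at hd
    rw [← hd]
    push_cast
    rw [Finset.sum_mul]
    refine Finset.sum_congr rfl fun i _ => ?_
    rw [theta_monomial, nsmul_eq_mul]
    simp only [deg]
    push_cast
    ring
  conv_lhs => rw [F.as_sum]
  conv_rhs => rw [F.as_sum]
  simp only [map_sum, Finset.mul_sum]
  rw [Finset.sum_comm]
  refine Finset.sum_congr rfl fun e he => ?_
  rw [key e he]

/-- Euler's identity. -/
lemma euler [Fintype τ] {m : ℤ} {f : FracField I} (hf : f ∈ twistStalk w I ⊥ m) :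
    ∑ i, (Φ.wt i : FracField I) * Φ.theta i f = m * f := by
  have : (⊥ : Ideal (CoordRing I)).IsPrime := Ideal.isPrime_bot
  obtain ⟨n, F, G, hF, hG, hG', h⟩ := (Φ.mem_twistStalk_iff (Φ.x_ne_zero none)).1 hf
  have hG0 : aeval Φ.xK G ≠ 0 := by
    rw [aeval_xK]; exact toK_ne_zero hG'
  have e1 := Φ.euler_aeval hF
  have e2 := Φ.euler_aeval hG
  have h1 : ∀ i, Φ.theta i (aeval Φ.xK F) =
      f * Φ.theta i (aeval Φ.xK G) + aeval Φ.xK G * Φ.theta i f := by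
    intro i
    rw [← h, Derivation.leibniz, smul_eq_mul, smul_eq_mul]
  apply mul_right_cancel₀ hG0
  have e3 : ∑ i, (Φ.wt i : FracField I) * Φ.theta i (aeval Φ.xK F) =
      f * ∑ i, (Φ.wt i : FracField I) * Φ.theta i (aeval Φ.xK G) +
        (∑ i, (Φ.wt i : FracField I) * Φ.theta i f) * aeval Φ.xK G := by
    rw [Finset.mul_sum, Finset.sum_mul, ← Finset.sum_add_distrib]
    refine Finset.sum_congr rfl fun i _ => ?_
    rw [h1]; ring
  rw [e1, e2, ← h] at e3
  push_cast at e3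
  linear_combination -e3

end Chart

/-! ### Logarithmic derivations of the function field -/

lemma log_derivation_pow {K : Type} [Field K] [Algebra ℂ K] (D : Derivation ℂ K K) {a : K}
    (ha : a ≠ 0) (n : ℕ) : D (a ^ n) = n * (D a / a) * a ^ n := by
  cases n with
  | zero => simp
  | succ n =>
    rw [Derivation.leibniz_pow]
    simp only [Nat.add_sub_cancel, smul_eq_mul, nsmul_eq_mul, pow_succ]
    field_simp

lemma log_derivation {K : Type} [Field K] [Algebra ℂ K] (D : Derivation ℂ K K) {a b : K}
    (ha : a ≠ 0) (hb : b ≠ 0) (m n : ℕ) : D (a ^ m * (b ^ n)⁻¹) =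
      (m * (D a / a) - n * (D b / b)) * (a ^ m * (b ^ n)⁻¹) := by
  rw [Derivation.leibniz, Derivation.leibniz_inv, log_derivation_pow D ha, log_derivation_pow D hb]
  simp only [smul_eq_mul]
  field_simp
  ring

namespace Chart

variable {σ : Type} {w : σ → ℤ} {I : Ideal (MvPolynomial σ ℂ)} [IsDomain (CoordRing I)]
  {τ : Type} (Φ : Chart w I τ) {𝔭 : Ideal (CoordRing I)}

instance bot_isPrime : (⊥ : Ideal (CoordRing I)).IsPrime := Ideal.isPrime_bot

lemma theta_mem_zero [𝔭.IsPrime] (h0 : Φ.x none ∉ 𝔭) {m : ℤ} {f : FracField I}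
    (hf : f ∈ twistStalk w I 𝔭 m) (i : Option τ) : Φ.theta i f ∈ twistStalk w I 𝔭 m := by
  obtain ⟨g, hg, h⟩ := Φ.theta_mem h0 hf i
  rw [h, show m = Φ.deg i + (m - Φ.deg i) by ring]
  exact twistStalk_mul (twistStalk_of_piece (Φ.mem i)) hg

/-- The degree of the base coordinate as a complex number. -/
def w0 : ℂ := Φ.wt none

lemma w0_ne_zero : Φ.w0 ≠ 0 := Nat.cast_ne_zero.2 (Φ.wt_pos none).ne'

/-- The derivation `(1/w₀) xᵢ ∂/∂xᵢ` of the function field. -/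
def der (i : τ) : Derivation ℂ (functionField w I) (functionField w I) :=
  Derivation.mk'
    { toFun := fun a => ⟨Φ.w0⁻¹ • Φ.theta (some i) a, mem_functionField
        (twistStalk_smul _ (Φ.theta_mem_zero (Φ.x_ne_zero none) (functionField_mem a) _))⟩
      map_add' := fun a b => Subtype.ext (by simp)
      map_smul' := fun c a => Subtype.ext (by simp [smul_comm c]) }
    fun a b => Subtype.ext (by simp)

lemma coe_der (i : τ) (a : functionField w I) :
    (Φ.der i a : FracField I) = Φ.w0⁻¹ • Φ.theta (some i) a := rfl

/-- The monomial `xᵢ^{w₀} / x₀^{wᵢ}` in the fraction field. -/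
def monK (i : τ) : FracField I := Φ.xK (some i) ^ Φ.wt none * (Φ.xK none ^ Φ.wt (some i))⁻¹

lemma monK_ne_zero (i : τ) : Φ.monK i ≠ 0 :=
  mul_ne_zero (pow_ne_zero _ (Φ.xK_ne_zero _)) (inv_ne_zero (pow_ne_zero _ (Φ.xK_ne_zero _)))

lemma monK_mem [𝔭.IsPrime] (h0 : Φ.x none ∉ 𝔭) (i : τ) : Φ.monK i ∈ twistStalk w I 𝔭 0 := by
  have h1 := twistStalk_pow (twistStalk_of_piece (𝔭 := 𝔭) (Φ.mem (some i))) (Φ.wt none)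
  have h2 := twistStalk_pow (twistStalk_inv (Φ.mem none) h0) (Φ.wt (some i))
  have h3 := twistStalk_mul h1 h2
  rw [show ((Φ.wt none : ℤ) * (Φ.wt (some i) : ℤ) + Φ.wt (some i) * -(Φ.wt none : ℤ)) = 0 by ring,
    inv_pow] at h3
  exact h3

lemma monK_inv_mem [𝔭.IsPrime] {i : τ} (hi : Φ.x (some i) ∉ 𝔭) :
    (Φ.monK i)⁻¹ ∈ twistStalk w I 𝔭 0 := by
  have h1 := twistStalk_pow (twistStalk_inv (Φ.mem (some i)) hi) (Φ.wt none)
  have h2 := twistStalk_pow (twistStalk_of_piece (𝔭 := 𝔭) (Φ.mem none)) (Φ.wt (some i))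
  have h3 := twistStalk_mul h1 h2
  rw [show ((Φ.wt none : ℤ) * -(Φ.wt (some i) : ℤ) + Φ.wt (some i) * (Φ.wt none : ℤ)) = 0 by ring,
    inv_pow] at h3
  rw [monK, mul_inv, inv_inv]
  exact h3

/-- The monomial `xᵢ^{w₀} / x₀^{wᵢ}` in the function field. -/
def mon (i : τ) : functionField w I :=
  ⟨Φ.monK i, mem_functionField (Φ.monK_mem (Φ.x_ne_zero none) i)⟩

/-- The inverse of the monomial `xᵢ^{w₀} / x₀^{wᵢ}`. -/
def monInv (i : τ) : functionField w I :=
  ⟨(Φ.monK i)⁻¹, mem_functionField (Φ.monK_inv_mem (Φ.x_ne_zero _))⟩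

lemma mon_mul_monInv (i : τ) : Φ.mon i * Φ.monInv i = 1 :=
  Subtype.ext (mul_inv_cancel₀ (Φ.monK_ne_zero i))

lemma theta_monK (i : Option τ) (j : τ) : Φ.theta i (Φ.monK j) =
    ((Φ.wt none : FracField I) * (Φ.theta i (Φ.xK (some j)) / Φ.xK (some j)) -
      (Φ.wt (some j) : FracField I) * (Φ.theta i (Φ.xK none) / Φ.xK none)) * Φ.monK j :=
  log_derivation _ (Φ.xK_ne_zero _) (Φ.xK_ne_zero _) _ _

variable [DecidableEq τ]

lemma algebraMap_w0 : algebraMap ℂ (FracField I) Φ.w0 = Φ.wt none := map_natCast _ _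

lemma der_mon (i j : τ) : Φ.der i (Φ.mon j) = if i = j then Φ.mon j else 0 := by
  apply Subtype.ext
  have h : (Φ.der i (Φ.mon j) : FracField I) = Φ.w0⁻¹ • Φ.theta (some i) (Φ.monK j) := rfl
  have hw : (Φ.wt none : FracField I) ≠ 0 := Nat.cast_ne_zero.2 (Φ.wt_pos none).ne'
  have hx := Φ.xK_ne_zero (some j)
  rw [h, theta_monK, theta_xK, theta_xK, Algebra.smul_def, map_inv₀, algebraMap_w0]
  by_cases hij : i = j
  · subst hij
    simp only [if_true, reduceCtorEq, if_false, zero_div, mul_zero, sub_zero, div_self hx, mul_one]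
    rw [inv_mul_cancel_left₀ hw]
    rfl
  · have hij' : ¬ some i = some j := fun h => hij (Option.some_injective _ h)
    simp [hij, hij']

variable [Fintype τ]

lemma aeval_monomial_one (e : Option τ →₀ ℕ) :
    aeval Φ.xK (monomial e (1 : ℂ)) = ∏ i, Φ.xK i ^ e i := by
  rw [aeval_monomial, map_one, one_mul, Finsupp.prod_fintype _ _ (by simp)]

lemma aeval_monomial_ne_zero (e : Option τ →₀ ℕ) : aeval Φ.xK (monomial e (1 : ℂ)) ≠ 0 := by
  rw [aeval_monomial_one]
  exact Finset.prod_ne_zero_iff.2 fun i _ => pow_ne_zero _ (Φ.xK_ne_zero i)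

lemma aeval_monomial_pow (e : Option τ →₀ ℕ) : aeval Φ.xK (monomial e (1 : ℂ)) ^ Φ.wt none =
    (∏ i, Φ.monK i ^ e (some i)) * Φ.xK none ^ (∑ i, e i * Φ.wt i) := by
  have h0 := Φ.xK_ne_zero none
  rw [aeval_monomial_one, Fintype.prod_option, Fintype.sum_option, pow_add, mul_pow,
    ← Finset.prod_pow_eq_pow_sum, ← Finset.prod_pow, mul_left_comm, ← Finset.prod_mul_distrib]
  congr 1
  · rw [← pow_mul]
  · refine Finset.prod_congr rfl fun i _ => ?_
    rw [monK, mul_pow, inv_pow, ← pow_mul, ← pow_mul, ← pow_mul, mul_comm (Φ.wt (some i)),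
      mul_comm (Φ.wt none), mul_assoc, inv_mul_cancel₀ (pow_ne_zero _ h0), mul_one]

lemma weight_eq_sum (e : Option τ →₀ ℕ) :
    Finsupp.weight Φ.deg e = ((∑ i, e i * Φ.wt i : ℕ) : ℤ) := by
  rw [Finsupp.weight_apply, Finsupp.sum_fintype _ _ (by simp)]
  push_cast
  exact Finset.sum_congr rfl fun i _ => by rw [nsmul_eq_mul]; rfl

/-- A derivation of the function field that kills the monomials `xᵢ^{w₀} / x₀^{wᵢ}` vanishes,
because the `w₀`-th power of every Laurent monomial of degree zero is a product of these. -/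
lemma derivation_eq_zero {M : Type} [AddCommGroup M] [Module ℂ M] [Module (functionField w I) M]
    [IsScalarTower ℂ (functionField w I) M]
    (Θ : Derivation ℂ (functionField w I) M) (hΘ : ∀ j, Θ (Φ.mon j) = 0)
    (a : functionField w I) : Θ a = 0 := by
  let Z : Subalgebra ℂ (functionField w I) :=
    { carrier := {b | Θ b = 0}
      mul_mem' := fun {b c} (hb : Θ b = 0) (hc : Θ c = 0) => by
        show Θ (b * c) = 0
        rw [Derivation.leibniz, hb, hc, smul_zero, smul_zero, add_zero]
      add_mem' := fun {b c} (hb : Θ b = 0) (hc : Θ c = 0) => by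
        show Θ (b + c) = 0
        rw [map_add, hb, hc, add_zero]
      algebraMap_mem' := fun c => Θ.map_algebraMap c }
  -- The functions killed by `Θ` are closed under division and under taking roots, as the function
  -- field is a field of characteristic zero.
  have hcancel : ∀ (b : functionField w I) (v : M), b ≠ 0 → b • v = 0 → v = 0 := by
    intro b v hb h
    obtain ⟨b', hb'⟩ := exists_inverse_functionField b hb
    rw [← one_smul (functionField w I) v, ← hb', mul_comm, mul_smul, h, smul_zero]
  have hdiv : ∀ b c : functionField w I, b ∈ Z → b ≠ 0 → c * b ∈ Z → c ∈ Z := by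
    intro b c (hb : Θ b = 0) hb0 (h : Θ (c * b) = 0)
    rw [Derivation.leibniz, hb, smul_zero, zero_add] at h
    exact hcancel b _ hb0 h
  have hroot : ∀ (b : functionField w I) (n : ℕ), b ≠ 0 → n ≠ 0 → b ^ n ∈ Z → b ∈ Z := by
    intro b n hb hn (h : Θ (b ^ n) = 0)
    rw [Derivation.leibniz_pow, ← Nat.cast_smul_eq_nsmul (functionField w I)] at h
    have hn' : (n : functionField w I) ≠ 0 := by
      intro h0
      have := congrArg (Subtype.val) h0
      simp [hn] at this
    have h2 := hcancel _ _ hn' h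
    refine hcancel _ _ ?_ h2
    intro h0
    have := congrArg (Subtype.val) h0
    have hb' : (b : FracField I) ≠ 0 := fun h1 => hb (Subtype.ext h1)
    simp [hb'] at this
  have hmem : ∀ e f : Option τ →₀ ℕ, Finsupp.weight Φ.deg f = Finsupp.weight Φ.deg e →
      aeval Φ.xK (monomial f (1 : ℂ)) / aeval Φ.xK (monomial e (1 : ℂ)) ∈ twistStalk w I ⊥ 0 := by
    intro e f hef
    refine (Φ.mem_twistStalk_iff (Φ.x_ne_zero none)).2 ⟨Finsupp.weight Φ.deg e, monomial f 1,
      monomial e 1, ?_, isWeightedHomogeneous_monomial _ _ _ rfl, ?_,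
      div_mul_cancel₀ _ (Φ.aeval_monomial_ne_zero e)⟩
    · exact isWeightedHomogeneous_monomial _ _ _ (by rw [hef, add_zero])
    · intro h
      apply Φ.aeval_monomial_ne_zero e
      rw [aeval_xK, (Submodule.mem_bot _).1 h, map_zero]
  have hZ : ∀ (e f : Option τ →₀ ℕ) (hef : Finsupp.weight Φ.deg f = Finsupp.weight Φ.deg e),
      (⟨_, mem_functionField (hmem e f hef)⟩ : functionField w I) ∈ Z := by
    intro e f hef
    have hprod : ∀ g : Option τ →₀ ℕ, ∏ i, Φ.mon i ^ g (some i) ∈ Z :=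
      fun g => Subalgebra.prod_mem _ fun i _ => Subalgebra.pow_mem _ (hΘ i) _
    have hcoe : ∀ g : Option τ →₀ ℕ, ((∏ i, Φ.mon i ^ g (some i) : functionField w I) : FracField I)
        = ∏ i, Φ.monK i ^ g (some i) := by
      intro g
      rw [SubmonoidClass.coe_finsetProd]
      rfl
    refine hroot _ (Φ.wt none) ?_ (Φ.wt_pos none).ne' (hdiv _ _ (hprod e) ?_ ?_)
    · intro h
      exact div_ne_zero (Φ.aeval_monomial_ne_zero f) (Φ.aeval_monomial_ne_zero e)
        (congrArg Subtype.val h)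
    · intro h
      have := congrArg Subtype.val h
      rw [hcoe] at this
      exact Finset.prod_ne_zero_iff.2 (fun i _ => pow_ne_zero _ (Φ.monK_ne_zero i)) this
    · convert hprod f using 1
      apply Subtype.ext
      rw [hcoe]
      show (_ / _) ^ Φ.wt none * ((∏ i, Φ.mon i ^ e (some i) : functionField w I) : FracField I) = _
      rw [hcoe, div_pow, aeval_monomial_pow, aeval_monomial_pow]
      have hs : (∑ i, f i * Φ.wt i) = ∑ i, e i * Φ.wt i := by
        rw [weight_eq_sum, weight_eq_sum] at hef
        exact_mod_cast hef
      have h1 : ∏ i, Φ.monK i ^ e (some i) ≠ 0 :=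
        Finset.prod_ne_zero_iff.2 fun i _ => pow_ne_zero _ (Φ.monK_ne_zero i)
      have h2 : Φ.xK none ^ (∑ i, e i * Φ.wt i) ≠ 0 := pow_ne_zero _ (Φ.xK_ne_zero none)
      rw [hs]
      field_simp
  -- Dividing numerator and denominator of `a` by a monomial of the same degree makes both of them
  -- linear combinations of Laurent monomials of degree zero.
  obtain ⟨n, F, G, hF, hG, hG', h⟩ :=
    (Φ.mem_twistStalk_iff (Φ.x_ne_zero none)).1 (functionField_mem a)
  have hG0 : G ≠ 0 := by rintro rfl; exact hG' (by rw [map_zero]; exact zero_mem _)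
  obtain ⟨e, he⟩ := MvPolynomial.ne_zero_iff.1 hG0
  have hen : Finsupp.weight Φ.deg e = n := hG he
  have hfrac : ∀ H : MvPolynomial (Option τ) ℂ, IsWeightedHomogeneous Φ.deg H n →
      ∃ b ∈ Z, (b : FracField I) = aeval Φ.xK H / aeval Φ.xK (monomial e (1 : ℂ)) := by
    intro H hH
    have hHe : ∀ f : H.support, Finsupp.weight Φ.deg (f : Option τ →₀ ℕ) = Finsupp.weight Φ.deg e :=
      fun f => (hH (mem_support_iff.1 f.2)).trans hen.symm
    refine ⟨∑ f : H.support, coeff (f : Option τ →₀ ℕ) H •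
      (⟨_, mem_functionField (hmem e f (hHe f))⟩ : functionField w I),
      Subalgebra.sum_mem _ fun f _ => Subalgebra.smul_mem _ (hZ e f (hHe f)) _, ?_⟩
    rw [AddSubmonoidClass.coe_finsetSum]
    conv_rhs => rw [H.as_sum, map_sum, Finset.sum_div, ← Finset.sum_coe_sort]
    refine Finset.sum_congr rfl fun f _ => ?_
    show coeff (f : Option τ →₀ ℕ) H • (_ / _) = _
    rw [← smul_div_assoc, ← map_smul, smul_monomial, smul_eq_mul, mul_one]
  obtain ⟨b, hb, eb⟩ := hfrac G hG
  obtain ⟨c, hc, ec⟩ := hfrac F (by rwa [add_zero] at hF)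
  have hGK : aeval Φ.xK G ≠ 0 := fun h0 => hG0 (Φ.inj_xK (by rw [h0, map_zero]))
  refine hdiv b a hb ?_ ?_
  · rintro rfl
    exact div_ne_zero hGK (Φ.aeval_monomial_ne_zero e) eb.symm
  · convert hc using 1
    apply Subtype.ext
    show (a : FracField I) * (b : FracField I) = c
    rw [eb, ec, ← h]
    ring

/-- The differential of a function in terms of the dual derivations: both sides are derivations with
the same values at the monomials `xᵢ^{w₀} / x₀^{wᵢ}`. -/
lemma differential_eq (a : functionField w I) : KaehlerDifferential.D ℂ (functionField w I) a =
    ∑ i, Φ.der i a • Φ.monInv i • KaehlerDifferential.D ℂ (functionField w I) (Φ.mon i) := by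
  let Θ : Derivation ℂ (functionField w I) (Ω[functionField w I⁄ℂ]) :=
    KaehlerDifferential.D ℂ (functionField w I) - ∑ i, (LinearMap.toSpanSingleton (functionField w I)
      (Ω[functionField w I⁄ℂ]) (Φ.monInv i •
        KaehlerDifferential.D ℂ (functionField w I) (Φ.mon i))).compDer (Φ.der i)
  have hΘ : ∀ a, Θ a = KaehlerDifferential.D ℂ (functionField w I) a -
      ∑ i, Φ.der i a • Φ.monInv i • KaehlerDifferential.D ℂ (functionField w I) (Φ.mon i) := by
    intro a
    have := map_sum (Derivation.coeFnAddMonoidHom (R := ℂ) (A := functionField w I)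
      (M := Ω[functionField w I⁄ℂ])) (fun i => (LinearMap.toSpanSingleton (functionField w I)
      (Ω[functionField w I⁄ℂ]) (Φ.monInv i •
        KaehlerDifferential.D ℂ (functionField w I) (Φ.mon i))).compDer (Φ.der i)) Finset.univ
    have h2 := congrFun this a
    simp only [Derivation.coeFnAddMonoidHom_apply] at h2
    rw [Derivation.sub_apply, h2, Finset.sum_apply]
    rfl
  refine sub_eq_zero.1 ((hΘ a).symm.trans (Φ.derivation_eq_zero Θ (fun j => ?_) a))
  rw [hΘ, Finset.sum_eq_single j]
  · rw [der_mon, if_pos rfl, sub_eq_zero]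
    have h := mul_smul (β := Ω[functionField w I⁄ℂ]) (Φ.mon j) (Φ.monInv j)
      (KaehlerDifferential.D ℂ (functionField w I) (Φ.mon j))
    rw [mon_mul_monInv] at h
    exact (one_smul (functionField w I) (α := Ω[functionField w I⁄ℂ]) _).symm.trans h
  · intro i _ hij
    rw [der_mon, if_neg hij]
    exact zero_smul (functionField w I) (A := Ω[functionField w I⁄ℂ]) _
  · simp

end Chart

/-! ### Groups generated by Jacobian determinants -/

section DetSpan

variable {K : Type} [CommRing K] [Algebra ℂ K] {τ ι : Type} [Fintype τ] [DecidableEq τ] [Fintype ι]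
  [DecidableEq ι]

lemma detSpan_reindex (D : τ → Derivation ℂ K K) (e : ι ≃ τ) (O : Set K) :
    detSpan (fun i => D (e i)) O = detSpan D O := by
  have hdet : ∀ a : τ → K, (Matrix.of fun i j => D (e i) (a (e j))).det =
      (Matrix.of fun i j => D i (a j)).det := by
    intro a
    rw [← Matrix.det_submatrix_equiv_self e (Matrix.of fun i j => D i (a j))]
    rfl
  unfold detSpan
  congr 1
  ext h
  constructor
  · rintro ⟨a₀, a, h0, h1, rfl⟩
    refine ⟨a₀, fun i => a (e.symm i), h0, fun i => h1 _, ?_⟩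
    rw [← hdet]
    simp
  · rintro ⟨a₀, a, h0, h1, rfl⟩
    exact ⟨a₀, fun i => a (e i), h0, fun i => h1 _, by rw [hdet]⟩

/-- Changing the system of derivations multiplies the group of determinants by a determinant. -/
lemma mem_detSpan_change {D E : τ → Derivation ℂ K K} {M : Matrix τ τ K}
    (h : ∀ i a, D i a = ∑ k, M i k * E k a) {T' : K} (hT : M.det * T' = 1) {O : Set K} {f : K} :
    f ∈ detSpan D O ↔ f * T' ∈ detSpan E O := by
  have hdet : ∀ a : τ → K, (Matrix.of fun i j => D i (a j)).det =
      M.det * (Matrix.of fun i j => E i (a j)).det := by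
    intro a
    rw [← Matrix.det_mul]
    congr 1
    ext i j
    simp [Matrix.mul_apply, h]
  have hmap : (detSpan E O).map (AddMonoidHom.mulLeft M.det) = detSpan D O := by
    rw [detSpan, AddMonoidHom.map_closure, detSpan]
    congr 1
    ext f
    constructor
    · rintro ⟨_, ⟨a₀, a, h0, h1, rfl⟩, rfl⟩
      refine ⟨a₀, a, h0, h1, ?_⟩
      rw [hdet, AddMonoidHom.coe_mulLeft]; ring
    · rintro ⟨a₀, a, h0, h1, rfl⟩
      refine ⟨_, ⟨a₀, a, h0, h1, rfl⟩, ?_⟩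
      rw [hdet, AddMonoidHom.coe_mulLeft]; ring
  rw [← hmap]
  constructor
  · rintro ⟨g, hg, rfl⟩
    have : M.det * g * T' = g := by rw [mul_right_comm, hT, one_mul]
    rwa [AddMonoidHom.coe_mulLeft, this]
  · intro hf
    refine ⟨_, hf, ?_⟩
    rw [AddMonoidHom.coe_mulLeft, mul_left_comm, hT, mul_one]

end DetSpan

section Divisibility

variable {ι : Type}

lemma exists_mem_support_of_not_X_dvd {F : MvPolynomial ι ℂ} {j : ι} (h : ¬ X j ∣ F) :
    ∃ e ∈ F.support, e j = 0 := by
  by_contra! hc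
  apply h
  rw [F.as_sum]
  exact Finset.dvd_sum fun e he => X_dvd_monomial.2 (Or.inr (hc e he))

end Divisibility

namespace Chart

variable {σ : Type} {w : σ → ℤ} {I : Ideal (MvPolynomial σ ℂ)} [IsDomain (CoordRing I)]
  {τ : Type} (Φ : Chart w I τ) {𝔭 : Ideal (CoordRing I)}

/-! ### The prime divisors of a chart -/

/-- The prime ideal of the closure of the divisor `xⱼ = 0` of the chart. -/
def divisor (j : τ) : Ideal (CoordRing I) where
  carrier := {a | ∃ (N : ℕ) (F : MvPolynomial (Option τ) ℂ),
    Φ.x none ^ N * a = aeval Φ.x (X (some j) * F)}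
  zero_mem' := ⟨0, 0, by simp⟩
  add_mem' := by
    rintro a b ⟨N, F, hF⟩ ⟨M, G, hG⟩
    refine ⟨N + M, X none ^ M * F + X none ^ N * G, ?_⟩
    simp only [map_mul, map_add, map_pow, aeval_X] at *
    linear_combination Φ.x none ^ M * hF + Φ.x none ^ N * hG
  smul_mem' := by
    rintro a b ⟨N, F, hF⟩
    obtain ⟨M, G, hG⟩ := Φ.surj a
    refine ⟨N + M, F * G, ?_⟩
    rw [smul_eq_mul]
    simp only [map_mul, aeval_X] at hF ⊢
    rw [pow_add]
    linear_combination (Φ.x none ^ M * a) * hF + (Φ.x (some j) * aeval Φ.x F) * hG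

lemma not_X_dvd_X_pow (j : τ) (N : ℕ) :
    ¬ (X (some j) : MvPolynomial (Option τ) ℂ) ∣ X none ^ N := by
  intro h
  have := (X_dvd_X (R := ℂ)).1 (X_prime.dvd_of_dvd_pow h)
  simp at this

lemma divisor_isPrime (j : τ) : (Φ.divisor j).IsPrime := by
  constructor
  · rw [Ideal.ne_top_iff_one]
    rintro ⟨N, F, h⟩
    have : X none ^ N = X (some j) * F := Φ.inj (by simpa using h)
    exact not_X_dvd_X_pow j N ⟨F, this⟩
  · rintro a b ⟨N, F, h⟩
    obtain ⟨M, A, hA⟩ := Φ.surj a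
    obtain ⟨L, B, hB⟩ := Φ.surj b
    have e : X none ^ N * (A * B) = X (some j) * (X none ^ (M + L) * F) := by
      apply Φ.inj
      rw [map_mul, map_mul, ← hA, ← hB]
      simp only [map_mul, map_pow, aeval_X] at *
      linear_combination Φ.x none ^ (M + L) * h
    have hd : X (some j) ∣ X none ^ N * (A * B) := ⟨_, e⟩
    rcases (X_prime.dvd_or_dvd hd).resolve_left (not_X_dvd_X_pow j N) |> X_prime.dvd_or_dvd with
      ⟨A', rfl⟩ | ⟨B', rfl⟩
    · exact Or.inl ⟨M, A', hA⟩
    · exact Or.inr ⟨L, B', hB⟩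

lemma x_mem_divisor_iff (i j : τ) : Φ.x (some i) ∈ Φ.divisor j ↔ i = j := by
  constructor
  · rintro ⟨N, F, h⟩
    have e : X none ^ N * X (some i) = X (some j) * F := Φ.inj (by simpa using h)
    have := (X_prime.dvd_or_dvd ⟨F, e⟩).resolve_left (not_X_dvd_X_pow j N)
    have := (X_dvd_X (R := ℂ)).1 this
    exact (Option.some_injective _ this).symm
  · rintro rfl
    exact ⟨0, 1, by simp⟩

lemma divisor_le [h𝔭 : 𝔭.IsPrime] (h0 : Φ.x none ∉ 𝔭) {j : τ} (hj : Φ.x (some j) ∈ 𝔭) :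
    Φ.divisor j ≤ 𝔭 := by
  rintro a ⟨N, F, h⟩
  have : Φ.x none ^ N * a ∈ 𝔭 := by
    rw [h, map_mul, aeval_X]
    exact 𝔭.mul_mem_right _ hj
  exact (h𝔭.mem_or_mem this).resolve_left fun h1 => h0 (h𝔭.mem_of_pow_mem _ h1)

lemma eq_of_le_of_height_one {R : Type} [CommRing R] [IsDomain R] {𝔭 𝔮 : Ideal R} [𝔭.IsPrime]
    [𝔮.IsPrime] (h1 : 𝔭.height = 1) (hle : 𝔮 ≤ 𝔭) (h0 : 𝔮 ≠ ⊥) : 𝔮 = 𝔭 := by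
  by_contra hne
  have := Ideal.height_add_one_le_of_lt_of_isPrime (lt_of_le_of_ne hle hne)
  rw [h1] at this
  have h2 : 𝔮.height = 0 := by
    have h3 : 𝔮.height + 1 ≤ 0 + 1 := by simpa using this
    exact le_antisymm ((ENat.add_le_add_iff_right (by simp)).1 h3) bot_le
  exact h0 (Ideal.height_eq_zero_iff_eq_bot.1 h2)

/-- At a point of codimension one of the chart at most one coordinate vanishes. -/
lemma eq_of_mem_of_mem [𝔭.IsPrime] (h1 : 𝔭.height = 1) (h0 : Φ.x none ∉ 𝔭) {i j : τ}
    (hi : Φ.x (some i) ∈ 𝔭) (hj : Φ.x (some j) ∈ 𝔭) : i = j := by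
  have := Φ.divisor_isPrime j
  have hne : Φ.divisor j ≠ ⊥ := by
    intro h
    have : Φ.x (some j) ∈ Φ.divisor j := (Φ.x_mem_divisor_iff j j).2 rfl
    rw [h] at this
    exact Φ.x_ne_zero _ this
  rw [← Φ.x_mem_divisor_iff, eq_of_le_of_height_one h1 (Φ.divisor_le h0 hj) hne]
  exact hi

/-! ### Regular forms on a chart -/

variable [Fintype τ] [DecidableEq τ]

lemma exists_form {n : ℕ} (e : Fin n ≃ τ) : ∃ η : DiffForms (functionField w I) n, η ≠ 0 ∧
    ∀ O, formMultipliers η O = detSpan Φ.der O := by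
  obtain ⟨η, h0, h⟩ := KeyVariety.exists_form (fun i => Φ.der (e i))
    (fun i => Φ.monInv (e i) • KaehlerDifferential.D ℂ (functionField w I) (Φ.mon (e i)))
    (fun i j => by
      rw [map_smul, Derivation.liftKaehlerDifferential_comp_D, der_mon]
      by_cases hij : i = j
      · subst hij
        rw [if_pos rfl, if_pos rfl, smul_eq_mul, mul_comm, mon_mul_monInv]
      · rw [if_neg hij, if_neg fun h => hij (e.injective h), smul_zero])
    (fun a => by
      rw [Φ.differential_eq a]
      exact (Equiv.sum_comp e _).symm)
  exact ⟨η, h0, fun O => by rw [h, detSpan_reindex Φ.der e]⟩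

lemma twistStalk_det [𝔭.IsPrime] {m : τ → ℤ} {B : Matrix τ τ (FracField I)}
    (hB : ∀ i j, B i j ∈ twistStalk w I 𝔭 (m i)) : B.det ∈ twistStalk w I 𝔭 (∑ i, m i) := by
  rw [Matrix.det_apply]
  refine twistStalk_sum _ fun π _ => ?_
  have h := twistStalk_prod Finset.univ (m := fun i => m (π i)) (f := fun i => B (π i) i)
    fun i _ => hB (π i) i
  rw [Equiv.sum_comp π m] at h
  rcases Int.units_eq_one_or (Equiv.Perm.sign π) with hs | hs
  · rw [hs, one_smul]; exact h
  · rw [hs, Units.neg_smul, one_smul]; exact twistStalk_neg h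

/-- Regularity of `h η` implies regularity of `h / ∏ xᵢ`: the derivative `xᵢ ∂a/∂xᵢ` of a regular
function is `xᵢ` times a section of `O(-wᵢ)`, so `∏ xᵢ` splits off every determinant. -/
lemma detSpan_le [𝔭.IsPrime] (h0 : Φ.x none ∉ 𝔭) {h : functionField w I}
    (hh : h ∈ detSpan Φ.der (localRing w I 𝔭)) :
    (h : FracField I) * (∏ i, Φ.xK (some i))⁻¹ ∈ twistStalk w I 𝔭 (-∑ i, Φ.deg (some i)) := by
  rw [detSpan] at hh
  induction hh using AddSubgroup.closure_induction with
  | mem h hh =>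
    obtain ⟨a₀, a, ha₀, ha, rfl⟩ := hh
    choose b hb hb' using fun (i j : τ) => Φ.theta_mem h0 (ha j) (some i)
    have hP : ∏ i, Φ.xK (some i) ≠ 0 := Finset.prod_ne_zero_iff.2 fun i _ => Φ.xK_ne_zero _
    have hdet : ((Matrix.of fun i j => Φ.der i (a j)).det : FracField I) =
        (∏ i, Φ.xK (some i)) * (Matrix.of fun i j => Φ.w0⁻¹ • b i j).det := by
      rw [← Matrix.det_mul_column]
      have := RingHom.map_det (functionField w I).val.toRingHom (Matrix.of fun i j => Φ.der i (a j))
      refine this.trans ?_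
      congr 1
      ext i j
      show Φ.w0⁻¹ • Φ.theta (some i) (a j) = _
      rw [hb', Matrix.of_apply, Matrix.of_apply, mul_smul_comm]
    have h1 : (Matrix.of fun i j => Φ.w0⁻¹ • b i j).det ∈
        twistStalk w I 𝔭 (∑ i, (0 - Φ.deg (some i))) :=
      twistStalk_det fun i j => twistStalk_smul _ (hb i j)
    have h2 := twistStalk_mul ha₀ h1
    rw [show (0 + ∑ i, (0 - Φ.deg (some i))) = -∑ i, Φ.deg (some i) by simp] at h2
    convert h2 using 1
    show ((a₀ : FracField I) * ((Matrix.of fun i j => Φ.der i (a j)).det : FracField I)) * _ = _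
    rw [hdet]
    field_simp
  | zero => simpa using twistStalk_zero _
  | add x y _ _ hx hy =>
    have e : ((x + y : functionField w I) : FracField I) = x + y := rfl
    rw [e, add_mul]; exact twistStalk_add hx hy
  | neg x _ hx =>
    have e : ((-x : functionField w I) : FracField I) = -x := rfl
    rw [e, neg_mul]; exact twistStalk_neg hx

/-- Where no coordinate vanishes, the monomials `xᵢ^{w₀} / x₀^{wᵢ}` are units, and the matrix of their
derivatives is diagonal. -/
lemma mem_detSpan_of_units [𝔭.IsPrime] (h0 : Φ.x none ∉ 𝔭) (hx : ∀ i, Φ.x (some i) ∉ 𝔭)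
    {h : functionField w I}
    (hh : (h : FracField I) * (∏ i, Φ.xK (some i))⁻¹ ∈ twistStalk w I 𝔭 (-∑ i, Φ.deg (some i))) :
    h ∈ detSpan Φ.der (localRing w I 𝔭) := by
  have hP : ∏ i, Φ.xK (some i) ≠ 0 := Finset.prod_ne_zero_iff.2 fun i _ => Φ.xK_ne_zero _
  refine AddSubgroup.subset_closure ⟨h * ∏ i, Φ.monInv i, Φ.mon, ?_, fun i => Φ.monK_mem h0 i, ?_⟩
  · have h1 := twistStalk_prod (w := w) (𝔭 := 𝔭) Finset.univ (m := fun i => Φ.deg (some i))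
      (f := fun i => Φ.xK (some i)) fun i _ => twistStalk_of_piece (Φ.mem (some i))
    have h2 := twistStalk_prod (w := w) (𝔭 := 𝔭) Finset.univ (m := fun _ => 0)
      (f := fun i => (Φ.monK i)⁻¹) fun i _ => Φ.monK_inv_mem (hx i)
    have h3 := twistStalk_mul (twistStalk_mul hh h1) h2
    simp only [Finset.sum_const_zero, add_zero, neg_add_cancel] at h3
    rw [inv_mul_cancel_right₀ hP] at h3
    show (h : FracField I) * ((∏ i, Φ.monInv i : functionField w I) : FracField I) ∈
      twistStalk w I 𝔭 0
    rw [SubmonoidClass.coe_finsetProd]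
    exact h3
  · have : (Matrix.of fun i j => Φ.der i (Φ.mon j)) = Matrix.diagonal Φ.mon := by
      ext i j
      rw [Matrix.of_apply, der_mon, Matrix.diagonal_apply]
      by_cases hij : i = j
      · subst hij; simp
      · simp [hij]
    rw [this, Matrix.det_diagonal, mul_assoc, ← Finset.prod_mul_distrib]
    simp [mul_comm, mon_mul_monInv]

lemma theta_monomial_div (i : Option τ) (e g : Option τ →₀ ℕ) :
    Φ.theta i (aeval Φ.xK (monomial e (1 : ℂ)) / aeval Φ.xK (monomial g (1 : ℂ))) =
      ((e i : FracField I) - g i) *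
        (aeval Φ.xK (monomial e (1 : ℂ)) / aeval Φ.xK (monomial g (1 : ℂ))) := by
  have hg := Φ.aeval_monomial_ne_zero g
  rw [Derivation.leibniz_div, theta_monomial, theta_monomial]
  simp only [smul_eq_mul]
  field_simp

lemma aeval_monomial_notMem [h𝔭 : 𝔭.IsPrime] {e : Option τ →₀ ℕ}
    (he : ∀ i, e i ≠ 0 → Φ.x i ∉ 𝔭) : aeval Φ.x (monomial e (1 : ℂ)) ∉ 𝔭 := by
  rw [aeval_monomial, map_one, one_mul, Finsupp.prod, h𝔭.prod_mem_iff]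
  rintro ⟨i, hi, h⟩
  exact he i (Finsupp.mem_support_iff.1 hi) (h𝔭.mem_of_pow_mem _ h)

/-- At the generic point of the divisor `xⱼ = 0`, the function `h` itself is a multiple of a Laurent
monomial `y` of degree zero with exponent `K > 0` at `xⱼ`. With `y` in place of the `j`-th monomial
`xⱼ^{w₀} / x₀^{wⱼ}`, the determinant of the derivatives is `K / w₀` times `y` and the remaining
monomials, which are units. -/
lemma mem_detSpan_of_mem [𝔭.IsPrime] (h1 : 𝔭.height = 1) (h0 : Φ.x none ∉ 𝔭) {j : τ}
    (hj : Φ.x (some j) ∈ 𝔭) {h : functionField w I}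
    (hh : (h : FracField I) * (∏ i, Φ.xK (some i))⁻¹ ∈ twistStalk w I 𝔭 (-∑ i, Φ.deg (some i))) :
    h ∈ detSpan Φ.der (localRing w I 𝔭) := by
  have hP : ∏ i, Φ.xK (some i) ≠ 0 := Finset.prod_ne_zero_iff.2 fun i _ => Φ.xK_ne_zero _
  have hunit : ∀ i : Option τ, i ≠ some j → Φ.x i ∉ 𝔭 := by
    rintro (_ | i) hi hm
    · exact h0 hm
    · exact hi (congrArg some (Φ.eq_of_mem_of_mem h1 h0 hm hj))
  obtain ⟨n, F, G, hF, hG, hG', hFG⟩ := (Φ.mem_twistStalk_iff h0).1 hh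
  by_cases hF0 : F = 0
  · have : (h : FracField I) = 0 := by
      rw [hF0, map_zero] at hFG
      have hGK : aeval Φ.xK G ≠ 0 := by
        rw [aeval_xK]; exact toK_ne_zero (ne_zero_of_notMem hG')
      simpa [hGK, hP] using hFG
    rw [show h = 0 from Subtype.ext this]
    exact zero_mem _
  obtain ⟨K, H, hH, hPF⟩ := WfDvdMonoid.max_power_factor (a₀ := (∏ i, X (some i)) * F)
    (mul_ne_zero (Finset.prod_ne_zero_iff.2 fun i _ => X_ne_zero _) hF0)
    (X_prime (R := ℂ) (i := some j)).irreducible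
  -- The factor `xⱼ` of `∏ xᵢ` makes the exponent positive.
  have hK : K ≠ 0 := by
    rintro rfl
    rw [pow_zero, one_mul] at hPF
    apply hH
    rw [← hPF]
    exact (Finset.dvd_prod_of_mem (fun i => X (some i)) (Finset.mem_univ j)).mul_right F
  have hGj : ¬ X (some j) ∣ G := by
    rintro ⟨G', rfl⟩
    rw [map_mul, aeval_X] at hG'
    exact hG' (𝔭.mul_mem_right _ hj)
  obtain ⟨e, he, hej⟩ := exists_mem_support_of_not_X_dvd hH
  obtain ⟨g, hg, hgj⟩ := exists_mem_support_of_not_X_dvd hGj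
  have hhG : (h : FracField I) * aeval Φ.xK G = aeval Φ.xK (X (some j) ^ K * H) := by
    rw [← hPF, map_mul, ← hFG, map_prod]
    simp only [aeval_X]
    field_simp
  have hdeg : IsWeightedHomogeneous Φ.deg (X (some j) ^ K * H) n := by
    rw [← hPF]
    have := (IsWeightedHomogeneous.prod Finset.univ (fun i : τ => (X (some i) :
      MvPolynomial (Option τ) ℂ)) (fun i => Φ.deg (some i))
      fun i _ => isWeightedHomogeneous_X ℂ Φ.deg (some i)).mul hF
    rwa [show ∑ i, Φ.deg (some i) + (n + -∑ i, Φ.deg (some i)) = n by ring] at this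
  have hwH : ∀ d ∈ H.support, Finsupp.weight Φ.deg (Finsupp.single (some j) K + d) = n := by
    intro d hd
    apply hdeg
    rw [X_pow_eq_monomial, coeff_monomial_mul, one_mul]
    exact mem_support_iff.1 hd
  have hHhom : IsWeightedHomogeneous Φ.deg H (Finsupp.weight Φ.deg e) := by
    intro d hd
    have e1 := hwH d (mem_support_iff.2 hd)
    have e2 := hwH e he
    rw [map_add] at e1 e2
    linarith
  have hgw : Finsupp.weight Φ.deg g = n := hG (mem_support_iff.1 hg)
  have hge : ∀ i, g i ≠ 0 → Φ.x i ∉ 𝔭 := fun i hi => hunit i fun h => hi (h ▸ hgj)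
  have hee : ∀ i, e i ≠ 0 → Φ.x i ∉ 𝔭 := fun i hi => hunit i fun h => hi (h ▸ hej)
  -- The monomials with exponents `e` and `g` are units at the point, since `xⱼ` does not occur.
  set yK : FracField I := aeval Φ.xK (monomial (Finsupp.single (some j) K + e) (1 : ℂ)) /
    aeval Φ.xK (monomial g (1 : ℂ)) with hyK
  have hgK := Φ.aeval_monomial_ne_zero g
  have heK := Φ.aeval_monomial_ne_zero e
  have hyK0 : yK ≠ 0 := div_ne_zero (Φ.aeval_monomial_ne_zero _) hgK
  have hymem : yK ∈ twistStalk w I 𝔭 0 := by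
    refine (Φ.mem_twistStalk_iff h0).2 ⟨n, _, _, ?_, ?_, Φ.aeval_monomial_notMem hge,
      div_mul_cancel₀ _ hgK⟩
    · rw [add_zero]; exact isWeightedHomogeneous_monomial _ _ _ (hwH e he)
    · exact isWeightedHomogeneous_monomial _ _ _ hgw
  obtain ⟨y, hy⟩ : ∃ y : functionField w I, (y : FracField I) = yK :=
    ⟨⟨yK, mem_functionField (twistStalk_subset hymem)⟩, rfl⟩
  obtain ⟨y', hy'⟩ := exists_inverse_functionField y
    fun h => hyK0 (by rw [← hy, h]; rfl)
  have hy'K : (y' : FracField I) = yK⁻¹ := by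
    have := congrArg Subtype.val hy'
    rw [← hy]
    exact eq_inv_of_mul_eq_one_right this
  have hquot : (h : FracField I) * y' ∈ twistStalk w I 𝔭 0 := by
    refine (Φ.mem_twistStalk_iff h0).2 ⟨Finsupp.weight Φ.deg e + n, monomial g 1 * H,
      monomial e 1 * G, ?_, ?_, ?_, ?_⟩
    · have := (isWeightedHomogeneous_monomial Φ.deg g (1 : ℂ) hgw).mul hHhom
      rwa [add_comm, ← add_zero (_ + n)] at this
    · exact (isWeightedHomogeneous_monomial Φ.deg e (1 : ℂ) rfl).mul hG
    · rw [map_mul]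
      exact fun hm => (Ideal.IsPrime.mem_or_mem inferInstance hm).elim
        (Φ.aeval_monomial_notMem hee) hG'
    · have hjK : Φ.xK (some j) ^ K ≠ 0 := pow_ne_zero _ (Φ.xK_ne_zero _)
      have hmon : aeval Φ.xK (monomial (Finsupp.single (some j) K + e) (1 : ℂ)) =
          Φ.xK (some j) ^ K * aeval Φ.xK (monomial e (1 : ℂ)) := by
        rw [← one_mul (1 : ℂ), ← monomial_mul, ← X_pow_eq_monomial, map_mul, map_pow, aeval_X,
          one_mul]
      rw [map_mul, map_pow, aeval_X] at hhG
      rw [hy'K, hyK, hmon, map_mul, map_mul]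
      field_simp
      linear_combination hhG
  have hdery : ∀ i, Φ.der i y = (Φ.w0⁻¹ * (((Finsupp.single (some j) K + e) (some i) : ℂ) -
      (g (some i) : ℂ))) • y := by
    intro i
    apply Subtype.ext
    rw [coe_der, hy, hyK, theta_monomial_div, ← hyK, mul_smul]
    show _ = Φ.w0⁻¹ • (_ • (y : FracField I))
    rw [hy, Algebra.smul_def (_ - _ : ℂ)]
    simp
  have hcj : (((Finsupp.single (some j) K + e) (some j) : ℂ) - (g (some j) : ℂ)) = K := by
    simp [hej, hgj]
  have hmat : (Matrix.of fun i l => Φ.der i (Function.update Φ.mon j y l)) =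
      Matrix.of fun i l => Function.update Φ.mon j y l *
        (Matrix.updateCol (1 : Matrix τ τ (functionField w I)) j fun i =>
          algebraMap ℂ _ (Φ.w0⁻¹ * (((Finsupp.single (some j) K + e) (some i) : ℂ) -
            (g (some i) : ℂ)))) i l := by
    ext1 i l
    rw [Matrix.of_apply, Matrix.of_apply]
    by_cases hl : l = j
    · subst hl
      rw [Function.update_self, Matrix.updateCol_self, hdery, Algebra.smul_def, mul_comm]
    · rw [Function.update_of_ne hl, Matrix.updateCol_ne hl, der_mon, Matrix.one_apply]
      split_ifs <;> simp
  have hKc : (K : ℂ) ≠ 0 := Nat.cast_ne_zero.2 hK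
  refine AddSubgroup.subset_closure ⟨(Φ.w0 / K) • (h * y' * ∏ l ∈ Finset.univ \ {j}, Φ.monInv l),
    Function.update Φ.mon j y, ?_, ?_, ?_⟩
  · have h2 := twistStalk_prod (w := w) (𝔭 := 𝔭) (Finset.univ \ {j}) (m := fun _ => 0)
      (f := fun i => (Φ.monK i)⁻¹) fun i hi => Φ.monK_inv_mem (hunit _ fun h => by
        simp [Option.some_injective _ h] at hi)
    have h3 := twistStalk_smul (Φ.w0 / K) (twistStalk_mul hquot h2)
    simp only [Finset.sum_const_zero, add_zero] at h3
    show (Φ.w0 / K) • ((h : FracField I) * y' *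
      ((∏ l ∈ Finset.univ \ {j}, Φ.monInv l : functionField w I) : FracField I)) ∈
      twistStalk w I 𝔭 0
    rw [SubmonoidClass.coe_finsetProd]
    exact h3
  · intro i
    by_cases hi : i = j
    · subst hi
      rw [Function.update_self]
      show (y : FracField I) ∈ twistStalk w I 𝔭 0
      rw [hy]
      exact hymem
    · rw [Function.update_of_ne hi]
      exact Φ.monK_mem h0 i
  · have hdet : (Matrix.updateCol (1 : Matrix τ τ (functionField w I)) j fun i =>
          algebraMap ℂ _ (Φ.w0⁻¹ * (((Finsupp.single (some j) K + e) (some i) : ℂ) -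
            (g (some i) : ℂ)))).det = algebraMap ℂ _ (Φ.w0⁻¹ * K) := by
      rw [← Matrix.cramer_apply, Matrix.cramer_one]
      simp only [Module.End.one_apply]
      rw [hcj]
    have hprod : (∏ l ∈ Finset.univ \ {j}, Φ.monInv l) * ∏ l ∈ Finset.univ \ {j}, Φ.mon l = 1 := by
      rw [← Finset.prod_mul_distrib]
      exact Finset.prod_eq_one fun i _ => by rw [mul_comm, mon_mul_monInv]
    rw [hmat, Matrix.det_mul_row, hdet, Finset.prod_update_of_mem (Finset.mem_univ j),
      Algebra.smul_def]
    have hc : algebraMap ℂ (functionField w I) (Φ.w0 / K) * algebraMap ℂ _ (Φ.w0⁻¹ * K) = 1 := by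
      rw [← map_mul, ← map_one (algebraMap ℂ (functionField w I))]
      congr 1
      have := Φ.w0_ne_zero
      field_simp
    set c := algebraMap ℂ (functionField w I) (Φ.w0 / K)
    set c' := algebraMap ℂ (functionField w I) (Φ.w0⁻¹ * K)
    linear_combination -h * (y' * y * c * c') * hprod - h * (c * c') * hy' - h * hc

/-- Regular multiples of the form dual to the derivations `(1/w₀) xᵢ ∂/∂xᵢ`. -/
lemma mem_detSpan_iff [𝔭.IsPrime] (h1 : 𝔭.height = 1) (h0 : Φ.x none ∉ 𝔭)
    {h : functionField w I} : h ∈ detSpan Φ.der (localRing w I 𝔭) ↔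
      (h : FracField I) * (∏ i, Φ.xK (some i))⁻¹ ∈ twistStalk w I 𝔭 (-∑ i, Φ.deg (some i)) := by
  refine ⟨Φ.detSpan_le h0, fun hh => ?_⟩
  by_cases hx : ∃ j, Φ.x (some j) ∈ 𝔭
  · obtain ⟨j, hj⟩ := hx
    exact Φ.mem_detSpan_of_mem h1 h0 hj hh
  · exact Φ.mem_detSpan_of_units h0 (not_exists.1 hx) hh

end Chart

/-! ### Change of charts -/

/-- The Jacobian determinant of dehomogenized coordinates in terms of the homogeneous one: bordering
by the Euler relation `hL` turns both sides into determinants of block triangular products. -/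
lemma det_dehomogenize {K τ : Type} [Field K] [Fintype τ] [DecidableEq τ]
    (L : Matrix (Unit ⊕ τ) (Unit ⊕ τ) K) (M : Matrix τ τ K) (a b : Unit ⊕ τ → K)
    (hL : ∀ k, ∑ i, a i * L i k = b k)
    (hM : ∀ i k, a (.inl ()) * M i k =
      b (.inl ()) * L (.inr i) (.inr k) - b (.inr k) * L (.inr i) (.inl ())) :
    a (.inl ()) * L.det * b (.inl ()) ^ Fintype.card τ =
      b (.inl ()) * (a (.inl ()) ^ Fintype.card τ * M.det) := by
  have hA : (Matrix.fromBlocks (Matrix.of fun _ _ : Unit => a (.inl ()))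
      (Matrix.of fun (_ : Unit) i => a (.inr i)) 0 (1 : Matrix τ τ K)).det = a (.inl ()) := by
    rw [Matrix.det_fromBlocks_zero₂₁, Matrix.det_one, mul_one, Matrix.det_unique, Matrix.of_apply]
  have hB : (Matrix.fromBlocks (1 : Matrix Unit Unit K)
      (Matrix.of fun (_ : Unit) k => -b (.inr k)) 0 (b (.inl ()) • (1 : Matrix τ τ K))).det =
      b (.inl ()) ^ Fintype.card τ := by
    rw [Matrix.det_fromBlocks_zero₂₁, Matrix.det_one, one_mul, Matrix.det_smul, Matrix.det_one,
      mul_one]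
  have hC : (Matrix.fromBlocks (Matrix.of fun _ _ : Unit => b (.inl ())) 0
      (Matrix.of fun i (_ : Unit) => L (.inr i) (.inl ())) (a (.inl ()) • M)).det =
      b (.inl ()) * (a (.inl ()) ^ Fintype.card τ * M.det) := by
    rw [Matrix.det_fromBlocks_zero₁₂, Matrix.det_unique, Matrix.of_apply, Matrix.det_smul]
  refine ((congrArg₂ (fun s t => s * L.det * t) hA hB).symm.trans ?_).trans hC
  rw [← Matrix.det_mul, ← Matrix.det_mul]
  congr 1
  have hL0 := hL (.inl ())
  simp only [Fintype.sum_sum_type, Finset.univ_unique, Finset.sum_singleton] at hL hL0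
  ext (i | i) (k | k)
  · simp [Matrix.mul_apply, Matrix.fromBlocks]
    exact hL0
  · have h1 := hL (.inr k)
    simp [Matrix.mul_apply, Matrix.fromBlocks, Matrix.one_apply]
    simp only [PUnit.default_eq_unit] at h1 hL0
    rw [h1, hL0]
    ring
  · simp [Matrix.mul_apply, Matrix.fromBlocks, Matrix.one_apply]
  · simp [Matrix.mul_apply, Matrix.fromBlocks, Matrix.one_apply]
    rw [hM]
    ring

/-- The first four coordinates of a chart, and the remaining ones. -/
def chartIndex (C : Type) : Fin 4 ⊕ C ≃ Unit ⊕ (Fin 3 ⊕ C) where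
  toFun := Sum.elim ![.inl (), .inr (.inl 0), .inr (.inl 1), .inr (.inl 2)] fun c => .inr (.inr c)
  invFun := Sum.elim (fun _ => .inl 0) (Sum.elim ![.inl 1, .inl 2, .inl 3] .inr)
  left_inv := by
    rintro (i | c)
    · fin_cases i <;> rfl
    · rfl
  right_inv := by
    rintro (i | i | c)
    · rfl
    · fin_cases i <;> rfl
    · rfl

namespace Chart

variable {σ : Type} {w : σ → ℤ} {I : Ideal (MvPolynomial σ ℂ)} [IsDomain (CoordRing I)]

variable {τ : Type} [Fintype τ] [DecidableEq τ] (Φ Ψ : Chart w I τ)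

/-- The derivations of one chart in terms of those of another. -/
lemma der_change (i : τ) (a : functionField w I) :
    Φ.der i a = ∑ k, (Φ.der i (Ψ.mon k) * Ψ.monInv k) * Ψ.der k a := by
  have h := congrArg (Φ.der i).liftKaehlerDifferential (Ψ.differential_eq a)
  rw [Derivation.liftKaehlerDifferential_comp_D, map_sum] at h
  rw [h]
  refine Finset.sum_congr rfl fun k _ => ?_
  rw [map_smul, map_smul, Derivation.liftKaehlerDifferential_comp_D, smul_eq_mul, smul_eq_mul]
  ring

variable {C : Type} [Fintype C] [DecidableEq C] (Φ Ψ : Chart w I (Fin 3 ⊕ C))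

/-- The first four coordinates of a chart. -/
def fourIndex (C : Type) : Fin 4 → Option (Fin 3 ⊕ C) :=
  ![none, some (.inl 0), some (.inl 1), some (.inl 2)]

/-- The logarithmic Jacobian matrix of the first four coordinates. -/
def logJacobian : Matrix (Fin 4) (Fin 4) (FracField I) :=
  Matrix.of fun i k =>
    Φ.theta (fourIndex C i) (Ψ.xK (fourIndex C k)) / Ψ.xK (fourIndex C k)

/-- For charts that differ only in the first four coordinates, the determinant that compares the
derivations is a multiple of the logarithmic Jacobian determinant of these coordinates. -/
lemma exists_det_der_change (hC : ∀ c, Φ.x (some (.inr c)) = Ψ.x (some (.inr c))) :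
    ∃ c : ℂ, c ≠ 0 ∧
      ((Matrix.of fun i k => Φ.der i (Ψ.mon k) * Ψ.monInv k).det : FracField I) =
        algebraMap ℂ _ c * (logJacobian Φ Ψ).det := by
  let ε : Unit ⊕ (Fin 3 ⊕ C) → Option (Fin 3 ⊕ C) := Sum.elim (fun _ => none) some
  let L : Matrix (Unit ⊕ (Fin 3 ⊕ C)) (Unit ⊕ (Fin 3 ⊕ C)) (FracField I) :=
    Matrix.of fun i k => Φ.theta (ε i) (Ψ.xK (ε k)) / Ψ.xK (ε k)
  have ha0 : (Φ.wt none : FracField I) ≠ 0 := Nat.cast_ne_zero.2 (Φ.wt_pos none).ne'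
  have hb0 : (Ψ.wt none : FracField I) ≠ 0 := Nat.cast_ne_zero.2 (Ψ.wt_pos none).ne'
  have h1 := det_dehomogenize L
    (Matrix.of fun i k => ((Φ.der i (Ψ.mon k) * Ψ.monInv k : functionField w I) : FracField I))
    (fun i => Φ.wt (ε i)) (fun k => Ψ.wt (ε k)) (fun k => ?_) (fun i k => ?_)
  · have hL : L.det = (logJacobian Φ Ψ).det := by
      rw [← Matrix.det_submatrix_equiv_self (chartIndex C) L]
      have : L.submatrix (chartIndex C) (chartIndex C) = Matrix.fromBlocks (logJacobian Φ Ψ) 0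
          (Matrix.of fun c k => L (.inr (.inr c)) (chartIndex C (.inl k))) 1 := by
        have hε : ∀ i, ε (chartIndex C (.inl i)) = fourIndex C i := by
          intro i; fin_cases i <;> rfl
        ext (i | i) (k | k)
        · simp only [Matrix.submatrix_apply, Matrix.fromBlocks_apply₁₁, logJacobian, L,
            Matrix.of_apply, hε]
        · have h2 : Φ.theta (fourIndex C i) (Ψ.xK (some (.inr k))) = 0 := by
            have : Ψ.xK (some (.inr k)) = Φ.xK (some (.inr k)) := by rw [xK, xK, hC]
            rw [this, theta_xK, if_neg]
            fin_cases i <;> simp [fourIndex]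
          simp only [Matrix.submatrix_apply, Matrix.fromBlocks_apply₁₂, L, Matrix.of_apply, hε]
          show Φ.theta (fourIndex C i) (Ψ.xK (some (.inr k))) / _ = 0
          rw [h2, zero_div]
        · rfl
        · have h2 : Ψ.xK (some (.inr k)) = Φ.xK (some (.inr k)) := by rw [xK, xK, hC]
          simp only [Matrix.submatrix_apply, Matrix.fromBlocks_apply₂₂]
          show Φ.theta (some (.inr i)) (Ψ.xK (some (.inr k))) / Ψ.xK (some (.inr k)) = _
          rw [h2, theta_xK, Matrix.one_apply]
          by_cases hik : i = k
          · subst hik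
            rw [if_pos rfl, if_pos rfl, div_self (Φ.xK_ne_zero _)]
          · rw [if_neg hik, if_neg (by simpa using hik), zero_div]
      rw [this, Matrix.det_fromBlocks_zero₁₂, Matrix.det_one, mul_one]
    rw [hL] at h1
    set n := Fintype.card (Fin 3 ⊕ C)
    refine ⟨Φ.w0 * Ψ.w0 ^ n * (Ψ.w0 * Φ.w0 ^ n)⁻¹, ?_, ?_⟩
    · have := Φ.w0_ne_zero
      have := Ψ.w0_ne_zero
      positivity
    · have h3 := RingHom.map_det (functionField w I).val.toRingHom
        (Matrix.of fun i k => Φ.der i (Ψ.mon k) * Ψ.monInv k)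
      refine h3.trans ?_
      rw [map_mul, map_inv₀, map_mul, map_mul, map_pow, map_pow, algebraMap_w0, algebraMap_w0]
      have hden : (Ψ.wt none : FracField I) * (Φ.wt none : FracField I) ^ n ≠ 0 :=
        mul_ne_zero hb0 (pow_ne_zero _ ha0)
      rw [mul_right_comm, ← div_eq_mul_inv, eq_div_iff hden]
      have h4 : (functionField w I).val.toRingHom.mapMatrix
          (Matrix.of fun i k => Φ.der i (Ψ.mon k) * Ψ.monInv k) = Matrix.of fun i k =>
          ((Φ.der i (Ψ.mon k) * Ψ.monInv k : functionField w I) : FracField I) := rfl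
      rw [h4]
      change (Φ.wt none : FracField I) * _ * (Ψ.wt none : FracField I) ^ n =
        (Ψ.wt none : FracField I) * ((Φ.wt none : FracField I) ^ n * _) at h1
      linear_combination -h1
  · have h2 := Φ.euler (twistStalk_of_piece (𝔭 := ⊥) (Ψ.mem (ε k)))
    have h3 : ∑ i, (Φ.wt (ε i) : FracField I) * Φ.theta (ε i) (Ψ.xK (ε k)) =
        (Ψ.wt (ε k) : FracField I) * Ψ.xK (ε k) := by
      rw [Fintype.sum_option] at h2
      rw [Fintype.sum_sum_type, Fintype.sum_unique]
      exact_mod_cast h2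
    simp only [L, Matrix.of_apply, ← mul_div_assoc]
    rw [← Finset.sum_div, h3, mul_div_cancel_right₀ _ (Ψ.xK_ne_zero _)]
  · have h2 : Φ.theta (some i) (Ψ.monK k) =
        ((Ψ.wt none : FracField I) * L (.inr i) (.inr k) -
          (Ψ.wt (some k) : FracField I) * L (.inr i) (.inl ())) * Ψ.monK k :=
      log_derivation _ (Ψ.xK_ne_zero _) (Ψ.xK_ne_zero _) _ _
    show (Φ.wt none : FracField I) * ((Φ.w0⁻¹ • Φ.theta (some i) (Ψ.monK k)) * (Ψ.monK k)⁻¹) = _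
    rw [h2, Algebra.smul_def, map_inv₀, algebraMap_w0]
    have := Ψ.monK_ne_zero k
    simp only [ε, Sum.elim_inl, Sum.elim_inr]
    field_simp

/-- Comparison of the regular forms in two charts that differ only in the first four
coordinates. -/
lemma mem_detSpan_change_chart (hC : ∀ c, Φ.x (some (.inr c)) = Ψ.x (some (.inr c)))
    (hJ : (logJacobian Φ Ψ).det ≠ 0) {𝔭 : Ideal (CoordRing I)} [𝔭.IsPrime] (h1 : 𝔭.height = 1)
    (h0 : Ψ.x none ∉ 𝔭) {h : functionField w I} :
    h ∈ detSpan Φ.der (localRing w I 𝔭) ↔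
      (h : FracField I) * (logJacobian Φ Ψ).det⁻¹ * (∏ i, Ψ.xK (some i))⁻¹ ∈
        twistStalk w I 𝔭 (-∑ i, Ψ.deg (some i)) := by
  obtain ⟨c, hc, hdet⟩ := exists_det_der_change Φ Ψ hC
  have hcK : algebraMap ℂ (FracField I) c ≠ 0 :=
    (map_ne_zero_iff _ (algebraMap ℂ (FracField I)).injective).2 hc
  set M : Matrix (Fin 3 ⊕ C) (Fin 3 ⊕ C) (functionField w I) :=
    Matrix.of fun i k => Φ.der i (Ψ.mon k) * Ψ.monInv k
  obtain ⟨T', hT'⟩ := exists_inverse_functionField M.det (by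
    intro h
    rw [h] at hdet
    exact mul_ne_zero hcK hJ hdet.symm)
  have hT'K : (T' : FracField I) = c⁻¹ • (logJacobian Φ Ψ).det⁻¹ := by
    have := congrArg Subtype.val hT'
    rw [Algebra.smul_def, map_inv₀, ← mul_inv, ← hdet]
    exact eq_inv_of_mul_eq_one_right this
  rw [mem_detSpan_change (Φ.der_change Ψ) hT', Ψ.mem_detSpan_iff h1 h0]
  have e : ((h * T' : functionField w I) : FracField I) * (∏ i, Ψ.xK (some i))⁻¹ =
      c⁻¹ • ((h : FracField I) * (logJacobian Φ Ψ).det⁻¹ * (∏ i, Ψ.xK (some i))⁻¹) := by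
    show (h : FracField I) * T' * _ = _
    rw [hT'K, mul_smul_comm, smul_mul_assoc]
  rw [e]
  constructor
  · intro hm
    have := twistStalk_smul c hm
    rwa [smul_inv_smul₀ hc] at this
  · exact twistStalk_smul _

end Chart

/-! ### The logarithmic Jacobian determinant -/

section LogJacobian

variable {K : Type} [Field K] [Algebra ℂ K] (x : Var → K)

/-- The values `u p₁, u p₂, u p₃, u p₄` as polynomials in the other coordinates. -/
def numer : Fin 4 → K :=
  ![x .r * (x .q2 * x .t3 - x .q3 * x .t2) - crs (qVec x) (sxVec x) 0,
    x .r * (x .q3 * x .t1 - x .q1 * x .t3) - crs (qVec x) (sxVec x) 1,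
    x .r * (x .q1 * x .t2 - x .q2 * x .t1) - crs (qVec x) (sxVec x) 2,
    -(x .r ^ 2 + dot (qVec x) (adjVec x))]

/-- The polynomials `numer`, and their partial derivatives with respect to `q₁`, `r` and `s₁₁`. -/
def numerJacobian : Matrix (Fin 4) (Fin 4) K :=
  Matrix.of ![numer x,
    ![-(x .q2 * (x .s33 * x .t2 - x .s23 * x .t3) - x .q3 * (x .s23 * x .t2 - x .s22 * x .t3)),
      -(x .r * x .t3) + (sxVec x 2 - x .q3 * (x .s13 * x .t2 - x .s12 * x .t3) +
        x .q1 * (x .s33 * x .t2 - x .s23 * x .t3)),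
      x .r * x .t2 - (sxVec x 1 + x .q1 * (x .s23 * x .t2 - x .s22 * x .t3) -
        x .q2 * (x .s13 * x .t2 - x .s12 * x .t3)),
      -2 * adjVec x 0],
    ![xVec x 0, xVec x 1, xVec x 2, -2 * x .r],
    ![0, -(x .q3 * xVec x 0), x .q2 * xVec x 0,
      -(x .q2 ^ 2 * x .s33 - 2 * x .q2 * x .q3 * x .s23 + x .q3 ^ 2 * x .s22)]]

/-- The determinant that makes the change of charts computable: it is a power of `u p₁`. -/
lemma det_numerJacobian : (numerJacobian x).det = -numer x 0 ^ 3 := by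
  simp [Matrix.det_succ_row_zero, Fin.sum_univ_succ, numerJacobian, numer, dot, adjVec, sxVec, sAct,
    xVec, crs, vec3, qVec, Fin.succAbove]
  ring

/-- The chain rule for a derivation that scales `q₁`, `r`, `s₁₁` and kills the other coordinates on
which `numer` depends. -/
lemma derivation_numer (D : Derivation ℂ K K) {a b c : K} (hq1 : D (x .q1) = a * x .q1)
    (hr : D (x .r) = b * x .r) (hs : D (x .s11) = c * x .s11)
    (h0 : ∀ v ∈ ({.q2, .q3, .s12, .s13, .s22, .s23, .s33, .t1, .t2, .t3} : Finset Var), D (x v) = 0)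
    (k : Fin 4) : D (numer x k) = a * x .q1 * numerJacobian x 1 k +
      b * x .r * numerJacobian x 2 k + c * x .s11 * numerJacobian x 3 k := by
  have q2 := h0 .q2 (by decide)
  have q3 := h0 .q3 (by decide)
  have s12 := h0 .s12 (by decide)
  have s13 := h0 .s13 (by decide)
  have s22 := h0 .s22 (by decide)
  have s23 := h0 .s23 (by decide)
  have s33 := h0 .s33 (by decide)
  have t1 := h0 .t1 (by decide)
  have t2 := h0 .t2 (by decide)
  have t3 := h0 .t3 (by decide)
  fin_cases k <;>
  · simp [numerJacobian, numer, dot, adjVec, sxVec, sAct, xVec, crs, vec3, qVec, q2, q3, s12, s13,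
      s22, s23, s33, t1, t2, t3, hq1, hr, hs]
    ring

/-- The determinant of the logarithmic derivatives of `p₁, …, p₄` along `u, q₁, r, s₁₁`. -/
lemma det_logJacobian (D : Fin 4 → Derivation ℂ K K)
    (hD : ∀ i, ∀ v ∉ ({.p1, .p2, .p3, .p4} : Finset Var),
      D i (x v) = if v = ![.u, .q1, .r, .s11] i then x v else 0)
    (hp : ∀ k, x .u * x (![.p1, .p2, .p3, .p4] k) = numer x k)
    (hx : ∀ v ∈ ({.u, .p1, .p2, .p3, .p4} : Finset Var), x v ≠ 0) :
    (Matrix.of fun i k => D i (x (![.p1, .p2, .p3, .p4] k)) / x (![.p1, .p2, .p3, .p4] k)).det =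
      x .q1 * x .r * x .s11 * x .p1 ^ 2 / (x .u * x .p2 * x .p3 * x .p4) := by
  have hu := hx .u (by decide)
  have h1 := hx .p1 (by decide)
  have h2 := hx .p2 (by decide)
  have h3 := hx .p3 (by decide)
  have h4 := hx .p4 (by decide)
  -- The derivation along `u` acts on `pₖ = numer k / u` by `-1`; the other three are given by the
  -- chain rule.
  let ρ : Fin 4 → K := ![-1, x .q1, x .r, x .s11]
  have hvars : ∀ i, ∀ v ∈ ({.q2, .q3, .s12, .s13, .s22, .s23, .s33, .t1, .t2, .t3} : Finset Var),
      v ∉ ({.p1, .p2, .p3, .p4} : Finset Var) ∧ v ≠ ![.u, .q1, .r, .s11] i := by decide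
  have hentry : ∀ i k, D i (x (![.p1, .p2, .p3, .p4] k)) / x (![.p1, .p2, .p3, .p4] k) =
      ρ i / x .u * ((x (![.p1, .p2, .p3, .p4] k))⁻¹ * numerJacobian x i k) := by
    intro i k
    have e := congrArg (D i) (hp k)
    rw [Derivation.leibniz, smul_eq_mul, smul_eq_mul, hD i .u (by decide)] at e
    have hi : ∀ v ∈ ({.q2, .q3, .s12, .s13, .s22, .s23, .s33, .t1, .t2, .t3} : Finset Var),
        D i (x v) = 0 := by
      intro v hv
      rw [hD i v (hvars i v hv).1, if_neg (hvars i v hv).2]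
    rw [derivation_numer x (D i) (a := if i = 1 then 1 else 0) (b := if i = 2 then 1 else 0)
      (c := if i = 3 then 1 else 0)
      (by rw [hD i .q1 (by decide)]; fin_cases i <;> simp)
      (by rw [hD i .r (by decide)]; fin_cases i <;> simp)
      (by rw [hD i .s11 (by decide)]; fin_cases i <;> simp) hi] at e
    have e' : x .u * D i (x (![.p1, .p2, .p3, .p4] k)) = ρ i * numerJacobian x i k := by
      fin_cases i
      · have h0 : numerJacobian x 0 k = numer x k := rfl
        simp [ρ] at e ⊢
        rw [h0, ← hp]
        linear_combination e
      all_goals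
        simp [ρ] at e ⊢
        linear_combination e
    rw [div_mul_eq_mul_div, div_eq_mul_inv, eq_div_iff hu]
    linear_combination (x (![.p1, .p2, .p3, .p4] k))⁻¹ * e'
  have hmat : (Matrix.of fun i k => D i (x (![.p1, .p2, .p3, .p4] k)) /
      x (![.p1, .p2, .p3, .p4] k)) = Matrix.of fun i k => ρ i / x .u *
        (Matrix.of fun i k => (x (![.p1, .p2, .p3, .p4] k))⁻¹ * numerJacobian x i k) i k := by
    ext i k
    exact hentry i k
  rw [hmat, Matrix.det_mul_column, Matrix.det_mul_row, det_numerJacobian, ← hp 0]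
  simp [Fin.prod_univ_succ, ρ]
  field_simp

end LogJacobian

/-! ### Construction of charts -/

section ChartConstruction

variable {σ τ : Type} {w : σ → ℤ} {I : Ideal (MvPolynomial σ ℂ)}

/-- The elements that become polynomials in `z` after multiplication by a power of the first
coordinate. -/
def numeratorAlgebra {R : Type} [CommRing R] [Algebra ℂ R] (z : Option τ → R) : Subalgebra ℂ R where
  carrier := {a | ∃ (N : ℕ) (F : MvPolynomial (Option τ) ℂ), z none ^ N * a = aeval z F}
  mul_mem' := by
    rintro a b ⟨N, F, hF⟩ ⟨M, G, hG⟩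
    refine ⟨N + M, F * G, ?_⟩
    rw [map_mul, ← hF, ← hG]
    ring
  add_mem' := by
    rintro a b ⟨N, F, hF⟩ ⟨M, G, hG⟩
    refine ⟨N + M, X none ^ M * F + X none ^ N * G, ?_⟩
    simp only [map_mul, map_add, map_pow, aeval_X, ← hF, ← hG]
    ring
  algebraMap_mem' := fun c => ⟨0, C c, by simp⟩

lemma mem_numeratorAlgebra {R : Type} [CommRing R] [Algebra ℂ R] (z : Option τ → R) (i : Option τ) :
    z i ∈ numeratorAlgebra z :=
  ⟨0, X i, by simp⟩

lemma mem_numeratorAlgebra_of_mul {R : Type} [CommRing R] [Algebra ℂ R] (z : Option τ → R) {a : R}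
    (h : z none * a ∈ numeratorAlgebra z) : a ∈ numeratorAlgebra z := by
  obtain ⟨N, F, hF⟩ := h
  exact ⟨N + 1, F, by rw [← hF]; ring⟩

/-- Elements are algebraically independent if they take arbitrary values at points where the first
of them does not vanish. -/
lemma injective_aeval_of_points {R : Type} [CommRing R] [Algebra ℂ R] {z : Option τ → R}
    (h : ∀ a : Option τ → ℂ, a none ≠ 0 → ∃ ε : R →ₐ[ℂ] ℂ, ∀ i, ε (z i) = a i) :
    Function.Injective (aeval z : MvPolynomial (Option τ) ℂ →ₐ[ℂ] R) := by
  rw [injective_iff_map_eq_zero]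
  intro F hF
  have : X none * F = 0 := by
    apply MvPolynomial.funext
    intro a
    rw [map_mul, eval_X, map_zero]
    by_cases ha : a none = 0
    · rw [ha, zero_mul]
    · obtain ⟨ε, hε⟩ := h a ha
      have e := congrArg ε hF
      rw [map_zero, comp_aeval_apply] at e
      have : (fun i => ε (z i)) = a := funext hε
      change aeval (fun i => ε (z i)) F = 0 at e
      rw [this] at e
      rw [← coe_aeval_eq_eval]
      show a none * aeval a F = 0
      rw [e, mul_zero]
  exact (mul_eq_zero.1 this).resolve_left (X_ne_zero _)

lemma weightedHomogeneousComponent_aeval {ι : Type} {ξ : ι → MvPolynomial σ ℂ} {d : ι → ℤ}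
    (hξ : ∀ i, IsWeightedHomogeneous w (ξ i) (d i)) (F : MvPolynomial ι ℂ) (n : ℤ) :
    weightedHomogeneousComponent w n (aeval ξ F) =
      aeval ξ (weightedHomogeneousComponent d n F) := by
  induction F using MvPolynomial.induction_on' with
  | add p q hp hq => simp only [map_add, hp, hq]
  | monomial e c =>
    have h1 : IsWeightedHomogeneous w (aeval ξ (monomial e c)) (Finsupp.weight d e) := by
      rw [aeval_monomial, ← Algebra.smul_def]
      refine (weightedHomogeneousSubmodule ℂ w _).smul_mem c ?_
      rw [Finsupp.weight_apply, Finsupp.prod, Finsupp.sum]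
      exact IsWeightedHomogeneous.prod _ _ _ fun i _ => (hξ i).pow _
    rw [weightedHomogeneousComponent_of_mem h1,
      weightedHomogeneousComponent_of_mem (isWeightedHomogeneous_monomial d e c rfl)]
    split_ifs <;> simp

attribute [local instance] MvPolynomial.weightedGradedAlgebra

lemma weightedHomogeneousComponent_mem_span {ι : Type} {e : ι → MvPolynomial σ ℂ}
    (he : ∀ i, ∃ n : ℤ, IsWeightedHomogeneous w (e i) n) {f : MvPolynomial σ ℂ}
    (hf : f ∈ Ideal.span (Set.range e)) (n : ℤ) :
    weightedHomogeneousComponent w n f ∈ Ideal.span (Set.range e) := by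
  refine weightedHomogeneousComponent_mem_of_mem ℂ w ?_ hf n
  refine Ideal.homogeneous_span _ _ ?_
  rintro _ ⟨i, rfl⟩
  exact he i

/-- A chart from homogeneous polynomials that are algebraically independent modulo the homogeneous
ideal `I` and generate everything after inverting the first of them. -/
def Chart.mk' (hI : ∀ f ∈ I, ∀ n, weightedHomogeneousComponent w n f ∈ I)
    (ξ : Option τ → MvPolynomial σ ℂ) (d : Option τ → ℤ) (hd : ∀ i, 0 < d i)
    (hξ : ∀ i, IsWeightedHomogeneous w (ξ i) (d i))
    (inj : Function.Injective (aeval (fun i => Ideal.Quotient.mk I (ξ i)) :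
      MvPolynomial (Option τ) ℂ →ₐ[ℂ] CoordRing I))
    (surj : numeratorAlgebra (fun i => Ideal.Quotient.mk I (ξ i)) = ⊤) : Chart w I τ where
  x i := Ideal.Quotient.mk I (ξ i)
  wt i := (d i).toNat
  wt_pos i := by have := hd i; omega
  mem i := ⟨ξ i, by rw [Int.toNat_of_nonneg (hd i).le]; exact hξ i, rfl⟩
  inj := inj
  surj a := by
    have : a ∈ numeratorAlgebra (fun i => Ideal.Quotient.mk I (ξ i)) := by rw [surj]; trivial
    exact this
  surj_hom := by
    rintro n _ ⟨f, hf, rfl⟩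
    have : Ideal.Quotient.mk I f ∈ numeratorAlgebra (fun i => Ideal.Quotient.mk I (ξ i)) := by
      rw [surj]; trivial
    obtain ⟨N, F, hF⟩ := this
    simp only [Int.toNat_of_nonneg (hd _).le]
    refine ⟨N, weightedHomogeneousComponent d (N * d none + n) F,
      weightedHomogeneousComponent_isWeightedHomogeneous _ _, ?_⟩
    have hmap : ∀ G : MvPolynomial (Option τ) ℂ,
        aeval (fun i => Ideal.Quotient.mk I (ξ i)) G = Ideal.Quotient.mk I (aeval ξ G) :=
      fun G => (comp_aeval_apply ξ (Ideal.Quotient.mkₐ ℂ I) G).symm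
    show Ideal.Quotient.mk I (ξ none) ^ N * Ideal.Quotient.mk I f = _
    rw [hmap, ← map_pow, ← map_mul] at hF ⊢
    rw [Ideal.Quotient.eq] at hF ⊢
    have h2 := hI _ hF (N * d none + n)
    have h3 : IsWeightedHomogeneous w (ξ none ^ N * f) (N * d none + n) := by
      have := ((hξ none).pow N).mul hf
      rwa [nsmul_eq_mul] at this
    rwa [map_sub, weightedHomogeneousComponent_of_mem h3, if_pos rfl,
      weightedHomogeneousComponent_aeval hξ] at h2

end ChartConstruction

/-! ### Solving the equations -/

section Solving

variable {K : Type} [CommRing K] [IsDomain K] (x : Var → K)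

/-- Where `u ≠ 0`, the last four equations imply the others. -/
lemma equations_eq_zero_of_u (hu : x .u ≠ 0) (hl : ∀ i, lastEq x i = 0) (hn : normEq x = 0)
    (i : Fin 9) : equations x i = 0 := by
  have h0 := hl 0
  have h1 := hl 1
  have h2 := hl 2
  -- Each identity below is a syzygy with the coefficient `u` at the equation in question.
  have e0 : dot (pVec x) (qVec x) = 0 := by
    refine (mul_eq_zero.1 (?_ : x .u * _ = 0)).resolve_left hu
    have : x .u * dot (pVec x) (qVec x) = dot (qVec x) (lastEq x) := by
      simp [dot, lastEq, crs, vec3, pVec, qVec, xVec]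
      ring
    rw [this, dot, h0, h1, h2]
    ring
  have em : ∀ c : Fin 3 → K, dot c (midEq x) = 0 := by
    intro c
    refine (mul_eq_zero.1 (?_ : x .u * _ = 0)).resolve_left hu
    have : x .u * dot c (midEq x) = dot (x .r • c + sAct x (crs c (qVec x))) (lastEq x) +
        dot (xVec x) c * normEq x := by
      simp [dot, lastEq, normEq, midEq, adjVec, sAct, crs, vec3, pVec, qVec, tVec, xVec, vVec, spVec,
        sxVec]
      ring
    rw [this, dot, h0, h1, h2, hn]
    ring
  have e4 : dot (pVec x) (vVec x) = 0 := by
    refine (mul_eq_zero.1 (?_ : x .u * _ = 0)).resolve_left hu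
    have : x .u * dot (pVec x) (vVec x) = dot (sxVec x) (midEq x) + dot (vVec x) (lastEq x) := by
      simp [dot, lastEq, midEq, sAct, crs, vec3, pVec, qVec, tVec, xVec, vVec, spVec, sxVec]
      ring
    rw [this, em, dot, h0, h1, h2]
    ring
  have m0 : midEq x 0 = 0 := by simpa [dot, vec3] using em (vec3 1 0 0)
  have m1 : midEq x 1 = 0 := by simpa [dot, vec3] using em (vec3 0 1 0)
  have m2 : midEq x 2 = 0 := by simpa [dot, vec3] using em (vec3 0 0 1)
  rw [equations_eq_pack9]
  fin_cases i <;> assumption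

/-- Where `p₁ ≠ 0`, four of the equations imply the others. -/
lemma equations_eq_zero_of_p1 (hp : x .p1 ≠ 0) (h0 : dot (pVec x) (qVec x) = 0)
    (hm : midEq x 0 = 0) (h4 : dot (pVec x) (vVec x) = 0) (hl : lastEq x 0 = 0)
    (i : Fin 9) : equations x i = 0 := by
  -- Each identity below is a syzygy with the coefficient `p₁` at the equation in question.
  have m1 : midEq x 1 = 0 := by
    refine (mul_eq_zero.1 (?_ : x .p1 * _ = 0)).resolve_left hp
    have : x .p1 * midEq x 1 = x .p2 * midEq x 0 + qVec x 2 * dot (pVec x) (vVec x) -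
        vVec x 2 * dot (pVec x) (qVec x) := by
      simp [dot, midEq, crs, vec3, pVec, qVec]
      ring
    rw [this, h0, hm, h4]
    ring
  have m2 : midEq x 2 = 0 := by
    refine (mul_eq_zero.1 (?_ : x .p1 * _ = 0)).resolve_left hp
    have : x .p1 * midEq x 2 = x .p3 * midEq x 0 - qVec x 1 * dot (pVec x) (vVec x) +
        vVec x 1 * dot (pVec x) (qVec x) := by
      simp [dot, midEq, crs, vec3, pVec, qVec]
      ring
    rw [this, h0, hm, h4]
    ring
  have l1 : lastEq x 1 = 0 := by
    refine (mul_eq_zero.1 (?_ : x .p1 * _ = 0)).resolve_left hp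
    have : x .p1 * lastEq x 1 = x .p2 * lastEq x 0 - sxVec x 2 * dot (pVec x) (qVec x) -
        (xVec x 1 * midEq x 0 - xVec x 0 * midEq x 1) := by
      simp [dot, midEq, lastEq, crs, vec3, pVec, qVec, tVec, sAct, xVec, vVec, spVec, sxVec]
      ring
    rw [this, h0, hm, hl, m1]
    ring
  have l2 : lastEq x 2 = 0 := by
    refine (mul_eq_zero.1 (?_ : x .p1 * _ = 0)).resolve_left hp
    have : x .p1 * lastEq x 2 = x .p3 * lastEq x 0 + sxVec x 1 * dot (pVec x) (qVec x) +
        (xVec x 0 * midEq x 2 - xVec x 2 * midEq x 0) := by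
      simp [dot, midEq, lastEq, crs, vec3, pVec, qVec, tVec, sAct, xVec, vVec, spVec, sxVec]
      ring
    rw [this, h0, hm, hl, m2]
    ring
  have hn : normEq x = 0 := by
    refine (mul_eq_zero.1 (?_ : x .p1 * _ = 0)).resolve_left hp
    have : x .p1 * normEq x = adjVec x 0 * dot (pVec x) (qVec x) + x .p4 * lastEq x 0 -
        dot (sAct x (crs (vec3 1 0 0) (qVec x))) (midEq x) + x .r * midEq x 0 := by
      simp [dot, midEq, lastEq, normEq, adjVec, crs, vec3, pVec, qVec, tVec, sAct, xVec, vVec, spVec,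
        sxVec]
      ring
    rw [this, h0, hm, hl, dot, hm, m1, m2]
    ring
  rw [equations_eq_pack9]
  fin_cases i <;> assumption

end Solving

/-! ### The two charts of the key variety -/

/-- The coordinates shared by the two charts. -/
def commonVars : Finset Var := {.q2, .q3, .s12, .s13, .s22, .s23, .s33, .t1, .t2, .t3}

/-- The coordinates of `Σ¹⁴`, or of its hyperplane section `s₃₃ = 1`, in the polynomial ring that
presents the coordinate ring; `cs` are the common variables of the charts that are not
constant. -/
structure KeyCoords {σ : Type} (w : σ → ℤ) (I : Ideal (MvPolynomial σ ℂ))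
    (x : Var → MvPolynomial σ ℂ) (W : Var → ℤ) (cs : Finset Var) : Prop where
  graded : GradedCoords w x W
  pos : ∀ v, v ≠ .s33 ∨ .s33 ∈ cs → 0 < W v
  ideal_eq : I = Ideal.span (Set.range (equations x))
  hom : ∀ i, ∃ n : ℤ, IsWeightedHomogeneous w (equations x i) n
  subset : cs ⊆ commonVars
  mem_or : ∀ v ∈ commonVars, v ∈ cs ∨ (v = .s33 ∧ x v = 1)
  adjoin : Algebra.adjoin ℂ (Set.range x) = ⊤
  point : ∀ v : Var → ℂ, .s33 ∈ cs ∨ v .s33 = 1 →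
    ∃ ε : MvPolynomial σ ℂ →ₐ[ℂ] ℂ, ∀ z, ε (x z) = v z
  nz_u : NZ I (x .u)
  nz_p1 : NZ (I ⊔ Ideal.span {x .u}) (x .p1)

/-- The coordinates of the chart `u ≠ 0`. -/
def uVars {cs : Finset Var} : Option (Fin 3 ⊕ cs) → Var
  | none => .u
  | some (.inl i) => ![.q1, .r, .s11] i
  | some (.inr c) => c

/-- The coordinates of the chart `p₁ ≠ 0`. -/
def pVars {cs : Finset Var} : Option (Fin 3 ⊕ cs) → Var
  | none => .p1
  | some (.inl i) => ![.p2, .p3, .p4] i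
  | some (.inr c) => c

namespace KeyCoords

variable {σ : Type} {w : σ → ℤ} {I : Ideal (MvPolynomial σ ℂ)} {x : Var → MvPolynomial σ ℂ}
  {W : Var → ℤ} {cs : Finset Var}

lemma homogeneous (H : KeyCoords w I x W cs) (f : MvPolynomial σ ℂ) (hf : f ∈ I) (n : ℤ) :
    weightedHomogeneousComponent w n f ∈ I := by
  have h := H.ideal_eq
  subst h
  exact weightedHomogeneousComponent_mem_span H.hom hf n

lemma equations_mk (H : KeyCoords w I x W cs) (i : Fin 9) :
    equations (fun v => Ideal.Quotient.mk I (x v)) i = 0 := by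
  rw [← map_equations, Ideal.Quotient.eq_zero_iff_mem, H.ideal_eq]
  exact Ideal.subset_span ⟨i, rfl⟩

lemma exists_point (H : KeyCoords w I x W cs) (v : Var → ℂ) (hv : .s33 ∈ cs ∨ v .s33 = 1)
    (he : ∀ i, equations v i = 0) :
    ∃ ε : CoordRing I →ₐ[ℂ] ℂ, ∀ z, ε (Ideal.Quotient.mk I (x z)) = v z := by
  obtain ⟨ε, hε⟩ := H.point v hv
  refine ⟨Ideal.Quotient.liftₐ I ε fun a ha => ?_, fun z => ?_⟩
  · rw [H.ideal_eq] at ha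
    have : Ideal.span (Set.range (equations x)) ≤ RingHom.ker ε.toRingHom := by
      rw [Ideal.span_le]
      rintro _ ⟨i, rfl⟩
      show ε.toRingHom _ = 0
      rw [map_equations]
      have : (fun z => ε.toRingHom (x z)) = v := funext hε
      rw [this, he]
    exact this ha
  · exact hε z

lemma eq_top (H : KeyCoords w I x W cs) (A : Subalgebra ℂ (CoordRing I))
    (hA : ∀ v, Ideal.Quotient.mk I (x v) ∈ A) : A = ⊤ := by
  have h1 : Algebra.adjoin ℂ (Set.range x) ≤ A.comap (Ideal.Quotient.mkₐ ℂ I) := by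
    rw [Algebra.adjoin_le_iff]
    rintro _ ⟨v, rfl⟩
    exact hA v
  rw [H.adjoin] at h1
  rw [eq_top_iff]
  rintro a -
  obtain ⟨f, rfl⟩ := Ideal.Quotient.mk_surjective a
  exact h1 (Algebra.mem_top (x := f))

/-- Given coordinates extended by the constant `s₃₃ = 1` when that is not one of them. -/
def extendPoint (b : cs → ℂ) (v : Var) : ℂ := if h : v ∈ cs then b ⟨v, h⟩ else 1

lemma common_mem (H : KeyCoords w I x W cs) {A : Subalgebra ℂ (CoordRing I)}
    (hA : ∀ c : cs, Ideal.Quotient.mk I (x c) ∈ A) {v : Var} (hv : v ∈ commonVars) :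
    Ideal.Quotient.mk I (x v) ∈ A := by
  rcases H.mem_or v hv with h | ⟨-, h⟩
  · exact hA ⟨v, h⟩
  · rw [h, map_one]; exact one_mem A

/-! #### The chart `u ≠ 0` -/

lemma injective_u (H : KeyCoords w I x W cs) :
    Function.Injective (aeval (fun i : Option (Fin 3 ⊕ cs) => Ideal.Quotient.mk I (x (uVars i))) :
      MvPolynomial (Option (Fin 3 ⊕ cs)) ℂ →ₐ[ℂ] CoordRing I) := by
  refine injective_aeval_of_points fun a ha => ?_
  -- The last four equations determine `p₁, …, p₄` from the values of the chart coordinates.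
  let b : Var → ℂ
    | .u => a none
    | .q1 => a (some (.inl 0))
    | .r => a (some (.inl 1))
    | .s11 => a (some (.inl 2))
    | v => extendPoint (fun c => a (some (.inr c))) v
  let v : Var → ℂ
    | .p1 => numer b 0 / a none
    | .p2 => numer b 1 / a none
    | .p3 => numer b 2 / a none
    | .p4 => numer b 3 / a none
    | z => b z
  suffices h : (∃ ε : CoordRing I →ₐ[ℂ] ℂ, ∀ z, ε (Ideal.Quotient.mk I (x z)) = v z) by
    obtain ⟨ε, hε⟩ := h
    refine ⟨ε, fun i => ?_⟩
    rw [hε]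
    match i with
    | none => rfl
    | some (.inl 0) => rfl
    | some (.inl 1) => rfl
    | some (.inl 2) => rfl
    | some (.inr ⟨c, hc⟩) =>
      have h1 : c ∈ commonVars := H.subset hc
      have h2 : v c = extendPoint (fun c => a (some (.inr c))) c := by
        cases c <;> first | rfl | exact absurd h1 (by decide)
      rw [uVars, h2, extendPoint, dif_pos hc]
  refine H.exists_point v ?_ (equations_eq_zero_of_u v ha ?_ ?_)
  · by_cases h : .s33 ∈ cs
    · exact Or.inl h
    · refine Or.inr ?_
      show extendPoint _ _ = 1
      rw [extendPoint, dif_neg h]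
  · intro i
    have e1 : a none * v .p1 = numer b 0 := mul_div_cancel₀ _ ha
    have e2 : a none * v .p2 = numer b 1 := mul_div_cancel₀ _ ha
    have e3 : a none * v .p3 = numer b 2 := mul_div_cancel₀ _ ha
    match i with
    | 0 =>
      show a none * v .p1 - v .r * xVec v 0 + crs (qVec v) (sxVec v) 0 = 0
      rw [e1]
      show v .r * xVec v 0 - crs (qVec v) (sxVec v) 0 - v .r * xVec v 0 +
        crs (qVec v) (sxVec v) 0 = 0
      ring
    | 1 =>
      show a none * v .p2 - v .r * xVec v 1 + crs (qVec v) (sxVec v) 1 = 0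
      rw [e2]
      show v .r * xVec v 1 - crs (qVec v) (sxVec v) 1 - v .r * xVec v 1 +
        crs (qVec v) (sxVec v) 1 = 0
      ring
    | 2 =>
      show a none * v .p3 - v .r * xVec v 2 + crs (qVec v) (sxVec v) 2 = 0
      rw [e3]
      show v .r * xVec v 2 - crs (qVec v) (sxVec v) 2 - v .r * xVec v 2 +
        crs (qVec v) (sxVec v) 2 = 0
      ring
  · have e4 : a none * v .p4 = numer b 3 := mul_div_cancel₀ _ ha
    show a none * v .p4 + (v .r ^ 2 + dot (qVec v) (adjVec v)) = 0
    rw [e4]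
    show -(v .r ^ 2 + dot (qVec v) (adjVec v)) + (v .r ^ 2 + dot (qVec v) (adjVec v)) = 0
    ring

lemma numeratorAlgebra_u (H : KeyCoords w I x W cs) :
    numeratorAlgebra (fun i : Option (Fin 3 ⊕ cs) => Ideal.Quotient.mk I (x (uVars i))) = ⊤ := by
  set z : Option (Fin 3 ⊕ cs) → CoordRing I := fun i => Ideal.Quotient.mk I (x (uVars i)) with hz
  set y : Var → CoordRing I := fun v => Ideal.Quotient.mk I (x v) with hy
  set A := numeratorAlgebra z
  have hmul : ∀ a, y .u * a ∈ A → a ∈ A := fun a h => mem_numeratorAlgebra_of_mul z h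
  have hu : y .u ∈ A := mem_numeratorAlgebra z none
  have hq1 : y .q1 ∈ A := mem_numeratorAlgebra z (some (.inl 0))
  have hr : y .r ∈ A := mem_numeratorAlgebra z (some (.inl 1))
  have hs11 : y .s11 ∈ A := mem_numeratorAlgebra z (some (.inl 2))
  have hc : ∀ {v}, v ∈ commonVars → y v ∈ A :=
    fun hv => H.common_mem (fun c => mem_numeratorAlgebra z (some (.inr c))) hv
  have hq2 : y .q2 ∈ A := hc (by decide)
  have hq3 : y .q3 ∈ A := hc (by decide)
  have hs12 : y .s12 ∈ A := hc (by decide)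
  have hs13 : y .s13 ∈ A := hc (by decide)
  have hs22 : y .s22 ∈ A := hc (by decide)
  have hs23 : y .s23 ∈ A := hc (by decide)
  have hs33 : y .s33 ∈ A := hc (by decide)
  have ht1 : y .t1 ∈ A := hc (by decide)
  have ht2 : y .t2 ∈ A := hc (by decide)
  have ht3 : y .t3 ∈ A := hc (by decide)
  have he := H.equations_mk
  rw [equations_eq_pack9] at he
  have h5 : y .u * y .p1 - y .r * xVec y 0 +
      (y .q2 * sxVec y 2 - y .q3 * sxVec y 1) = 0 := he 5
  have h6 : y .u * y .p2 - y .r * xVec y 1 +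
      (y .q3 * sxVec y 0 - y .q1 * sxVec y 2) = 0 := he 6
  have h7 : y .u * y .p3 - y .r * xVec y 2 +
      (y .q1 * sxVec y 1 - y .q2 * sxVec y 0) = 0 := he 7
  have h8 : y .u * y .p4 + (y .r ^ 2 + dot (qVec y) (adjVec y)) = 0 := he 8
  have hx : ∀ i, xVec y i ∈ A := by
    intro i
    match i with
    | 0 => exact sub_mem (mul_mem hq2 ht3) (mul_mem hq3 ht2)
    | 1 => exact sub_mem (mul_mem hq3 ht1) (mul_mem hq1 ht3)
    | 2 => exact sub_mem (mul_mem hq1 ht2) (mul_mem hq2 ht1)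
  have hsx : ∀ i, sxVec y i ∈ A := by
    intro i
    match i with
    | 0 => exact add_mem (add_mem (mul_mem hs11 (hx 0)) (mul_mem hs12 (hx 1))) (mul_mem hs13 (hx 2))
    | 1 => exact add_mem (add_mem (mul_mem hs12 (hx 0)) (mul_mem hs22 (hx 1))) (mul_mem hs23 (hx 2))
    | 2 => exact add_mem (add_mem (mul_mem hs13 (hx 0)) (mul_mem hs23 (hx 1))) (mul_mem hs33 (hx 2))
  have hp1 : y .p1 ∈ A := hmul _ (by
    rw [show y .u * y .p1 = y .r * xVec y 0 - (y .q2 * sxVec y 2 - y .q3 * sxVec y 1) from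
      by linear_combination h5]
    exact sub_mem (mul_mem hr (hx 0)) (sub_mem (mul_mem hq2 (hsx 2)) (mul_mem hq3 (hsx 1))))
  have hp2 : y .p2 ∈ A := hmul _ (by
    rw [show y .u * y .p2 = y .r * xVec y 1 - (y .q3 * sxVec y 0 - y .q1 * sxVec y 2) from
      by linear_combination h6]
    exact sub_mem (mul_mem hr (hx 1)) (sub_mem (mul_mem hq3 (hsx 0)) (mul_mem hq1 (hsx 2))))
  have hp3 : y .p3 ∈ A := hmul _ (by
    rw [show y .u * y .p3 = y .r * xVec y 2 - (y .q1 * sxVec y 1 - y .q2 * sxVec y 0) from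
      by linear_combination h7]
    exact sub_mem (mul_mem hr (hx 2)) (sub_mem (mul_mem hq1 (hsx 1)) (mul_mem hq2 (hsx 0))))
  have hadj : ∀ i, adjVec y i ∈ A := by
    intro i
    match i with
    | 0 =>
      exact add_mem (add_mem (mul_mem hq1 (sub_mem (mul_mem hs22 hs33) (mul_mem hs23 hs23)))
        (mul_mem hq2 (sub_mem (mul_mem hs13 hs23) (mul_mem hs12 hs33))))
        (mul_mem hq3 (sub_mem (mul_mem hs12 hs23) (mul_mem hs13 hs22)))
    | 1 =>
      exact add_mem (add_mem (mul_mem hq1 (sub_mem (mul_mem hs13 hs23) (mul_mem hs12 hs33)))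
        (mul_mem hq2 (sub_mem (mul_mem hs11 hs33) (mul_mem hs13 hs13))))
        (mul_mem hq3 (sub_mem (mul_mem hs12 hs13) (mul_mem hs11 hs23)))
    | 2 =>
      exact add_mem (add_mem (mul_mem hq1 (sub_mem (mul_mem hs12 hs23) (mul_mem hs13 hs22)))
        (mul_mem hq2 (sub_mem (mul_mem hs12 hs13) (mul_mem hs11 hs23))))
        (mul_mem hq3 (sub_mem (mul_mem hs11 hs22) (mul_mem hs12 hs12)))
  have hp4 : y .p4 ∈ A := hmul _ (by
    rw [eq_neg_of_add_eq_zero_left h8]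
    exact neg_mem (add_mem (pow_mem hr 2) (add_mem (add_mem (mul_mem hq1 (hadj 0))
      (mul_mem hq2 (hadj 1))) (mul_mem hq3 (hadj 2)))))
  refine H.eq_top A fun v => ?_
  cases v
  exacts [hp1, hp2, hp3, hp4, hq1, hq2, hq3, hr, hu, hs11, hs12, hs13, hs22, hs23, hs33, ht1, ht2,
    ht3]

/-! #### The chart `p₁ ≠ 0` -/

lemma injective_p (H : KeyCoords w I x W cs) :
    Function.Injective (aeval (fun i : Option (Fin 3 ⊕ cs) => Ideal.Quotient.mk I (x (pVars i))) :
      MvPolynomial (Option (Fin 3 ⊕ cs)) ℂ →ₐ[ℂ] CoordRing I) := by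
  refine injective_aeval_of_points fun a ha => ?_
  -- Four of the equations successively determine `q₁`, `r`, `s₁₁` and `u` from the values of the chart
  -- coordinates; `b` agrees with the point `v` except at `r`, `s₁₁` and `u`.
  let b₀ : Var → ℂ
    | .p1 => a none
    | .p2 => a (some (.inl 0))
    | .p3 => a (some (.inl 1))
    | .p4 => a (some (.inl 2))
    | v => extendPoint (fun c => a (some (.inr c))) v
  let b : Var → ℂ
    | .q1 => -(b₀ .p2 * b₀ .q2 + b₀ .p3 * b₀ .q3) / a none
    | z => b₀ z
  let r : ℂ := -(b .q2 * vVec b 2 - b .q3 * vVec b 1) / a none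
  let v : Var → ℂ
    | .r => r
    | .s11 => -(b .s12 * b .p2 + b .s13 * b .p3 + b .p4 * b .t1 +
        (b .p2 * vVec b 1 + b .p3 * vVec b 2) / a none) / a none
    | .u => (r * xVec b 0 - (b .q2 * sxVec b 2 - b .q3 * sxVec b 1)) / a none
    | z => b z
  suffices h : (∃ ε : CoordRing I →ₐ[ℂ] ℂ, ∀ z, ε (Ideal.Quotient.mk I (x z)) = v z) by
    obtain ⟨ε, hε⟩ := h
    refine ⟨ε, fun i => ?_⟩
    rw [hε]
    match i with
    | none => rfl
    | some (.inl 0) => rfl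
    | some (.inl 1) => rfl
    | some (.inl 2) => rfl
    | some (.inr ⟨c, hc⟩) =>
      have h1 : c ∈ commonVars := H.subset hc
      have h2 : v c = extendPoint (fun c => a (some (.inr c))) c := by
        cases c <;> first | rfl | exact absurd h1 (by decide)
      rw [pVars, h2, extendPoint, dif_pos hc]
  refine H.exists_point v ?_ (equations_eq_zero_of_p1 v ha ?_ ?_ ?_ ?_)
  · by_cases h : .s33 ∈ cs
    · exact Or.inl h
    · refine Or.inr ?_
      show extendPoint _ _ = 1
      rw [extendPoint, dif_neg h]
  · show a none * (-(b .p2 * b .q2 + b .p3 * b .q3) / a none) + b .p2 * b .q2 + b .p3 * b .q3 = 0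
    rw [mul_div_cancel₀ _ ha]
    ring
  · show r * a none + (b .q2 * vVec b 2 - b .q3 * vVec b 1) = 0
    rw [show r = -(b .q2 * vVec b 2 - b .q3 * vVec b 1) / a none from rfl, div_mul_cancel₀ _ ha]
    ring
  · show a none * (-(b .s12 * b .p2 + b .s13 * b .p3 + b .p4 * b .t1 +
        (b .p2 * vVec b 1 + b .p3 * vVec b 2) / a none) / a none * a none + b .s12 * b .p2 +
        b .s13 * b .p3 + b .p4 * b .t1) + b .p2 * vVec b 1 + b .p3 * vVec b 2 = 0
    field_simp
    ring
  · show (r * xVec b 0 - (b .q2 * sxVec b 2 - b .q3 * sxVec b 1)) / a none * a none -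
      r * xVec b 0 + (b .q2 * sxVec b 2 - b .q3 * sxVec b 1) = 0
    rw [div_mul_cancel₀ _ ha]
    ring

lemma numeratorAlgebra_p (H : KeyCoords w I x W cs) :
    numeratorAlgebra (fun i : Option (Fin 3 ⊕ cs) => Ideal.Quotient.mk I (x (pVars i))) = ⊤ := by
  set z : Option (Fin 3 ⊕ cs) → CoordRing I := fun i => Ideal.Quotient.mk I (x (pVars i)) with hz
  set y : Var → CoordRing I := fun v => Ideal.Quotient.mk I (x v) with hy
  set A := numeratorAlgebra z
  have hmul : ∀ a, y .p1 * a ∈ A → a ∈ A := fun a h => mem_numeratorAlgebra_of_mul z h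
  have hp1 : y .p1 ∈ A := mem_numeratorAlgebra z none
  have hp2 : y .p2 ∈ A := mem_numeratorAlgebra z (some (.inl 0))
  have hp3 : y .p3 ∈ A := mem_numeratorAlgebra z (some (.inl 1))
  have hp4 : y .p4 ∈ A := mem_numeratorAlgebra z (some (.inl 2))
  have hc : ∀ {v}, v ∈ commonVars → y v ∈ A :=
    fun hv => H.common_mem (fun c => mem_numeratorAlgebra z (some (.inr c))) hv
  have hq2 : y .q2 ∈ A := hc (by decide)
  have hq3 : y .q3 ∈ A := hc (by decide)
  have hs12 : y .s12 ∈ A := hc (by decide)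
  have hs13 : y .s13 ∈ A := hc (by decide)
  have hs22 : y .s22 ∈ A := hc (by decide)
  have hs23 : y .s23 ∈ A := hc (by decide)
  have hs33 : y .s33 ∈ A := hc (by decide)
  have ht1 : y .t1 ∈ A := hc (by decide)
  have ht2 : y .t2 ∈ A := hc (by decide)
  have ht3 : y .t3 ∈ A := hc (by decide)
  have he := H.equations_mk
  rw [equations_eq_pack9] at he
  have h0 : y .p1 * y .q1 + y .p2 * y .q2 + y .p3 * y .q3 = 0 := he 0
  have h1 : y .r * y .p1 + (y .q2 * vVec y 2 - y .q3 * vVec y 1) = 0 := he 1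
  have h4 : y .p1 * (y .s11 * y .p1 + y .s12 * y .p2 + y .s13 * y .p3 + y .p4 * y .t1) +
      y .p2 * vVec y 1 + y .p3 * vVec y 2 = 0 := he 4
  have h5 : y .u * y .p1 - y .r * xVec y 0 +
      (y .q2 * sxVec y 2 - y .q3 * sxVec y 1) = 0 := he 5
  have hv1 : vVec y 1 ∈ A := add_mem (add_mem (add_mem (mul_mem hs12 hp1) (mul_mem hs22 hp2))
    (mul_mem hs23 hp3)) (mul_mem hp4 ht2)
  have hv2 : vVec y 2 ∈ A := add_mem (add_mem (add_mem (mul_mem hs13 hp1) (mul_mem hs23 hp2))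
    (mul_mem hs33 hp3)) (mul_mem hp4 ht3)
  have hq1 : y .q1 ∈ A := hmul _ (by
    rw [show y .p1 * y .q1 = -(y .p2 * y .q2 + y .p3 * y .q3) by linear_combination h0]
    exact neg_mem (add_mem (mul_mem hp2 hq2) (mul_mem hp3 hq3)))
  have hr : y .r ∈ A := hmul _ (by
    rw [show y .p1 * y .r = -(y .q2 * vVec y 2 - y .q3 * vVec y 1) by linear_combination h1]
    exact neg_mem (sub_mem (mul_mem hq2 hv2) (mul_mem hq3 hv1)))
  have hs11 : y .s11 ∈ A := hmul _ (hmul _ (by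
    rw [show y .p1 * (y .p1 * y .s11) = -(y .p1 * (y .s12 * y .p2 + y .s13 * y .p3 + y .p4 * y .t1) +
      y .p2 * vVec y 1 + y .p3 * vVec y 2) by linear_combination h4]
    exact neg_mem (add_mem (add_mem (mul_mem hp1 (add_mem (add_mem (mul_mem hs12 hp2)
      (mul_mem hs13 hp3)) (mul_mem hp4 ht1))) (mul_mem hp2 hv1)) (mul_mem hp3 hv2))))
  have hx : ∀ i, xVec y i ∈ A := by
    intro i
    match i with
    | 0 => exact sub_mem (mul_mem hq2 ht3) (mul_mem hq3 ht2)
    | 1 => exact sub_mem (mul_mem hq3 ht1) (mul_mem hq1 ht3)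
    | 2 => exact sub_mem (mul_mem hq1 ht2) (mul_mem hq2 ht1)
  have hsx1 : sxVec y 1 ∈ A :=
    add_mem (add_mem (mul_mem hs12 (hx 0)) (mul_mem hs22 (hx 1))) (mul_mem hs23 (hx 2))
  have hsx2 : sxVec y 2 ∈ A :=
    add_mem (add_mem (mul_mem hs13 (hx 0)) (mul_mem hs23 (hx 1))) (mul_mem hs33 (hx 2))
  have hu : y .u ∈ A := hmul _ (by
    rw [show y .p1 * y .u = y .r * xVec y 0 - (y .q2 * sxVec y 2 - y .q3 * sxVec y 1) by
      linear_combination h5]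
    exact sub_mem (mul_mem hr (hx 0)) (sub_mem (mul_mem hq2 hsx2) (mul_mem hq3 hsx1)))
  refine H.eq_top A fun v => ?_
  cases v
  exacts [hp1, hp2, hp3, hp4, hq1, hq2, hq3, hr, hu, hs11, hs12, hs13, hs22, hs23, hs33, ht1, ht2,
    ht3]

end KeyCoords

/-! ### The canonical divisor -/

lemma mul_mem_twistStalk_iff {σ : Type} {w : σ → ℤ} {I : Ideal (MvPolynomial σ ℂ)}
    [IsDomain (CoordRing I)] {𝔭 : Ideal (CoordRing I)} [𝔭.IsPrime] {m n k : ℤ} {a : CoordRing I}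
    (ha : a ∈ piece w I m) (ha' : a ∉ 𝔭) (hk : k = n + m) {f : FracField I} :
    f * algebraMap _ _ a ∈ twistStalk w I 𝔭 k ↔ f ∈ twistStalk w I 𝔭 n := by
  subst hk
  constructor
  · intro h
    have := twistStalk_mul h (twistStalk_inv ha ha')
    rwa [mul_inv_cancel_right₀ (toK_ne_zero (ne_zero_of_notMem ha')), add_neg_cancel_right] at this
  · intro h
    exact twistStalk_mul h (twistStalk_of_piece ha)

/-- A prime of height one that contains `a` does not contain an element that is a nonzerodivisor
modulo `a`. -/
lemma notMem_of_height_one {R : Type} [CommRing R] [IsDomain R] {𝔭 : Ideal R} [𝔭.IsPrime]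
    (h1 : 𝔭.height = 1) {a b : R} (ha : a ≠ 0) (ha' : a ∈ 𝔭)
    (h : ∀ c, b * c ∈ Ideal.span {a} → c ∈ Ideal.span {a}) : b ∉ 𝔭 := by
  intro hb
  have hmin : 𝔭 ∈ (Ideal.span {a}).minimalPrimes := by
    refine ⟨⟨inferInstance, by rwa [Ideal.span_singleton_le_iff_mem]⟩, ?_⟩
    rintro 𝔮 ⟨h𝔮, hle⟩ hq
    rw [Ideal.span_singleton_le_iff_mem] at hle
    exact (Chart.eq_of_le_of_height_one h1 hq fun h0 => ha (by rwa [h0] at hle)).ge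
  obtain ⟨c, hc, hc'⟩ := Ideal.exists_mul_mem_of_mem_minimalPrimes hmin hb
  exact hc (h c hc')

namespace KeyCoords

variable {σ : Type} {w : σ → ℤ} {I : Ideal (MvPolynomial σ ℂ)} {x : Var → MvPolynomial σ ℂ}
  {W : Var → ℤ} {cs : Finset Var}

/-- Multiplication by a power of the nonzerodivisor `u` takes a product that vanishes into a
polynomial ring. -/
lemma isDomain (H : KeyCoords w I x W cs) : IsDomain (CoordRing I) := by
  have hinj := H.injective_u
  have : Nontrivial (CoordRing I) := hinj.nontrivial
  have hu : ∀ (N : ℕ) (a : CoordRing I), Ideal.Quotient.mk I (x .u) ^ N * a = 0 → a = 0 := by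
    intro N
    induction N with
    | zero => intro a h; simpa using h
    | succ N ih =>
      intro a h
      apply ih
      obtain ⟨b, hb⟩ := Ideal.Quotient.mk_surjective (Ideal.Quotient.mk I (x .u) ^ N * a)
      rw [pow_succ', mul_assoc, ← hb, ← map_mul, Ideal.Quotient.eq_zero_iff_mem] at h
      rw [← hb, Ideal.Quotient.eq_zero_iff_mem]
      exact H.nz_u b h
  have : NoZeroDivisors (CoordRing I) := by
    refine ⟨fun {a b} hab => ?_⟩
    have hnum : ∀ a : CoordRing I, a ∈ numeratorAlgebra
        (fun i : Option (Fin 3 ⊕ cs) => Ideal.Quotient.mk I (x (uVars i))) := by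
      intro a
      rw [H.numeratorAlgebra_u]
      trivial
    obtain ⟨N, F, hF⟩ := hnum a
    obtain ⟨M, G, hG⟩ := hnum b
    have hFG : F * G = 0 := by
      apply hinj
      rw [map_mul, ← hF, ← hG, map_zero, mul_mul_mul_comm, hab, mul_zero]
    rcases mul_eq_zero.1 hFG with rfl | rfl
    · rw [map_zero] at hF
      exact Or.inl (hu N a hF)
    · rw [map_zero] at hG
      exact Or.inr (hu M b hG)
  exact NoZeroDivisors.to_isDomain _

/-- The chart `u ≠ 0`. -/
def chartU (H : KeyCoords w I x W cs) : Chart w I (Fin 3 ⊕ cs) :=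
  Chart.mk' H.homogeneous (fun i => x (uVars i)) (fun i => W (uVars i))
    (fun i => H.pos _ (by
      match i with
      | none => exact Or.inl (show Var.u ≠ .s33 by decide)
      | some (.inl 0) => exact Or.inl (show Var.q1 ≠ .s33 by decide)
      | some (.inl 1) => exact Or.inl (show Var.r ≠ .s33 by decide)
      | some (.inl 2) => exact Or.inl (show Var.s11 ≠ .s33 by decide)
      | some (.inr ⟨c, hc⟩) =>
        by_cases h : c = .s33
        · exact Or.inr (h ▸ hc)
        · exact Or.inl h))
    (fun _ => H.graded.hom _) H.injective_u H.numeratorAlgebra_u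

/-- The chart `p₁ ≠ 0`. -/
def chartP (H : KeyCoords w I x W cs) : Chart w I (Fin 3 ⊕ cs) :=
  Chart.mk' H.homogeneous (fun i => x (pVars i)) (fun i => W (pVars i))
    (fun i => H.pos _ (by
      match i with
      | none => exact Or.inl (show Var.p1 ≠ .s33 by decide)
      | some (.inl 0) => exact Or.inl (show Var.p2 ≠ .s33 by decide)
      | some (.inl 1) => exact Or.inl (show Var.p3 ≠ .s33 by decide)
      | some (.inl 2) => exact Or.inl (show Var.p4 ≠ .s33 by decide)
      | some (.inr ⟨c, hc⟩) =>
        by_cases h : c = .s33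
        · exact Or.inr (h ▸ hc)
        · exact Or.inl h))
    (fun _ => H.graded.hom _) H.injective_p H.numeratorAlgebra_p

lemma chartU_deg (H : KeyCoords w I x W cs) [IsDomain (CoordRing I)] (i : Option (Fin 3 ⊕ cs)) :
    H.chartU.deg i = W (uVars i) := by
  have := H.chartU.wt_pos i
  show ((W (uVars i)).toNat : ℤ) = _
  change 0 < (W (uVars i)).toNat at this
  omega

lemma chartP_deg (H : KeyCoords w I x W cs) [IsDomain (CoordRing I)] (i : Option (Fin 3 ⊕ cs)) :
    H.chartP.deg i = W (pVars i) := by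
  have := H.chartP.wt_pos i
  show ((W (pVars i)).toNat : ℤ) = _
  change 0 < (W (pVars i)).toNat at this
  omega

/-- When `s₃₃ = 1` is not a chart coordinate, its weight vanishes. -/
lemma sum_common (H : KeyCoords w I x W cs) : ∑ c : cs, W c = ∑ v ∈ commonVars, W v := by
  rw [Finset.sum_coe_sort cs W]
  refine Finset.sum_subset H.subset fun v hv hv' => ?_
  obtain ⟨-, h⟩ := (H.mem_or v hv).resolve_left hv'
  have h1 := H.graded.hom v
  rw [h] at h1
  exact IsWeightedHomogeneous.inj_right one_ne_zero h1 (isWeightedHomogeneous_one ℂ w)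

lemma canonicalIndex_eq_u (H : KeyCoords w I x W cs) :
    -canonicalIndex W = -∑ i : Fin 3 ⊕ cs, W (uVars (some i)) + W .u := by
  have h : ∑ i : Fin 3 ⊕ cs, W (uVars (some i)) =
      W .q1 + W .r + W .s11 + ∑ v ∈ commonVars, W v := by
    rw [Fintype.sum_sum_type, Fin.sum_univ_three, ← H.sum_common]
    rfl
  have h2 : ∑ v ∈ commonVars, W v = W .q2 + W .q3 + W .s12 + W .s13 + W .s22 + W .s23 + W .s33 +
      W .t1 + W .t2 + W .t3 := by
    simp [commonVars]
    ring
  have hc := GradedCoords.c_eq W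
  have hd : d₀ W = W .p1 + W .q1 := rfl
  have hδ := delta_eq W
  obtain ⟨-, e2, e3, s11, s12, s13, s22, s23, s33, p4, t1, t2, t3⟩ := H.graded
  rw [h, h2, canonicalIndex]
  omega

lemma canonicalIndex_eq_p (H : KeyCoords w I x W cs) :
    -canonicalIndex W = -∑ i : Fin 3 ⊕ cs, W (pVars (some i)) + (W .p1 + W .p1) := by
  have h : ∑ i : Fin 3 ⊕ cs, W (pVars (some i)) =
      W .p2 + W .p3 + W .p4 + ∑ v ∈ commonVars, W v := by
    rw [Fintype.sum_sum_type, Fin.sum_univ_three, ← H.sum_common]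
    rfl
  have h2 : ∑ v ∈ commonVars, W v = W .q2 + W .q3 + W .s12 + W .s13 + W .s22 + W .s23 + W .s33 +
      W .t1 + W .t2 + W .t3 := by
    simp [commonVars]
    ring
  have hc := GradedCoords.c_eq W
  have hd : d₀ W = W .p1 + W .q1 := rfl
  have hδ := delta_eq W
  obtain ⟨-, e2, e3, s11, s12, s13, s22, s23, s33, p4, t1, t2, t3⟩ := H.graded
  rw [h, h2, canonicalIndex]
  omega

/-- The coordinates in the fraction field. -/
def frac (I : Ideal (MvPolynomial σ ℂ)) (x : Var → MvPolynomial σ ℂ) (v : Var) : FracField I :=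
  algebraMap (CoordRing I) (FracField I) (Ideal.Quotient.mk I (x v))

lemma det_logJacobian (H : KeyCoords w I x W cs) [IsDomain (CoordRing I)] :
    (Chart.logJacobian H.chartU H.chartP).det = frac I x .q1 * frac I x .r * frac I x .s11 *
      frac I x .p1 ^ 2 / (frac I x .u * frac I x .p2 * frac I x .p3 * frac I x .p4) := by
  have hU : ∀ i, H.chartU.xK i = frac I x (uVars i) := fun _ => rfl
  have hP : ∀ i, H.chartP.xK i = frac I x (pVars i) := fun _ => rfl
  have hfU : ∀ k, uVars (Chart.fourIndex cs k) = ![.u, .q1, .r, .s11] k := by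
    intro k; fin_cases k <;> rfl
  have hfP : ∀ k, pVars (Chart.fourIndex cs k) = ![.p1, .p2, .p3, .p4] k := by
    intro k; fin_cases k <;> rfl
  have hzero : ∀ i v, v ∈ commonVars → H.chartU.theta (Chart.fourIndex cs i) (frac I x v) = 0 := by
    intro i v hv
    rcases H.mem_or v hv with h | ⟨-, h⟩
    · have : frac I x v = H.chartU.xK (some (.inr ⟨v, h⟩)) := rfl
      rw [this, Chart.theta_xK, if_neg]
      fin_cases i <;> simp [Chart.fourIndex]
    · rw [frac, h, map_one, map_one]
      exact Derivation.map_one_eq_zero _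
  have hfour : ∀ i j, H.chartU.theta (Chart.fourIndex cs i)
      (frac I x (![.u, .q1, .r, .s11] j)) =
        if i = j then frac I x (![.u, .q1, .r, .s11] j) else 0 := by
    intro i j
    rw [← hfU j, ← hU, Chart.theta_xK]
    refine if_congr ?_ rfl rfl
    revert i j
    simp [Chart.fourIndex, Fin.forall_fin_succ]
  have he : ∀ i, equations (frac I x) i = 0 := by
    intro i
    have := congrArg (algebraMap (CoordRing I) (FracField I)) (H.equations_mk i)
    rw [map_equations, map_zero] at this
    exact this
  rw [equations_eq_pack9] at he
  have hne : ∀ i, ∀ v ∈ commonVars, v ≠ ![Var.u, .q1, .r, .s11] i := by decide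
  have hinj : ∀ i j, i = j ↔ ![Var.u, .q1, .r, .s11] j = ![Var.u, .q1, .r, .s11] i := by decide
  have hex : ∀ v, v ∉ commonVars → v ∉ ({.p1, .p2, .p3, .p4} : Finset Var) →
      ∃ j, v = ![Var.u, .q1, .r, .s11] j := by
    intro v
    cases v <;> decide
  have := KeyVariety.det_logJacobian (frac I x) (fun i => H.chartU.theta (Chart.fourIndex cs i))
    (fun i v hv => ?_) (fun k => ?_) (fun v hv => ?_)
  · rw [← this]
    congr 1
    ext i k
    simp only [Chart.logJacobian, Matrix.of_apply, hP, hfP]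
  · by_cases hc : v ∈ commonVars
    · rw [hzero i v hc, if_neg (hne i v hc)]
    · obtain ⟨j, rfl⟩ : ∃ j, v = ![.u, .q1, .r, .s11] j := hex v hc hv
      rw [hfour]
      exact if_congr (hinj i j) rfl rfl
  · match k with
    | 0 =>
      have h5 : frac I x .u * frac I x .p1 - frac I x .r * xVec (frac I x) 0 +
        crs (qVec (frac I x)) (sxVec (frac I x)) 0 = 0 := he 5
      show frac I x .u * frac I x .p1 = frac I x .r * xVec (frac I x) 0 -
        crs (qVec (frac I x)) (sxVec (frac I x)) 0
      linear_combination h5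
    | 1 =>
      have h5 : frac I x .u * frac I x .p2 - frac I x .r * xVec (frac I x) 1 +
        crs (qVec (frac I x)) (sxVec (frac I x)) 1 = 0 := he 6
      show frac I x .u * frac I x .p2 = frac I x .r * xVec (frac I x) 1 -
        crs (qVec (frac I x)) (sxVec (frac I x)) 1
      linear_combination h5
    | 2 =>
      have h5 : frac I x .u * frac I x .p3 - frac I x .r * xVec (frac I x) 2 +
        crs (qVec (frac I x)) (sxVec (frac I x)) 2 = 0 := he 7
      show frac I x .u * frac I x .p3 = frac I x .r * xVec (frac I x) 2 -
        crs (qVec (frac I x)) (sxVec (frac I x)) 2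
      linear_combination h5
    | 3 => exact eq_neg_of_add_eq_zero_left (he 8)
  · simp only [Finset.mem_insert, Finset.mem_singleton] at hv
    rcases hv with rfl | rfl | rfl | rfl | rfl
    · exact H.chartU.xK_ne_zero none
    · exact H.chartP.xK_ne_zero none
    · exact H.chartP.xK_ne_zero (some (.inl 0))
    · exact H.chartP.xK_ne_zero (some (.inl 1))
    · exact H.chartP.xK_ne_zero (some (.inl 2))

/-- The form `η` of the chart `u ≠ 0` and the section `u / ∏ xᵢ` of `O(-k)` have the same divisor. -/
theorem canonicalDivisorEq (H : KeyCoords w I x W cs) {n : ℕ} (e : Fin n ≃ Fin 3 ⊕ cs) :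
    CanonicalDivisorEq w I n (-canonicalIndex W) := by
  have := H.isDomain
  obtain ⟨η, hη, hform⟩ := H.chartU.exists_form e
  have hPU : ∏ i, H.chartU.xK (some i) ≠ 0 :=
    Finset.prod_ne_zero_iff.2 fun i _ => H.chartU.xK_ne_zero _
  have hu0 : frac I x .u ≠ 0 := H.chartU.xK_ne_zero none
  have hdegU : ∑ i, H.chartU.deg (some i) = ∑ i : Fin 3 ⊕ cs, W (uVars (some i)) :=
    Finset.sum_congr rfl fun i _ => H.chartU_deg _
  have hdegP : ∑ i, H.chartP.deg (some i) = ∑ i : Fin 3 ⊕ cs, W (pVars (some i)) :=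
    Finset.sum_congr rfl fun i _ => H.chartP_deg _
  have hpiece : ∀ v, Ideal.Quotient.mk I (x v) ∈ piece w I (W v) :=
    fun v => ⟨x v, H.graded.hom v, rfl⟩
  have hx0 : ∀ v, frac I x v ≠ 0 → Ideal.Quotient.mk I (x v) ≠ 0 := by
    intro v h h0
    rw [frac, h0, map_zero] at h
    exact h rfl
  refine ⟨η, hη, (∏ i, H.chartU.xK (some i))⁻¹ * frac I x .u, ?_, mul_ne_zero (inv_ne_zero hPU) hu0,
    ?_⟩
  · rw [rationalSections_eq]
    refine (mul_mem_twistStalk_iff (hpiece .u) (hx0 _ hu0) H.canonicalIndex_eq_u).2 ?_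
    rw [← hdegU, ← Finset.prod_inv_distrib, ← Finset.sum_neg_distrib]
    exact twistStalk_prod _ fun i _ => twistStalk_inv (H.chartU.mem _) (H.chartU.x_ne_zero _)
  · rintro 𝔭 ⟨⟨h𝔭, -⟩, h1⟩
    rw [hform]
    ext h
    show h ∈ detSpan H.chartU.der (localRing w I 𝔭) ↔ (h : FracField I) * (_ * _) ∈
      twistStalk w I 𝔭 (-canonicalIndex W)
    -- A point of codimension one with `u = 0` lies in the chart `p₁ ≠ 0`.
    by_cases hu : Ideal.Quotient.mk I (x .u) ∈ 𝔭
    · have hp1 : Ideal.Quotient.mk I (x .p1) ∉ 𝔭 := by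
        refine notMem_of_height_one h1 (hx0 _ hu0) hu fun c hc => ?_
        obtain ⟨c, rfl⟩ := Ideal.Quotient.mk_surjective c
        have key : ∀ f : MvPolynomial σ ℂ, Ideal.Quotient.mk I f ∈
            Ideal.span {Ideal.Quotient.mk I (x .u)} ↔ f ∈ I ⊔ Ideal.span {x .u} := by
          intro f
          rw [mem_sup_span, Ideal.mem_span_singleton']
          constructor
          · rintro ⟨a, ha⟩
            obtain ⟨a, rfl⟩ := Ideal.Quotient.mk_surjective a
            refine ⟨a, ?_⟩
            rw [← Ideal.Quotient.eq, ← ha, map_mul, mul_comm]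
          · rintro ⟨a, ha⟩
            refine ⟨Ideal.Quotient.mk I a, ?_⟩
            rw [← Ideal.Quotient.eq] at ha
            rw [ha, map_mul, mul_comm]
        rw [← map_mul, key] at hc
        rw [key]
        exact H.nz_p1 c hc
      have hJ := H.det_logJacobian
      have e1 : ∏ i, H.chartU.xK (some i) = frac I x .q1 * frac I x .r * frac I x .s11 *
          ∏ c : cs, frac I x c := by
        rw [Fintype.prod_sum_type, Fin.prod_univ_three]; rfl
      have e2 : ∏ i, H.chartP.xK (some i) = frac I x .p2 * frac I x .p3 * frac I x .p4 *
          ∏ c : cs, frac I x c := by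
        rw [Fintype.prod_sum_type, Fin.prod_univ_three]; rfl
      have hPP : ∏ i, H.chartP.xK (some i) ≠ 0 :=
        Finset.prod_ne_zero_iff.2 fun i _ => H.chartP.xK_ne_zero _
      have hp10 : frac I x .p1 ≠ 0 := H.chartP.xK_ne_zero none
      rw [e1] at hPU
      rw [e2] at hPP
      simp only [mul_ne_zero_iff] at hPU hPP
      obtain ⟨⟨⟨hq1, hr⟩, hs⟩, hC⟩ := hPU
      obtain ⟨⟨⟨hp2, hp3⟩, hp4⟩, -⟩ := hPP
      rw [Chart.mem_detSpan_change_chart H.chartU H.chartP (fun c => rfl) (by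
        rw [hJ]
        exact div_ne_zero (by simp [hq1, hr, hs, hp10]) (by simp [hu0, hp2, hp3, hp4])) h1 hp1,
        ← mul_mem_twistStalk_iff (k := -canonicalIndex W) (mul_mem_piece w I (hpiece .p1) (hpiece .p1))
        (fun h => (h𝔭.mem_or_mem h).elim hp1 hp1) (by rw [hdegP]; exact H.canonicalIndex_eq_p), hJ,
        e1, e2, map_mul]
      convert Iff.rfl using 2
      change _ = (h : FracField I) * _ * _ * (frac I x .p1 * frac I x .p1)
      field_simp
    · rw [H.chartU.mem_detSpan_iff h1 hu, ← mul_assoc]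
      exact (mul_mem_twistStalk_iff (hpiece .u) hu
        (by rw [hdegU]; exact H.canonicalIndex_eq_u)).symm

end KeyCoords

lemma keyCoords14 {w : Var → ℤ} (hw : IsWeightSystem equations14 w) (hpos : ∀ v, 0 < w v) :
    KeyCoords w ideal14 X w commonVars where
  graded := gradedCoords14 hw
  pos v _ := hpos v
  ideal_eq := rfl
  hom := hw
  subset := subset_rfl
  mem_or _ hv := Or.inl hv
  adjoin := adjoin_range_X
  point v _ := ⟨aeval v, fun z => aeval_X v z⟩
  nz_u := nz14_u
  nz_p1 := nz14_p1

lemma keyCoords13 {w : Var13 → ℤ} (hw : IsWeightSystem equations13 w) (hpos : ∀ v, 0 < w v) :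
    KeyCoords w ideal13 coord13 (extendWeight w) (commonVars.erase .s33) where
  graded := gradedCoords13 hw
  pos v hv := by
    have hv' : v ≠ .s33 := hv.resolve_right (Finset.notMem_erase _ _)
    rw [extendWeight, dif_neg hv']
    exact hpos _
  ideal_eq := rfl
  hom := hw
  subset := Finset.erase_subset _ _
  mem_or v hv := by
    by_cases h : v = .s33
    · exact Or.inr ⟨h, h ▸ coord13_s33⟩
    · exact Or.inl (Finset.mem_erase.2 ⟨h, hv⟩)
  adjoin := by
    rw [eq_top_iff, ← adjoin_range_X]
    refine Algebra.adjoin_mono ?_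
    rintro _ ⟨v, rfl⟩
    exact ⟨v, coord13_of_ne v.2⟩
  point v hv := by
    have hv' : v .s33 = 1 := hv.resolve_left (Finset.notMem_erase _ _)
    refine ⟨aeval fun z => v z, fun z => ?_⟩
    by_cases h : z = .s33
    · rw [h, coord13_s33, map_one, hv']
    · rw [coord13_of_ne h, aeval_X]
  nz_u := nz13_u
  nz_p1 := nz13_p1

theorem canonicalDivisorEq14 {w : Var → ℤ} (hw : IsWeightSystem equations14 w)
    (hpos : ∀ v, 0 < w v) : CanonicalDivisorEq w ideal14 13 (-canonicalIndex w) :=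
  (keyCoords14 hw hpos).canonicalDivisorEq
    (Fintype.equivFinOfCardEq (by
      rw [Fintype.card_sum, Fintype.card_fin, Fintype.card_coe]; rfl)).symm

theorem canonicalDivisorEq13 {w : Var13 → ℤ} (hw : IsWeightSystem equations13 w)
    (hpos : ∀ v, 0 < w v) :
    CanonicalDivisorEq w ideal13 12 (-canonicalIndex (extendWeight w)) :=
  (keyCoords13 hw hpos).canonicalDivisorEq
    (Fintype.equivFinOfCardEq (by
      rw [Fintype.card_sum, Fintype.card_fin, Fintype.card_coe]; rfl)).symm

end KeyVariety

end

theorem proposition4p1 :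
    -- the variety `Σ¹⁴` and its weighted projectivization of dimension `13`
    ((∃ F : KeyVariety.Resolution916 KeyVariety.ideal14,
        ∀ w : KeyVariety.Var → ℤ,
          KeyVariety.IsWeightSystem KeyVariety.equations14 w → F.IsGraded w w) ∧
      ∀ w : KeyVariety.Var → ℤ,
        KeyVariety.IsWeightSystem KeyVariety.equations14 w → (∀ v, 0 < w v) →
          KeyVariety.CanonicalDivisorEq w KeyVariety.ideal14 13
            (-KeyVariety.canonicalIndex w)) ∧
    -- the variety `Σ¹³` and its weighted projectivization of dimension `12`
    ((∃ F : KeyVariety.Resolution916 KeyVariety.ideal13,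
        ∀ w : KeyVariety.Var13 → ℤ,
          KeyVariety.IsWeightSystem KeyVariety.equations13 w →
            F.IsGraded w (KeyVariety.extendWeight w)) ∧
      ∀ w : KeyVariety.Var13 → ℤ,
        KeyVariety.IsWeightSystem KeyVariety.equations13 w → (∀ v, 0 < w v) →
          KeyVariety.CanonicalDivisorEq w KeyVariety.ideal13 12
            (-KeyVariety.canonicalIndex (KeyVariety.extendWeight w))) := by
  exact ⟨⟨KeyVariety.exists_resolution14, fun _ hw hpos => KeyVariety.canonicalDivisorEq14 hw hpos⟩,
    KeyVariety.exists_resolution13, fun _ hw hpos => KeyVariety.canonicalDivisorEq13 hw hpos⟩
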